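/- Let $p$ be a prime and let $G=\mathbb Z/p$. Let $X$ be a finite-dimensional $G$-CW-complex, that is, a finite-dimensional CW-complex with an action of $G$ by homeomorphisms that permutes the open cells of each dimension and is such that every $g\in G$ which maps a cell to itself fixes that cell pointwise. Let $X^G\subseteq X$ be the fixed point set, with the subspace topology, and let $H_\bullet(-;\mathbb Z/p)$ denote homology with coefficients in $\mathbb Z/p$. 1. If $H_\bullet(X;\mathbb Z/p)\cong H_\bullet(S^n;\mathbb Z/p)$ for some $n\ge 0$, then either $X^G=\emptyset$ or $H_\bullet(X^G;\mathbb Z/p)\cong H_\bullet(S^m;\mathbb Z/p)$ for some $m\ge 0$. 2. If $H_\bullet(X;\mathbb Z/p)\cong H_\bullet(\mathrm{pt};\mathbb Z/p)$, then $H_\bullet(X^G;\mathbb Z/p)\cong H_\bullet(\mathrm{pt};\mathbb Z/p)$. Here $\cong$ means that the homology groups are isomorphic in every degree. -/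

import Mathlib

open CategoryTheory

universe u

/-- A CW structure on the (Hausdorff) space `X`, on which the discrete group `G` acts by
homeomorphisms, is a `G`-CW structure if the action is cellular, i.e. every `g : G` carries each
open `n`-cell onto an open `n`-cell, and if moreover every `g : G` that maps an open cell onto
itself fixes that cell pointwise. -/
structure IsGCWComplex (G : Type*) [Group G] (X : Type u) [TopologicalSpace X] [MulAction G X]
    [ContinuousConstSMul G X] [Topology.CWComplex (Set.univ : Set X)] : Prop where
  /-- The action permutes the open cells of each dimension. -/
  exists_image_openCell_eq (g : G) (n : ℕ)
      (i : Topology.RelCWComplex.cell (Set.univ : Set X) n) :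
    ∃ j : Topology.RelCWComplex.cell (Set.univ : Set X) n,
      (fun x : X ↦ g • x) '' Topology.RelCWComplex.openCell n i =
        Topology.RelCWComplex.openCell n j
  /-- A group element that stabilizes a cell fixes it pointwise. -/
  smul_eq_of_image_openCell_eq (g : G) (n : ℕ)
      (i : Topology.RelCWComplex.cell (Set.univ : Set X) n)
      (h : (fun x : X ↦ g • x) '' Topology.RelCWComplex.openCell n i =
        Topology.RelCWComplex.openCell n i) :
    ∀ x ∈ Topology.RelCWComplex.openCell n i, g • x = x

/-- The singular homology group `H_k(X; ℤ/p)`, as a module over `ℤ/p`. -/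
noncomputable def modPHomology (p k : ℕ) (X : TopCat.{u}) : ModuleCat.{u} (ZMod p) :=
  ((AlgebraicTopology.singularHomologyFunctor (ModuleCat.{u} (ZMod p)) k).obj
    (ModuleCat.of (ZMod p) (ULift.{u} (ZMod p)))).obj X

/-- `H_•(X; ℤ/p) ≅ H_•(Y; ℤ/p)` as graded vector spaces: in every degree the two homology groups
are isomorphic (no map between the spaces is required). -/
def SameModPHomology (p : ℕ) (X Y : TopCat.{u}) : Prop :=
  ∀ k : ℕ, Nonempty (modPHomology p k X ≅ modPHomology p k Y)

/-- `X` has the mod `p` homology of the sphere `S^n`, the unit sphere of `ℝ^(n+1)`. -/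
def IsModPHomologySphere (p n : ℕ) (X : TopCat.{u}) : Prop :=
  SameModPHomology p X (TopCat.sphere.{u} n)

/-- `X` is mod `p` acyclic: it has the mod `p` homology of a point. -/
def IsModPAcyclic (p : ℕ) (X : TopCat.{u}) : Prop :=
  SameModPHomology p X (TopCat.of PUnit.{u + 1})

/-! The proof is Smith theory on singular chains. Let `g` generate `G` and let `t = g - 1` act on
the augmented singular chains `C` of `X` over `ZMod p`. Since `g` permutes the singular simplices
and fixes exactly those lying in `X^G`, each chain module is the sum of the trivial module `C(X^G)`
and a free module over `(ZMod p)[t]/(t^p)`. Hence `ker t^j = im t^(p-j) ⊕ C(X^G)` for `0 < j < p`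
(`exists_eq_permSubOne_pow_add`), which gives short exact sequences of complexes `0 → im t^(p-j) ⊕
C(X^G) → C → im t^j → 0` and `0 → im t^(p-1) → im t^j → im t^(j+1) → 0`.

If the homology of `im t^(p-1)` vanishes in high degrees, the long exact sequences yield the Smith
inequality `dim H_n(im t^j) + ∑_{i ≥ n} dim H_i(X^G) ≤ ∑_{i ≥ n} dim H_i(X)` for reduced homology
(`SmithData.image_add_sum_fixed_le`). So `X^G` is acyclic if `X` is, and has total reduced dimension
at most one if `X` is a homology sphere. Total dimension zero is impossible in the second case: the
homology of `im t^j` would then sit in a single degree, with dimensions `a_j` satisfying `a_j = (p -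
j) a_(p-1)` and `a_j + a_(p-j) = 1`, whence `p * a_(p-1) = 1`. In reduced homology the empty set is
the sphere of dimension `-1`, so the case of empty `X^G` needs no separate count.

The vanishing is where finite dimensionality enters; it is not automatic, since singular chains
exist in all degrees. The operator `t^(p-1)` is the norm of the group ring. Subdivision and prism
operators are natural, so they commute with it, and norms satisfy invariance under equivariant
deformation and a Mayer–Vietoris argument. One inducts over skeleta
(`IsGCWComplex.normAcyclicAt_skeletonLT`): a skeleton is covered by the complement of the centres of
its top cells, which retracts radially and equivariantly onto the previous skeleton, and by the
union of its top open cells. This union and the overlap split into open or punctured cells permuted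
by `G`, a preserved cell being fixed pointwise.

Chains are indexed by the number of vertices: index `n` is degree `n - 1`, index `0` is the
augmentation, and `S^n` has its reduced homology in index `n + 1`. Homotopy invariance, small
simplices and the homology of spheres are proved for these concrete chains, which are compared with
Mathlib's singular homology at the end. -/

/-! ### Chains on finite tuples -/

section TupleChains

variable (R : Type*) [CommRing R] {K K' : Type*}

/-- Formal linear combinations of `n`-tuples of elements of `K`; the `n`-tuples play the role of
`(n - 1)`-simplices, so that the empty tuple spans the augmentation. -/
abbrev TupleChain (K : Type*) (n : ℕ) := (Fin n → K) →₀ R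

namespace TupleChain

/-- The alternating sum of the faces. -/
noncomputable def boundary (n : ℕ) : TupleChain R K (n + 1) →ₗ[R] TupleChain R K n :=
  Finsupp.linearCombination R fun v ↦
    ∑ i : Fin (n + 1), Finsupp.single (fun j ↦ v (i.succAbove j)) ((-1) ^ (i : ℕ))

/-- The map induced by a map of vertices. -/
noncomputable def map (f : K → K') (n : ℕ) : TupleChain R K n →ₗ[R] TupleChain R K' n :=
  Finsupp.lmapDomain R R fun v j ↦ f (v j)

/-- Adding a new zeroth vertex. -/
noncomputable def cone (b : K) (n : ℕ) : TupleChain R K n →ₗ[R] TupleChain R K (n + 1) :=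
  Finsupp.lmapDomain R R fun v ↦ (Fin.cons b v : Fin (n + 1) → K)

variable {R}

@[simp]
lemma boundary_single {n : ℕ} (v : Fin (n + 1) → K) (r : R) :
    boundary R n (Finsupp.single v r) =
      r • ∑ i : Fin (n + 1), Finsupp.single (fun j ↦ v (i.succAbove j)) ((-1) ^ (i : ℕ)) := by
  simp [boundary]

@[simp]
lemma map_single (f : K → K') {n : ℕ} (v : Fin n → K) (r : R) :
    map R f n (Finsupp.single v r) = Finsupp.single (fun j ↦ f (v j)) r := by
  simp [map]

@[simp]
lemma cone_single (b : K) {n : ℕ} (v : Fin n → K) (r : R) :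
    cone R b n (Finsupp.single v r) = Finsupp.single (Fin.cons b v : Fin (n + 1) → K) r := by
  simp [cone]

lemma map_boundary (f : K → K') {n : ℕ} (c : TupleChain R K (n + 1)) :
    map R f n (boundary R n c) = boundary R n (map R f (n + 1) c) := by
  induction c using Finsupp.induction_linear with
  | zero => simp
  | add x y hx hy => simp [hx, hy]
  | single v r => simp [map_sum]

lemma map_cone (f : K → K') (b : K) {n : ℕ} (c : TupleChain R K n) :
    map R f (n + 1) (cone R b n c) = cone R (f b) n (map R f n c) := by
  induction c using Finsupp.induction_linear with
  | zero => simp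
  | add x y hx hy => simp [hx, hy]
  | single v r =>
    simp only [cone_single, map_single]
    congr 1
    ext j
    refine Fin.cases ?_ (fun i ↦ ?_) j <;> simp

lemma boundary_cone_zero (b : K) (c : TupleChain R K 0) : boundary R 0 (cone R b 0 c) = c := by
  induction c using Finsupp.induction_linear with
  | zero => simp
  | add x y hx hy => simp [hx, hy]
  | single v r =>
    rw [cone_single, boundary_single, Fin.sum_univ_one, Finsupp.smul_single]
    congr 1
    simp

/-- The cone is a contracting homotopy. The chain identities for subdivision and prisms all follow
from this one by induction. -/
lemma boundary_cone (b : K) {n : ℕ} (c : TupleChain R K (n + 1)) :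
    boundary R (n + 1) (cone R b (n + 1) c) = c - cone R b n (boundary R n c) := by
  induction c using Finsupp.induction_linear with
  | zero => simp
  | add x y hx hy => simp only [map_add, hx, hy]; abel
  | single v r =>
    simp only [cone_single, boundary_single, map_smul, map_sum]
    rw [Fin.sum_univ_succ, smul_add, sub_eq_add_neg, ← smul_neg, ← Finset.sum_neg_distrib]
    congr 1
    · simp only [Fin.zero_succAbove, Fin.cons_succ, Fin.val_zero, pow_zero, Finsupp.smul_single,
        smul_eq_mul, mul_one]
    · congr 1
      refine Finset.sum_congr rfl fun i _ ↦ ?_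
      rw [← Finsupp.single_neg]
      congr 1
      · ext j
        refine Fin.cases ?_ (fun i ↦ ?_) j <;> simp
      · simp [pow_succ]

/-- Each tuple is the cone from its zeroth vertex over the rest, so the cone identity reduces the
claim by one dimension and no double sum of faces is needed. -/
lemma boundary_boundary {n : ℕ} (c : TupleChain R K (n + 2)) :
    boundary R n (boundary R (n + 1) c) = 0 := by
  induction n with
  | zero =>
    induction c using Finsupp.induction_linear with
    | zero => simp
    | add x y hx hy => simp [hx, hy]
    | single v r =>
      rw [← Fin.cons_self_tail v, ← cone_single, boundary_cone, map_sub, boundary_cone_zero,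
        sub_self]
  | succ n ih =>
    induction c using Finsupp.induction_linear with
    | zero => simp
    | add x y hx hy => simp [hx, hy]
    | single v r =>
      rw [← Fin.cons_self_tail v, ← cone_single, boundary_cone, map_sub, boundary_cone, ih]
      simp

variable (R) in
/-- Subdivision, where `b n v` is used as a barycenter of `v`. -/
noncomputable def subdiv (b : ∀ n, (Fin (n + 1) → K) → K) : ∀ n, TupleChain R K n →ₗ[R] TupleChain R K n
  | 0 => LinearMap.id
  | n + 1 => Finsupp.linearCombination R fun v ↦
      cone R (b n v) n (subdiv b n (boundary R n (Finsupp.single v 1)))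

lemma subdiv_succ_single (b : ∀ n, (Fin (n + 1) → K) → K) {n : ℕ} (v : Fin (n + 1) → K) (r : R) :
    subdiv R b (n + 1) (Finsupp.single v r) =
      r • cone R (b n v) n (subdiv R b n (boundary R n (Finsupp.single v 1))) := by
  simp [subdiv]

lemma boundary_subdiv (b : ∀ n, (Fin (n + 1) → K) → K) {n : ℕ} (c : TupleChain R K (n + 1)) :
    boundary R n (subdiv R b (n + 1) c) = subdiv R b n (boundary R n c) := by
  induction n with
  | zero =>
    induction c using Finsupp.induction_linear with
    | zero => simp
    | add x y hx hy => simp only [map_add, hx, hy]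
    | single v r =>
      rw [subdiv_succ_single, map_smul, boundary_cone_zero, ← map_smul, ← map_smul]; simp
  | succ n ih =>
    induction c using Finsupp.induction_linear with
    | zero => simp
    | add x y hx hy => simp only [map_add, hx, hy]
    | single v r =>
      rw [subdiv_succ_single, map_smul, boundary_cone, ih, boundary_boundary, map_zero, map_zero,
        sub_zero, ← map_smul, ← map_smul]
      simp

lemma map_subdiv (b : ∀ n, (Fin (n + 1) → K) → K) (b' : ∀ n, (Fin (n + 1) → K') → K') (f : K → K')
    (hf : ∀ n v, f (b n v) = b' n (fun j ↦ f (v j))) {n : ℕ} (c : TupleChain R K n) :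
    map R f n (subdiv R b n c) = subdiv R b' n (map R f n c) := by
  induction n with
  | zero => simp [subdiv]
  | succ n ih =>
    induction c using Finsupp.induction_linear with
    | zero => simp
    | add x y hx hy => simp only [map_add, hx, hy]
    | single v r =>
      rw [subdiv_succ_single, map_smul, map_cone, ih, map_boundary, map_single, map_single, hf,
        subdiv_succ_single]

variable (R) in
/-- A chain homotopy between the inclusion `v ↦ (v, j₀)` and the subdivided inclusion
`v ↦ (v, j₁)`. -/
noncomputable def prism {J : Type*} (j₀ j₁ : J) (b : ∀ n, (Fin (n + 1) → K) → K) :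
    ∀ n, TupleChain R K n →ₗ[R] TupleChain R (K × J) (n + 1)
  | 0 => 0
  | n + 1 => Finsupp.linearCombination R fun v ↦
      -- The bracket is the boundary that the homotopy formula prescribes. By induction it is a
      -- cycle, so coning it off produces a chain with that boundary.
      cone R (b n v, j₀) (n + 1)
        (map R (fun x ↦ (x, j₁)) (n + 1) (subdiv R b (n + 1) (Finsupp.single v 1))
          - map R (fun x ↦ (x, j₀)) (n + 1) (Finsupp.single v 1)
          - prism j₀ j₁ b n (boundary R n (Finsupp.single v 1)))

section prism

variable {J : Type*} (j₀ j₁ : J) (b : ∀ n, (Fin (n + 1) → K) → K)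

lemma prism_succ_single {n : ℕ} (v : Fin (n + 1) → K) (r : R) :
    prism R j₀ j₁ b (n + 1) (Finsupp.single v r) = r • cone R (b n v, j₀) (n + 1)
        (map R (fun x ↦ (x, j₁)) (n + 1) (subdiv R b (n + 1) (Finsupp.single v 1))
          - map R (fun x ↦ (x, j₀)) (n + 1) (Finsupp.single v 1)
          - prism R j₀ j₁ b n (boundary R n (Finsupp.single v 1))) := by
  simp [prism]

lemma map_zero_index (f g : K → K') (c : TupleChain R K 0) : map R f 0 c = map R g 0 c := by
  unfold map
  congr 2
  funext v
  exact Subsingleton.elim _ _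

lemma boundary_prism {n : ℕ} (c : TupleChain R K (n + 1)) :
    boundary R (n + 1) (prism R j₀ j₁ b (n + 1) c) =
      map R (fun x ↦ (x, j₁)) (n + 1) (subdiv R b (n + 1) c) - map R (fun x ↦ (x, j₀)) (n + 1) c
        - prism R j₀ j₁ b n (boundary R n c) := by
  induction n with
  | zero =>
    induction c using Finsupp.induction_linear with
    | zero => simp
    | add x y hx hy => simp only [map_add, hx, hy]; abel
    | single v r =>
      rw [prism_succ_single, map_smul, boundary_cone]
      simp only [map_sub]
      rw [← map_boundary, boundary_subdiv, ← map_boundary,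
        map_zero_index (fun x : K ↦ (x, j₁)) (fun x : K ↦ (x, j₀))]
      have h0 : subdiv R b 0 (boundary R 0 (Finsupp.single v 1)) =
        boundary R 0 (Finsupp.single v 1) := rfl
      have h1 (c) : prism R j₀ j₁ b 0 c = 0 := rfl
      rw [h0, h1, h1, sub_self, map_zero, map_zero, sub_zero, sub_zero, sub_zero, sub_zero]
      simp only [smul_sub, ← map_smul, Finsupp.smul_single, smul_eq_mul, mul_one]
  | succ n ih =>
    induction c using Finsupp.induction_linear with
    | zero => simp
    | add x y hx hy => simp only [map_add, hx, hy]; abel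
    | single v r =>
      rw [prism_succ_single, map_smul, boundary_cone, map_sub (boundary R (n + 1)),
        map_sub (boundary R (n + 1)), ih, boundary_boundary,
        ← map_boundary, boundary_subdiv, ← map_boundary, map_zero, sub_zero, sub_self, map_zero,
        sub_zero]
      simp only [smul_sub, ← map_smul, Finsupp.smul_single, smul_eq_mul, mul_one]

lemma map_prism (b' : ∀ n, (Fin (n + 1) → K') → K') (f : K → K')
    (hf : ∀ n v, f (b n v) = b' n (fun j ↦ f (v j))) {n : ℕ} (c : TupleChain R K n) :
    map R (Prod.map f id) (n + 1) (prism R j₀ j₁ b n c) = prism R j₀ j₁ b' n (map R f n c) := by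
  induction n with
  | zero => simp [prism]
  | succ n ih =>
    induction c using Finsupp.induction_linear with
    | zero => simp
    | add x y hx hy => simp only [map_add, hx, hy]
    | single v r =>
      have key (j : J) (c : TupleChain R K (n + 1)) :
          map R (Prod.map f id) (n + 1) (map R (fun x ↦ (x, j)) (n + 1) c) =
            map R (fun x ↦ (x, j)) (n + 1) (map R f (n + 1) c) := by
        simp only [map, ← LinearMap.comp_apply, ← Finsupp.lmapDomain_comp]
        rfl
      rw [prism_succ_single, map_smul, map_cone, map_sub (map R _ _), map_sub (map R _ _), key, key, ih, map_boundary,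
        map_subdiv b b' f hf]
      simp only [map_single, prism_succ_single, Prod.map, hf, id]

end prism

end TupleChain

end TupleChains

/-! ### Affine maps between standard simplices -/

namespace stdSimplex

/-- The affine map from a standard simplex sending the vertices to the given points. -/
noncomputable def affine {m n : ℕ} (v : Fin m → stdSimplex ℝ (Fin n)) :
    C(stdSimplex ℝ (Fin m), stdSimplex ℝ (Fin n)) where
  toFun t := ⟨∑ i, t.1 i • (v i).1,
    (convex_stdSimplex ℝ (Fin n)).sum_mem (fun i _ ↦ t.2.1 i) t.2.2 fun i _ ↦ (v i).2⟩
  continuous_toFun := by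
    refine Continuous.subtype_mk (continuous_finsetSum _ fun i _ ↦ ?_) _
    exact ((continuous_apply i).comp continuous_subtype_val).smul continuous_const

lemma affine_coe {m n : ℕ} (v : Fin m → stdSimplex ℝ (Fin n)) (t : stdSimplex ℝ (Fin m)) :
    (affine v t).1 = ∑ i, t.1 i • (v i).1 := rfl

/-- The inclusion of the `i`-th face. -/
noncomputable def face {n : ℕ} (i : Fin (n + 1)) :
    C(stdSimplex ℝ (Fin n), stdSimplex ℝ (Fin (n + 1))) :=
  ⟨stdSimplex.map i.succAbove, stdSimplex.continuous_map _⟩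

lemma map_eq_affine {m n : ℕ} (f : Fin m → Fin n) (t : stdSimplex ℝ (Fin m)) :
    stdSimplex.map f t = affine (fun i ↦ vertex (f i)) t := by
  apply Subtype.ext
  funext j
  rw [affine_coe]
  change FunOnFinite.linearMap ℝ ℝ f t.1 j = _
  rw [FunOnFinite.linearMap_apply_apply, Finset.sum_apply, Finset.sum_filter]
  refine Finset.sum_congr rfl fun i _ ↦ ?_
  simp [Pi.single_apply, eq_comm]

lemma affine_comp_affine {l m n : ℕ} (w : Fin m → stdSimplex ℝ (Fin n))
    (v : Fin l → stdSimplex ℝ (Fin m)) :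
    (affine w).comp (affine v) = affine fun i ↦ affine w (v i) := by
  ext1 t
  apply Subtype.ext
  simp only [ContinuousMap.comp_apply, affine_coe, Finset.smul_sum, Finset.sum_apply,
    Finset.sum_smul, Pi.smul_apply, smul_eq_mul, mul_smul]
  exact Finset.sum_comm

lemma affine_vertex_apply {m n : ℕ} (v : Fin m → stdSimplex ℝ (Fin n)) (i : Fin m) :
    affine v (vertex i) = v i := by
  apply Subtype.ext
  rw [affine_coe]
  simp [Pi.single_apply]

lemma affine_vertex (n : ℕ) :
    affine (vertex : Fin n → stdSimplex ℝ (Fin n)) = ContinuousMap.id _ := by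
  ext1 t
  simpa using (map_eq_affine id t).symm

lemma face_eq_affine {n : ℕ} (i : Fin (n + 1)) : face i = affine fun j ↦ vertex (i.succAbove j) := by
  ext1 t
  exact map_eq_affine _ _

lemma affine_comp_face {m n : ℕ} (v : Fin (m + 1) → stdSimplex ℝ (Fin n)) (i : Fin (m + 1)) :
    (affine v).comp (face i) = affine fun j ↦ v (i.succAbove j) := by
  simp [face_eq_affine, affine_comp_affine, affine_vertex_apply]

/-- The barycenter of finitely many points in a simplex. -/
noncomputable def center {d : ℕ} (n : ℕ) (v : Fin (n + 1) → stdSimplex ℝ (Fin d)) :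
    stdSimplex ℝ (Fin d) :=
  affine v barycenter

/-- Because affine maps preserve barycenters, subdivision and prism are compatible with faces and
descend to singular chains. -/
lemma affine_center {d e : ℕ} (w : Fin d → stdSimplex ℝ (Fin e)) (n : ℕ)
    (v : Fin (n + 1) → stdSimplex ℝ (Fin d)) :
    affine w (center n v) = center n fun i ↦ affine w (v i) := by
  rw [center, ← ContinuousMap.comp_apply, affine_comp_affine, center]

end stdSimplex

open stdSimplex

/-! ### Augmented singular chains -/

section

variable (R : Type*) [CommRing R] (Y : Type*) {Z W : Type*} [TopologicalSpace Y]
  [TopologicalSpace Z] [TopologicalSpace W]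

/-- Augmented singular chains, indexed by the number of vertices. -/
abbrev SingularChain (n : ℕ) := C(stdSimplex ℝ (Fin n), Y) →₀ R

variable {Y}

namespace SingularChain

/-- The alternating sum of the faces. -/
noncomputable def boundary (n : ℕ) : SingularChain R Y (n + 1) →ₗ[R] SingularChain R Y n :=
  Finsupp.linearCombination R fun s ↦
    ∑ i : Fin (n + 1), Finsupp.single (s.comp (face i)) ((-1) ^ (i : ℕ))

/-- The map induced by a continuous map. -/
noncomputable def map (f : C(Y, Z)) (n : ℕ) : SingularChain R Y n →ₗ[R] SingularChain R Z n :=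
  Finsupp.lmapDomain R R fun s ↦ f.comp s

/-- The singular chain attached to a chain of tuples of points in a simplex. -/
noncomputable def ofTuple {d : ℕ} (n : ℕ) :
    TupleChain R (stdSimplex ℝ (Fin d)) n →ₗ[R] SingularChain R (stdSimplex ℝ (Fin d)) n :=
  Finsupp.lmapDomain R R affine

/-- The singular chain attached to a chain of tuples of points in a product of two simplices. -/
noncomputable def ofTuplePair {d e : ℕ} (n : ℕ) :
    TupleChain R (stdSimplex ℝ (Fin d) × stdSimplex ℝ (Fin e)) n →ₗ[R]
      SingularChain R (stdSimplex ℝ (Fin d) × stdSimplex ℝ (Fin e)) n :=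
  Finsupp.lmapDomain R R fun v ↦ (affine fun i ↦ (v i).1).prodMk (affine fun i ↦ (v i).2)

variable {R}

@[simp]
lemma boundary_single {n : ℕ} (s : C(stdSimplex ℝ (Fin (n + 1)), Y)) (r : R) :
    boundary R n (Finsupp.single s r) =
      r • ∑ i : Fin (n + 1), Finsupp.single (s.comp (face i)) ((-1) ^ (i : ℕ)) := by
  simp [boundary]

@[simp]
lemma map_single (f : C(Y, Z)) {n : ℕ} (s : C(stdSimplex ℝ (Fin n), Y)) (r : R) :
    map R f n (Finsupp.single s r) = Finsupp.single (f.comp s) r := by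
  simp [map]

@[simp]
lemma ofTuple_single {d n : ℕ} (v : Fin n → stdSimplex ℝ (Fin d)) (r : R) :
    ofTuple R n (Finsupp.single v r) = Finsupp.single (affine v) r := by
  simp [ofTuple]

@[simp]
lemma ofTuplePair_single {d e n : ℕ} (v : Fin n → stdSimplex ℝ (Fin d) × stdSimplex ℝ (Fin e))
    (r : R) :
    ofTuplePair R n (Finsupp.single v r) =
      Finsupp.single ((affine fun i ↦ (v i).1).prodMk (affine fun i ↦ (v i).2)) r := by
  simp [ofTuplePair]

lemma map_map (g : C(Z, W)) (f : C(Y, Z)) {n : ℕ} (c : SingularChain R Y n) :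
    map R g n (map R f n c) = map R (g.comp f) n c := by
  simp only [map, ← LinearMap.comp_apply, ← Finsupp.lmapDomain_comp]
  rfl

lemma map_id {n : ℕ} (c : SingularChain R Y n) : map R (ContinuousMap.id Y) n c = c :=
  Finsupp.mapDomain_id

lemma map_boundary (f : C(Y, Z)) {n : ℕ} (c : SingularChain R Y (n + 1)) :
    map R f n (boundary R n c) = boundary R n (map R f (n + 1) c) := by
  induction c using Finsupp.induction_linear with
  | zero => simp
  | add x y hx hy => simp [hx, hy]
  | single v r => simp [map_sum, ContinuousMap.comp_assoc]

lemma ofTuple_boundary {d n : ℕ} (c : TupleChain R (stdSimplex ℝ (Fin d)) (n + 1)) :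
    ofTuple R n (c.boundary R n) = boundary R n (ofTuple R (n + 1) c) := by
  induction c using Finsupp.induction_linear with
  | zero => simp
  | add x y hx hy => simp [hx, hy]
  | single v r => simp [map_sum, affine_comp_face]

lemma ofTuplePair_boundary {d e n : ℕ}
    (c : TupleChain R (stdSimplex ℝ (Fin d) × stdSimplex ℝ (Fin e)) (n + 1)) :
    ofTuplePair R n (c.boundary R n) = boundary R n (ofTuplePair R (n + 1) c) := by
  induction c using Finsupp.induction_linear with
  | zero => simp
  | add x y hx hy => simp [hx, hy]
  | single v r =>
    simp only [TupleChain.boundary_single, map_smul, map_sum, ofTuplePair_single, boundary_single]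
    congr 1
    refine Finset.sum_congr rfl fun i _ ↦ ?_
    congr 1
    rw [← affine_comp_face (fun j ↦ (v j).1), ← affine_comp_face (fun j ↦ (v j).2)]
    rfl

lemma map_affine_ofTuple {d e n : ℕ} (w : Fin d → stdSimplex ℝ (Fin e))
    (c : TupleChain R (stdSimplex ℝ (Fin d)) n) :
    map R (affine w) n (ofTuple R n c) = ofTuple R n (c.map R (affine w) n) := by
  induction c using Finsupp.induction_linear with
  | zero => simp
  | add x y hx hy => simp [hx, hy]
  | single v r => simp [affine_comp_affine]

lemma map_affine_ofTuplePair {d d' e n : ℕ} (w : Fin d → stdSimplex ℝ (Fin d'))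
    (c : TupleChain R (stdSimplex ℝ (Fin d) × stdSimplex ℝ (Fin e)) n) :
    map R ((affine w).prodMap (ContinuousMap.id _)) n (ofTuplePair R n c) =
      ofTuplePair R n (c.map R (Prod.map (affine w) id) n) := by
  induction c using Finsupp.induction_linear with
  | zero => simp
  | add x y hx hy => simp [hx, hy]
  | single v r =>
    simp only [map_single, TupleChain.map_single, ofTuplePair_single, Prod.map_fst, Prod.map_snd,
      id, ← affine_comp_affine]
    rfl

/-- Every singular simplex is the image of the identity simplex, so natural identities only have to
be checked on tuple chains of a standard simplex. -/
lemma map_ofTuple_single {n : ℕ} (s : C(stdSimplex ℝ (Fin n), Y)) :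
    map R s n (ofTuple R n (Finsupp.single vertex 1)) = Finsupp.single s 1 := by
  simp [affine_vertex]

lemma tuple_map_face {n : ℕ} (i : Fin (n + 1)) :
    (TupleChain.map R (face i) n (Finsupp.single vertex 1)) =
      Finsupp.single (fun j ↦ vertex (i.succAbove j)) 1 := by
  simp [face_eq_affine, affine_vertex_apply]

/-- The tuple chain model of the boundary of the simplex. -/
lemma tuple_boundary_vertex (n : ℕ) :
    (TupleChain.boundary R n (Finsupp.single (vertex : _ → stdSimplex ℝ (Fin (n + 1))) 1)) =
      ∑ i : Fin (n + 1), (-1 : R) ^ (i : ℕ) • 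
        TupleChain.map R (face i) n (Finsupp.single vertex 1) := by
  simp only [tuple_map_face, TupleChain.boundary_single, one_smul]
  simp

/-- With the signs as scalars, operators defined on simplices with coefficient one can be applied
face by face. -/
lemma boundary_single' {n : ℕ} (s : C(stdSimplex ℝ (Fin (n + 1)), Y)) (r : R) :
    boundary R n (Finsupp.single s r) =
      r • ∑ i : Fin (n + 1), (-1 : R) ^ (i : ℕ) • Finsupp.single (s.comp (face i)) 1 := by
  simp

lemma boundary_boundary {n : ℕ} (c : SingularChain R Y (n + 2)) :
    boundary R n (boundary R (n + 1) c) = 0 := by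
  induction c using Finsupp.induction_linear with
  | zero => simp
  | add x y hx hy => simp [hx, hy]
  | single s r =>
    rw [← mul_one r, ← smul_eq_mul, ← Finsupp.smul_single, ← map_ofTuple_single, map_smul, map_smul,
      ← map_boundary, ← ofTuple_boundary, ← map_boundary, ← ofTuple_boundary,
      TupleChain.boundary_boundary]
    simp

variable (R) in
/-- Barycentric subdivision. -/
noncomputable def subdiv (n : ℕ) : SingularChain R Y n →ₗ[R] SingularChain R Y n :=
  Finsupp.linearCombination R fun s ↦
    map R s n (ofTuple R n (TupleChain.subdiv R center n (Finsupp.single vertex 1)))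

lemma subdiv_single {n : ℕ} (s : C(stdSimplex ℝ (Fin n), Y)) (r : R) :
    subdiv R n (Finsupp.single s r) = r •
    map R s n (ofTuple R n (TupleChain.subdiv R center n (Finsupp.single vertex 1))) := by
  simp [subdiv]

lemma map_subdiv (f : C(Y, Z)) {n : ℕ} (c : SingularChain R Y n) :
    map R f n (subdiv R n c) = subdiv R n (map R f n c) := by
  induction c using Finsupp.induction_linear with
  | zero => simp
  | add x y hx hy => simp [hx, hy]
  | single s r => simp [subdiv_single, map_map]

lemma subdiv_zero (c : SingularChain R Y 0) : subdiv R 0 c = c := by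
  induction c using Finsupp.induction_linear with
  | zero => simp
  | add x y hx hy => simp [hx, hy]
  | single s r =>
    rw [subdiv_single]
    change r • map R s 0 (ofTuple R 0 (Finsupp.single vertex 1)) = _
    rw [map_ofTuple_single]
    simp

lemma boundary_subdiv {n : ℕ} (c : SingularChain R Y (n + 1)) :
    boundary R n (subdiv R (n + 1) c) = subdiv R n (boundary R n c) := by
  induction c using Finsupp.induction_linear with
  | zero => simp
  | add x y hx hy => simp [hx, hy]
  | single s r =>
    rw [subdiv_single, map_smul, ← map_boundary, ← ofTuple_boundary, TupleChain.boundary_subdiv,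
      tuple_boundary_vertex, boundary_single']
    simp only [map_sum, map_smul, subdiv_single, one_smul]
    congr 1
    refine Finset.sum_congr rfl fun i _ ↦ ?_
    rw [face_eq_affine, ← TupleChain.map_subdiv _ _ _ (affine_center _), ← map_affine_ofTuple,
      map_map]

lemma subdiv_ofTuple {d n : ℕ} (c : TupleChain R (stdSimplex ℝ (Fin d)) n) :
    subdiv R n (ofTuple R n c) = ofTuple R n (c.subdiv R center n) := by
  induction c using Finsupp.induction_linear with
  | zero => simp
  | add x y hx hy => simp [hx, hy]
  | single v r =>
    rw [ofTuple_single, subdiv_single, map_affine_ofTuple,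
      TupleChain.map_subdiv _ _ _ (affine_center _), TupleChain.map_single, ← map_smul, ← map_smul,
      Finsupp.smul_single]
    simp [affine_vertex_apply]

variable (R) in
/-- The prism operator: a natural chain homotopy from the inclusion at the zeroth vertex to the
subdivision of the inclusion at the first vertex. -/
noncomputable def prism (n : ℕ) :
    SingularChain R Y n →ₗ[R] SingularChain R (Y × stdSimplex ℝ (Fin 2)) (n + 1) :=
  Finsupp.linearCombination R fun s ↦ map R (s.prodMap (ContinuousMap.id _)) (n + 1)
    (ofTuplePair R (n + 1)
      (TupleChain.prism R (vertex 0) (vertex 1) center n (Finsupp.single vertex 1)))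

lemma prism_single {n : ℕ} (s : C(stdSimplex ℝ (Fin n), Y)) (r : R) :
    prism R n (Finsupp.single s r) = r • map R (s.prodMap (ContinuousMap.id _)) (n + 1)
    (ofTuplePair R (n + 1)
      (TupleChain.prism R (vertex 0) (vertex 1) center n (Finsupp.single vertex 1))) := by
  simp [prism]

lemma map_prism (f : C(Y, Z)) {n : ℕ} (c : SingularChain R Y n) :
    map R (f.prodMap (ContinuousMap.id _)) (n + 1) (prism R n c) = prism R n (map R f n c) := by
  induction c using Finsupp.induction_linear with
  | zero => simp
  | add x y hx hy => simp [hx, hy]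
  | single s r =>
    simp only [prism_single, map_single, map_smul, map_map]
    rfl

lemma affine_const {m n : ℕ} (x : stdSimplex ℝ (Fin n)) :
    affine (fun _ : Fin m ↦ x) = ContinuousMap.const _ x := by
  ext1 t
  apply Subtype.ext
  rw [affine_coe, ← Finset.sum_smul, t.2.2, one_smul]
  rfl

lemma ofTuplePair_map_prodMk {d e n : ℕ} (y : stdSimplex ℝ (Fin e))
    (c : TupleChain R (stdSimplex ℝ (Fin d)) n) :
    ofTuplePair R n (c.map R (fun x ↦ (x, y)) n) =
      map R ((ContinuousMap.id _).prodMk (ContinuousMap.const _ y)) n (ofTuple R n c) := by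
  induction c using Finsupp.induction_linear with
  | zero => simp
  | add x y hx hy => simp [hx, hy]
  | single v r =>
    simp only [TupleChain.map_single, ofTuplePair_single, ofTuple_single, map_single, affine_const]
    rfl

lemma prism_zero (c : SingularChain R Y 0) : prism R 0 c = 0 := by
  induction c using Finsupp.induction_linear with
  | zero => simp
  | add x y hx hy => simp [hx, hy]
  | single s r => simp [prism_single, TupleChain.prism]

lemma boundary_prism {n : ℕ} (c : SingularChain R Y (n + 1)) :
    boundary R (n + 1) (prism R (n + 1) c) =
      map R ((ContinuousMap.id _).prodMk (ContinuousMap.const _ (vertex 1))) _ (subdiv R (n + 1) c)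
      - map R ((ContinuousMap.id _).prodMk (ContinuousMap.const _ (vertex 0))) _ c
      - prism R n (boundary R n c) := by
  induction c using Finsupp.induction_linear with
  | zero => simp
  | add x y hx hy => simp only [map_add, hx, hy]; abel
  | single s r =>
    have h1 : Finsupp.single s r = r • map R s (n + 1) (ofTuple R (n + 1) (Finsupp.single vertex 1)) := by
      simp [affine_vertex]
    rw [prism_single, map_smul, ← map_boundary, ← ofTuplePair_boundary, TupleChain.boundary_prism,
      tuple_boundary_vertex, boundary_single', map_sub, map_sub, map_sub, map_sub, smul_sub,
      smul_sub, ofTuplePair_map_prodMk, ofTuplePair_map_prodMk]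
    congr 2
    · rw [subdiv_single, map_smul, map_map, map_map]
      rfl
    · rw [h1, map_smul, map_map, map_map]
      rfl
    · simp only [map_sum, map_smul, prism_single, one_smul]
      congr 1
      refine Finset.sum_congr rfl fun i _ ↦ ?_
      rw [face_eq_affine, ← TupleChain.map_prism _ _ _ _ _ (affine_center _),
        ← map_affine_ofTuplePair, map_map]
      rfl

variable (R) in
/-- The chain homotopy attached to a homotopy. -/
noncomputable def homotopyOperator (h : C(Y × stdSimplex ℝ (Fin 2), Z)) (n : ℕ) :
    SingularChain R Y n →ₗ[R] SingularChain R Z (n + 1) :=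
  map R h (n + 1) ∘ₗ prism R n

/-- This serves two purposes: for a constant homotopy it shows that subdivision is homologous to the
identity on cycles, and with that known it gives homotopy invariance. -/
lemma boundary_homotopyOperator (h : C(Y × stdSimplex ℝ (Fin 2), Z)) {n : ℕ}
    (c : SingularChain R Y (n + 1)) :
    boundary R (n + 1) (homotopyOperator R h (n + 1) c) =
      subdiv R (n + 1)
        (map R (h.comp ((ContinuousMap.id _).prodMk (ContinuousMap.const _ (vertex 1)))) _ c)
      - map R (h.comp ((ContinuousMap.id _).prodMk (ContinuousMap.const _ (vertex 0)))) _ c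
      - homotopyOperator R h n (boundary R n c) := by
  simp only [homotopyOperator, LinearMap.comp_apply]
  rw [← map_boundary, boundary_prism, map_sub, map_sub, map_map, map_map, map_subdiv]

lemma homotopyOperator_zero (h : C(Y × stdSimplex ℝ (Fin 2), Z)) (c : SingularChain R Y 0) :
    homotopyOperator R h 0 c = 0 := by
  simp [homotopyOperator, prism_zero]

lemma map_homotopyOperator (h : C(Y × stdSimplex ℝ (Fin 2), Y)) (f : C(Y, Y))
    (hf : h.comp (f.prodMap (ContinuousMap.id _)) = f.comp h) {n : ℕ} (c : SingularChain R Y n) :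
    map R f (n + 1) (homotopyOperator R h n c) = homotopyOperator R h n (map R f n c) := by
  simp only [homotopyOperator, LinearMap.comp_apply]
  rw [map_map, ← hf, ← map_map, map_prism]

end SingularChain

end

open stdSimplex

/-! ### Subdivided simplices become small -/

section Mesh

variable {R : Type*} [CommRing R] {d : ℕ}

/-- The difference `v k - center` is the average of the `n + 1` differences `v k - v i`, one of
which vanishes. -/
lemma dist_center_le {n : ℕ} (v : Fin (n + 1) → stdSimplex ℝ (Fin d)) {δ : ℝ}
    (h : ∀ i j, dist (v i) (v j) ≤ δ) (k : Fin (n + 1)) :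
    dist (v k) (center n v) ≤ n / (n + 1) * δ := by
  have hc : (center n v).1 = ∑ i, ((n : ℝ) + 1)⁻¹ • (v i).1 := by
    rw [center, affine_coe]
    simp
  have hk : (v k).1 = ∑ i : Fin (n + 1), ((n : ℝ) + 1)⁻¹ • (v k).1 := by
    rw [Finset.sum_const, Finset.card_univ, Fintype.card_fin, ← Nat.cast_smul_eq_nsmul ℝ, smul_smul]
    push_cast
    rw [mul_inv_cancel₀ (by positivity), one_smul]
  rw [Subtype.dist_eq, dist_eq_norm, hc, hk, ← Finset.sum_sub_distrib]
  rw [← Finset.sum_erase_add _ _ (Finset.mem_univ k), ← smul_sub, sub_self, smul_zero, add_zero]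
  refine (norm_sum_le_of_le _ (f := fun i ↦ ((n : ℝ) + 1)⁻¹ • (v k).1 - ((n : ℝ) + 1)⁻¹ • (v i).1)
    (n := fun _ ↦ ((n : ℝ) + 1)⁻¹ * δ) fun i _ ↦ ?_).trans ?_
  · rw [← smul_sub, norm_smul, Real.norm_of_nonneg (by positivity)]
    have := h k i
    rw [Subtype.dist_eq, dist_eq_norm] at this
    gcongr
  · rw [Finset.sum_const, Finset.card_erase_of_mem (Finset.mem_univ k), Finset.card_univ,
      Fintype.card_fin, nsmul_eq_mul]
    apply le_of_eq
    rw [Nat.add_sub_cancel]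
    ring

/-- The tuples of diameter at most `δ` in the convex hull of a set. -/
def smallTuples (n : ℕ) (A : Set (Fin d → ℝ)) (δ : ℝ) : Set (Fin n → stdSimplex ℝ (Fin d)) :=
  {w | (∀ i, (w i).1 ∈ convexHull ℝ A) ∧ ∀ i j, dist (w i) (w j) ≤ δ}

/-- Two vertices of a piece either both come from a subdivided face, which is the inductive case, or
one is the barycenter, whose distance to any point of the hull is bounded by its distance to the
vertices. The factor of the top dimension `N` is used throughout so that it survives the induction
on faces. -/
lemma subdiv_mem_supported_smallTuples (N : ℕ) {n : ℕ} (hn : n ≤ N + 1) {A : Set (Fin d → ℝ)}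
    {δ : ℝ} {v : Fin n → stdSimplex ℝ (Fin d)} (hv : v ∈ smallTuples n A δ) (r : R) :
    TupleChain.subdiv R center n (Finsupp.single v r) ∈
      Finsupp.supported R R (smallTuples n A (N / (N + 1) * δ)) := by
  induction n generalizing A r with
  | zero =>
    refine Finsupp.single_mem_supported R r ⟨fun i ↦ i.elim0, fun i ↦ i.elim0⟩
  | succ n ih =>
    have hδ : 0 ≤ δ := dist_nonneg.trans (hv.2 0 0)
    have hq : (n : ℝ) / (n + 1) * δ ≤ N / (N + 1) * δ := by
      refine mul_le_mul_of_nonneg_right ?_ hδ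
      rw [div_le_div_iff₀ (by positivity) (by positivity)]
      have : (n : ℝ) ≤ N := by exact_mod_cast Nat.le_of_succ_le_succ hn
      nlinarith
    rw [TupleChain.subdiv_succ_single]
    refine Submodule.smul_mem _ _ ?_
    set B : Set (Fin d → ℝ) := Set.range fun i ↦ (v i).1 with hB
    have hBA : convexHull ℝ B ⊆ convexHull ℝ A := by
      refine convexHull_min ?_ (convex_convexHull ℝ A)
      rintro _ ⟨i, rfl⟩
      exact hv.1 i
    have hcB : (center n v).1 ∈ convexHull ℝ B := by
      rw [center, affine_coe]
      exact (convex_convexHull ℝ B).sum_mem (fun i _ ↦ barycenter.2.1 i) barycenter.2.2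
        fun i _ ↦ subset_convexHull ℝ B ⟨i, rfl⟩
    have hball : convexHull ℝ B ⊆ Metric.closedBall (center n v).1 (N / (N + 1) * δ) := by
      refine convexHull_min ?_ (convex_closedBall _ _)
      rintro _ ⟨i, rfl⟩
      exact (dist_center_le v hv.2 i).trans hq
    have h1 : TupleChain.subdiv R center n (TupleChain.boundary R n (Finsupp.single v 1)) ∈
        Finsupp.supported R R (smallTuples n B (N / (N + 1) * δ)) := by
      rw [TupleChain.boundary_single, map_smul, map_sum]
      refine Submodule.smul_mem _ _ (Submodule.sum_mem _ fun i _ ↦ ih (Nat.le_of_succ_le hn) ?_ _)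
      exact ⟨fun j ↦ subset_convexHull ℝ B ⟨_, rfl⟩, fun j k ↦ hv.2 _ _⟩
    have h2 : Finsupp.supported R R (smallTuples n B (N / (N + 1) * δ)) ≤
        (Finsupp.supported R R (smallTuples (n + 1) A (N / (N + 1) * δ))).comap
          (TupleChain.cone R (center n v) n) := by
      rw [Finsupp.supported_eq_span_single, Submodule.span_le]
      rintro _ ⟨w, hw, rfl⟩
      rw [Submodule.comap_coe, Set.mem_preimage, TupleChain.cone_single]
      refine Finsupp.single_mem_supported R _ ⟨fun i ↦ ?_, fun i j ↦ ?_⟩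
      · refine Fin.cases (hBA hcB) (fun i ↦ hBA (hw.1 i)) i
      · refine Fin.cases ?_ (fun i ↦ ?_) i <;> refine Fin.cases ?_ (fun j ↦ ?_) j
        · simp only [Fin.cons_zero, dist_self]; positivity
        · simp only [Fin.cons_zero, Fin.cons_succ]
          rw [dist_comm]
          exact hball (hw.1 j)
        · simp only [Fin.cons_zero, Fin.cons_succ]
          exact hball (hw.1 i)
        · exact hw.2 i j
    exact h2 h1

lemma subdiv_pow_mem_supported_smallTuples (N : ℕ) {n : ℕ} (hn : n ≤ N + 1) {A : Set (Fin d → ℝ)}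
    {δ : ℝ} {v : Fin n → stdSimplex ℝ (Fin d)} (hv : v ∈ smallTuples n A δ) (k : ℕ) :
    (TupleChain.subdiv R center n ^ k) (Finsupp.single v 1) ∈
      Finsupp.supported R R (smallTuples n A ((N / (N + 1)) ^ k * δ)) := by
  induction k with
  | zero => simpa using Finsupp.single_mem_supported R (1 : R) hv
  | succ k ih =>
    have : Finsupp.supported R R (smallTuples n A ((N / (N + 1)) ^ k * δ)) ≤
        (Finsupp.supported R R (smallTuples n A ((N / (N + 1)) ^ (k + 1) * δ))).comap
          (TupleChain.subdiv R center n) := by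
      rw [Finsupp.supported_eq_span_single, Submodule.span_le]
      rintro _ ⟨w, hw, rfl⟩
      rw [Submodule.comap_coe, Set.mem_preimage, pow_succ', mul_assoc]
      exact subdiv_mem_supported_smallTuples N hn hw 1
    rw [pow_succ' (TupleChain.subdiv R center n), Module.End.mul_apply]
    exact this ih

end Mesh

/-! ### Chains in a subset, and the small simplices theorem -/

namespace SingularChain

variable (R : Type*) [CommRing R] {Y Z : Type*} [TopologicalSpace Y] [TopologicalSpace Z]

/-- The chains whose simplices lie in `S`. -/
def chainsIn (S : Set Y) (n : ℕ) : Submodule R (SingularChain R Y n) :=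
  Finsupp.supported R R {s | Set.range s ⊆ S}

variable {R}

lemma chainsIn_eq_span (S : Set Y) (n : ℕ) : chainsIn R S n =
    Submodule.span R ((fun s : C(stdSimplex ℝ (Fin n), Y) ↦ Finsupp.single s (1 : R)) ''
      {s | Set.range s ⊆ S}) :=
  Finsupp.supported_eq_span_single R _

lemma single_mem_chainsIn {S : Set Y} {n : ℕ} {s : C(stdSimplex ℝ (Fin n), Y)}
    (hs : Set.range s ⊆ S) (r : R) : Finsupp.single s r ∈ chainsIn R S n :=
  Finsupp.single_mem_supported R r hs

lemma chainsIn_mono {S T : Set Y} (h : S ⊆ T) (n : ℕ) : chainsIn R S n ≤ chainsIn R T n :=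
  Finsupp.supported_mono fun _ hs ↦ hs.trans h

lemma chainsIn_univ (n : ℕ) : chainsIn R (Set.univ : Set Y) n = ⊤ := by
  simp [chainsIn]

/-- The simplex on no vertices is empty, so it lies in every subset. -/
lemma chainsIn_zero (S : Set Y) : chainsIn R S 0 = ⊤ := by
  rw [chainsIn, eq_top_iff]
  intro c _
  rw [Finsupp.mem_supported]
  rintro s - _ ⟨t, rfl⟩
  simpa using t.2.2

lemma chainsIn_empty (n : ℕ) : chainsIn R (∅ : Set Y) (n + 1) = ⊥ := by
  rw [chainsIn, eq_bot_iff]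
  intro c hc
  rw [Finsupp.mem_supported] at hc
  rw [Submodule.mem_bot, ← Finsupp.support_eq_empty, Finset.eq_empty_iff_forall_notMem]
  intro s hs
  exact hc hs ⟨vertex 0, rfl⟩

lemma chainsIn_inter (S T : Set Y) (n : ℕ) :
    chainsIn R S n ⊓ chainsIn R T n = chainsIn R (S ∩ T) n := by
  rw [chainsIn, chainsIn, ← Finsupp.supported_inter, chainsIn]
  congr 1
  ext s
  simp

lemma map_mem_chainsIn {S : Set Y} {T : Set Z} {f : C(Y, Z)} (hf : Set.MapsTo f S T) {n : ℕ}
    {c : SingularChain R Y n} (hc : c ∈ chainsIn R S n) : map R f n c ∈ chainsIn R T n := by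
  suffices chainsIn R S n ≤ (chainsIn R T n).comap (map R f n) from this hc
  rw [chainsIn_eq_span, Submodule.span_le]
  rintro _ ⟨s, hs, rfl⟩
  simp only [Submodule.comap_coe, Set.mem_preimage, map_single]
  refine single_mem_chainsIn ?_ _
  rintro _ ⟨t, rfl⟩
  exact hf (hs ⟨t, rfl⟩)

lemma map_mem_chainsIn_range (f : C(Y, Z)) {n : ℕ} (c : SingularChain R Y n) :
    map R f n c ∈ chainsIn R (Set.range f) n :=
  map_mem_chainsIn (S := Set.univ) (fun x _ ↦ Set.mem_range_self x)
    (by rw [chainsIn_univ]; trivial)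

lemma boundary_mem_chainsIn {S : Set Y} {n : ℕ}
    {c : SingularChain R Y (n + 1)} (hc : c ∈ chainsIn R S (n + 1)) :
    boundary R n c ∈ chainsIn R S n := by
  suffices chainsIn R S (n + 1) ≤ (chainsIn R S n).comap (boundary R n) from this hc
  rw [chainsIn_eq_span, Submodule.span_le]
  rintro _ ⟨s, hs, rfl⟩
  simp only [Submodule.comap_coe, Set.mem_preimage, boundary_single]
  refine Submodule.smul_mem _ _ (Submodule.sum_mem _ fun i _ ↦ single_mem_chainsIn ?_ _)
  exact (Set.range_comp_subset_range (face i) s).trans hs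

lemma subdiv_mem_chainsIn {S : Set Y} {n : ℕ}
    {c : SingularChain R Y n} (hc : c ∈ chainsIn R S n) : subdiv R n c ∈ chainsIn R S n := by
  suffices chainsIn R S n ≤ (chainsIn R S n).comap (subdiv R n) from this hc
  rw [chainsIn_eq_span, Submodule.span_le]
  rintro _ ⟨s, hs, rfl⟩
  simp only [Submodule.comap_coe, Set.mem_preimage, subdiv_single, one_smul]
  rw [← chainsIn_eq_span]
  exact chainsIn_mono hs n (map_mem_chainsIn_range s _)

lemma subdiv_pow_mem_chainsIn {S : Set Y} {n : ℕ}
    {c : SingularChain R Y n} (hc : c ∈ chainsIn R S n) (k : ℕ) :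
    (subdiv R n ^ k) c ∈ chainsIn R S n := by
  induction k with
  | zero => simpa using hc
  | succ k ih =>
    rw [pow_succ', Module.End.mul_apply]
    exact subdiv_mem_chainsIn ih

lemma map_subdiv_pow (f : C(Y, Z)) {n : ℕ} (c : SingularChain R Y n) (k : ℕ) :
    map R f n ((subdiv R n ^ k) c) = (subdiv R n ^ k) (map R f n c) := by
  induction k with
  | zero => simp
  | succ k ih => rw [pow_succ', Module.End.mul_apply, map_subdiv, ih, pow_succ', Module.End.mul_apply]

lemma map_injective {f : C(Y, Z)} (hf : Function.Injective f) (n : ℕ) :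
    Function.Injective (map R f n) := by
  refine Finsupp.mapDomain_injective fun s t h ↦ ?_
  ext1 x
  exact hf (DFunLike.congr_fun h x)

lemma exists_map_eq {S : Set Y} {n : ℕ} {c : SingularChain R Y n} (hc : c ∈ chainsIn R S n) :
    ∃ c' : SingularChain R S n, map R ⟨Subtype.val, continuous_subtype_val⟩ n c' = c := by
  suffices chainsIn R S n ≤
    LinearMap.range (map R (⟨Subtype.val, continuous_subtype_val⟩ : C(S, Y)) n) from this hc
  rw [chainsIn_eq_span, Submodule.span_le]
  rintro _ ⟨s, hs, rfl⟩
  refine ⟨Finsupp.single ⟨fun t ↦ ⟨s t, hs ⟨t, rfl⟩⟩, by fun_prop⟩ 1, ?_⟩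
  rw [map_single]
  rfl

lemma ofTuple_subdiv_pow {d n : ℕ} (c : TupleChain R (stdSimplex ℝ (Fin d)) n) (k : ℕ) :
    (subdiv R n ^ k) (ofTuple R n c) = ofTuple R n ((TupleChain.subdiv R center n ^ k) c) := by
  induction k with
  | zero => simp
  | succ k ih =>
    rw [pow_succ', Module.End.mul_apply, ih, subdiv_ofTuple, pow_succ', Module.End.mul_apply]

/-- Pull the cover back to the simplex, take a Lebesgue number, and subdivide until all pieces are
smaller. Keeping `Set.range s` in the conclusion lets chains of a subset stay in that subset. -/
lemma exists_subdiv_single_mem {O₁ O₂ : Set Y} (h₁ : IsOpen O₁) (h₂ : IsOpen O₂) {n : ℕ}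
    (s : C(stdSimplex ℝ (Fin n), Y)) (hs : Set.range s ⊆ O₁ ∪ O₂) :
    ∃ k, (subdiv R n ^ k) (Finsupp.single s 1) ∈
      chainsIn R (Set.range s ∩ O₁) n ⊔ chainsIn R (Set.range s ∩ O₂) n := by
  obtain _ | N := n
  · exact ⟨0, by simp [chainsIn_zero]⟩
  obtain ⟨ε, hε, H⟩ := lebesgue_number_lemma_of_metric (s := Set.univ)
    (c := fun b : Bool ↦ s ⁻¹' (cond b O₁ O₂)) isCompact_univ
    (by rintro (_ | _) <;> exact IsOpen.preimage s.continuous (by assumption))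
    (by
      intro x _
      rw [Set.mem_iUnion]
      rcases hs ⟨x, rfl⟩ with h | h
      exacts [⟨true, h⟩, ⟨false, h⟩])
  obtain ⟨k, hk⟩ := exists_pow_lt_of_lt_one hε
    (show (N : ℝ) / (N + 1) < 1 by rw [div_lt_one (by positivity)]; linarith)
  refine ⟨k, ?_⟩
  rw [← map_ofTuple_single, ← map_subdiv_pow, ofTuple_subdiv_pow]
  have hv : (vertex : _ → stdSimplex ℝ (Fin (N + 1))) ∈
      smallTuples (N + 1) (stdSimplex ℝ (Fin (N + 1))) 1 := by
    refine ⟨fun i ↦ subset_convexHull ℝ _ (vertex i).2, fun i j ↦ ?_⟩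
    exact (Metric.dist_le_diam_of_mem (bounded_stdSimplex _) (vertex i).2 (vertex j).2).trans
      diam_stdSimplex_le
  have h1 := subdiv_pow_mem_supported_smallTuples (R := R) N le_rfl hv k
  rw [mul_one] at h1
  suffices Finsupp.supported R R (smallTuples (N + 1) (stdSimplex ℝ (Fin (N + 1)))
      ((N / (N + 1)) ^ k)) ≤ (chainsIn R (Set.range s ∩ O₁) (N + 1) ⊔
        chainsIn R (Set.range s ∩ O₂) (N + 1)).comap (map R s (N + 1) ∘ₗ ofTuple R (N + 1)) from
    this h1
  rw [Finsupp.supported_eq_span_single, Submodule.span_le]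
  rintro _ ⟨w, hw, rfl⟩
  simp only [Submodule.comap_coe, Set.mem_preimage, LinearMap.comp_apply, ofTuple_single,
    map_single]
  -- All vertices of the piece lie in the ball around the zeroth one, and the ball is convex, so the
  -- whole piece does.
  obtain ⟨b, hb⟩ := H (w 0) trivial
  have h2 : ∀ t, affine w t ∈ Metric.ball (w 0) ε := by
    intro t
    have : (affine w t).1 ∈ Metric.ball (w 0).1 ε := by
      rw [affine_coe]
      refine (convex_ball _ _).sum_mem (fun i _ ↦ t.2.1 i) t.2.2 fun i _ ↦ ?_
      exact (hw.2 i 0).trans_lt hk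
    exact this
  rcases b with _ | _
  · refine Submodule.mem_sup_right (single_mem_chainsIn ?_ _)
    rintro _ ⟨t, rfl⟩
    exact ⟨⟨_, rfl⟩, hb (h2 t)⟩
  · refine Submodule.mem_sup_left (single_mem_chainsIn ?_ _)
    rintro _ ⟨t, rfl⟩
    exact ⟨⟨_, rfl⟩, hb (h2 t)⟩

/-- The small simplices theorem for a cover by two relatively open sets. -/
theorem exists_subdiv_pow_eq_add {S O₁ O₂ : Set Y} (h₁ : IsOpen O₁) (h₂ : IsOpen O₂)
    (hS : S ⊆ O₁ ∪ O₂) {n : ℕ} {c : SingularChain R Y n} (hc : c ∈ chainsIn R S n) :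
    ∃ k, ∃ a ∈ chainsIn R (S ∩ O₁) n, ∃ b ∈ chainsIn R (S ∩ O₂) n, (subdiv R n ^ k) c = a + b := by
  -- Different simplices need different exponents; since small chains stay small under subdivision,
  -- exponents of two summands can be added.
  have stable : ∀ l (x : SingularChain R Y n),
      x ∈ chainsIn R (S ∩ O₁) n ⊔ chainsIn R (S ∩ O₂) n →
      (subdiv R n ^ l) x ∈ chainsIn R (S ∩ O₁) n ⊔ chainsIn R (S ∩ O₂) n := by
    intro l x hx
    obtain ⟨a, ha, b, hb, rfl⟩ := Submodule.mem_sup.1 hx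
    rw [map_add]
    exact Submodule.add_mem_sup (subdiv_pow_mem_chainsIn ha l) (subdiv_pow_mem_chainsIn hb l)
  suffices ∃ k, (subdiv R n ^ k) c ∈ chainsIn R (S ∩ O₁) n ⊔ chainsIn R (S ∩ O₂) n by
    obtain ⟨k, hk⟩ := this
    obtain ⟨a, ha, b, hb, h⟩ := Submodule.mem_sup.1 hk
    exact ⟨k, a, ha, b, hb, h.symm⟩
  rw [chainsIn_eq_span] at hc
  induction hc using Submodule.span_induction with
  | mem x hx =>
    obtain ⟨s, hs, rfl⟩ := hx
    obtain ⟨k, hk⟩ := exists_subdiv_single_mem (R := R) h₁ h₂ s (Set.Subset.trans hs hS)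
    refine ⟨k, ?_⟩
    have hle : chainsIn R (Set.range s ∩ O₁) n ⊔ chainsIn R (Set.range s ∩ O₂) n ≤
        chainsIn R (S ∩ O₁) n ⊔ chainsIn R (S ∩ O₂) n :=
      sup_le_sup (chainsIn_mono (Set.inter_subset_inter_left _ hs) n)
        (chainsIn_mono (Set.inter_subset_inter_left _ hs) n)
    exact hle hk
  | zero => exact ⟨0, by simp⟩
  | add x y _ _ hx hy =>
    obtain ⟨k, hk⟩ := hx
    obtain ⟨l, hl⟩ := hy
    refine ⟨k + l, ?_⟩
    rw [map_add]
    refine Submodule.add_mem _ ?_ ?_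
    · rw [add_comm k l, pow_add, Module.End.mul_apply]
      exact stable _ _ hk
    · rw [pow_add, Module.End.mul_apply]
      exact stable _ _ hl
  | smul r x _ hx =>
    obtain ⟨k, hk⟩ := hx
    exact ⟨k, by rw [map_smul]; exact Submodule.smul_mem _ _ hk⟩

end SingularChain

open stdSimplex

namespace SingularChain

variable {R : Type*} [CommRing R] {Y Z : Type*} [TopologicalSpace Y] [TopologicalSpace Z]

lemma mem_chainsIn_univ {n : ℕ} (c : SingularChain R Y n) : c ∈ chainsIn R Set.univ n := by
  rw [chainsIn_univ]; trivial

/-! ### Cycles and boundaries -/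

/-- The cycles; every chain of index zero is a cycle. -/
def IsCycle : ∀ {n : ℕ}, SingularChain R Y n → Prop
  | 0, _ => True
  | n + 1, c => boundary R n c = 0

/-- The chains that bound a chain in `S`. -/
def IsBoundaryIn (S : Set Y) {n : ℕ} (c : SingularChain R Y n) : Prop :=
  ∃ b ∈ chainsIn R S (n + 1), boundary R n b = c

lemma isCycle_boundary {n : ℕ} (c : SingularChain R Y (n + 1)) : IsCycle (boundary R n c) := by
  cases n with
  | zero => trivial
  | succ n => exact boundary_boundary c

lemma IsCycle.add {n : ℕ} {c c' : SingularChain R Y n} (h : IsCycle c) (h' : IsCycle c') :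
    IsCycle (c + c') := by
  cases n with
  | zero => trivial
  | succ n => exact (map_add _ _ _).trans (by rw [show _ = _ from h, show _ = _ from h', add_zero])

lemma IsCycle.smul {n : ℕ} {c : SingularChain R Y n} (r : R) (h : IsCycle c) :
    IsCycle (r • c) := by
  cases n with
  | zero => trivial
  | succ n => exact (map_smul _ _ _).trans (by rw [show _ = _ from h, smul_zero])

lemma IsCycle.neg {n : ℕ} {c : SingularChain R Y n} (h : IsCycle c) : IsCycle (-c) := by
  simpa using h.smul (-1)

lemma IsCycle.sub {n : ℕ} {c c' : SingularChain R Y n} (h : IsCycle c) (h' : IsCycle c') :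
    IsCycle (c - c') := by
  rw [sub_eq_add_neg]
  exact h.add h'.neg

lemma IsCycle.map {n : ℕ} {c : SingularChain R Y n} (h : IsCycle c) (f : C(Y, Z)) :
    IsCycle (map R f n c) := by
  cases n with
  | zero => trivial
  | succ n => exact (map_boundary f c).symm.trans (by rw [show _ = _ from h, map_zero])

lemma IsCycle.of_map {n : ℕ} {c : SingularChain R Y n} {f : C(Y, Z)} (hf : Function.Injective f)
    (h : IsCycle (SingularChain.map R f n c)) : IsCycle c := by
  cases n with
  | zero => trivial
  | succ n =>
    refine map_injective hf n ?_
    rw [map_boundary, map_zero]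
    exact h

lemma IsCycle.subdiv_pow {n : ℕ} {c : SingularChain R Y n} (h : IsCycle c) (k : ℕ) :
    IsCycle ((subdiv R n ^ k) c) := by
  induction k with
  | zero => simpa using h
  | succ k ih =>
    cases n with
    | zero => trivial
    | succ n =>
      rw [pow_succ', Module.End.mul_apply]
      exact (boundary_subdiv _).trans (by rw [show _ = _ from ih, map_zero])

lemma IsBoundaryIn.mono {S T : Set Y} (hST : S ⊆ T) {n : ℕ} {c : SingularChain R Y n}
    (h : IsBoundaryIn S c) : IsBoundaryIn T c := by
  obtain ⟨b, hb, h⟩ := h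
  exact ⟨b, chainsIn_mono hST _ hb, h⟩

lemma isBoundaryIn_zero (S : Set Y) (n : ℕ) : IsBoundaryIn S (0 : SingularChain R Y n) :=
  ⟨0, zero_mem _, map_zero _⟩

lemma IsBoundaryIn.add {S : Set Y} {n : ℕ} {c c' : SingularChain R Y n} (h : IsBoundaryIn S c)
    (h' : IsBoundaryIn S c') : IsBoundaryIn S (c + c') := by
  obtain ⟨b, hb, rfl⟩ := h
  obtain ⟨b', hb', rfl⟩ := h'
  exact ⟨b + b', add_mem hb hb', map_add _ _ _⟩

lemma IsBoundaryIn.smul {S : Set Y} {n : ℕ} {c : SingularChain R Y n} (r : R)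
    (h : IsBoundaryIn S c) : IsBoundaryIn S (r • c) := by
  obtain ⟨b, hb, rfl⟩ := h
  exact ⟨r • b, Submodule.smul_mem _ _ hb, map_smul _ _ _⟩

lemma IsBoundaryIn.neg {S : Set Y} {n : ℕ} {c : SingularChain R Y n}
    (h : IsBoundaryIn S c) : IsBoundaryIn S (-c) := by
  simpa using h.smul (-1)

lemma IsBoundaryIn.sub {S : Set Y} {n : ℕ} {c c' : SingularChain R Y n} (h : IsBoundaryIn S c)
    (h' : IsBoundaryIn S c') : IsBoundaryIn S (c - c') := by
  rw [sub_eq_add_neg]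
  exact h.add h'.neg

lemma IsBoundaryIn.map {S : Set Y} {T : Set Z} {n : ℕ} {c : SingularChain R Y n}
    (h : IsBoundaryIn S c) {f : C(Y, Z)} (hf : Set.MapsTo f S T) :
    IsBoundaryIn T (SingularChain.map R f n c) := by
  obtain ⟨b, hb, rfl⟩ := h
  exact ⟨_, map_mem_chainsIn hf hb, (map_boundary f b).symm⟩

/-! ### Homotopy invariance -/

/-- A homotopy, reparametrized by the standard 1-simplex. -/
noncomputable def homotopyOnSimplex {f g : C(Y, Z)} (H : f.Homotopy g) :
    C(Y × stdSimplex ℝ (Fin 2), Z) :=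
  ⟨fun x ↦ H (stdSimplexHomeomorphUnitInterval x.2, x.1), by fun_prop⟩

lemma homotopyOnSimplex_comp_zero {f g : C(Y, Z)} (H : f.Homotopy g) :
    (homotopyOnSimplex H).comp ((ContinuousMap.id _).prodMk (ContinuousMap.const _ (vertex 0))) =
      f := by
  ext1 x
  exact H.apply_zero x

lemma homotopyOnSimplex_comp_one {f g : C(Y, Z)} (H : f.Homotopy g) :
    (homotopyOnSimplex H).comp ((ContinuousMap.id _).prodMk (ContinuousMap.const _ (vertex 1))) =
      g := by
  ext1 x
  exact H.apply_one x

instance : IsEmpty (stdSimplex ℝ (Fin 0)) := ⟨fun t ↦ by simpa using t.2.2⟩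

instance : Unique C(stdSimplex ℝ (Fin 0), Y) where
  default := ⟨isEmptyElim, continuous_of_const isEmptyElim⟩
  uniq s := by
    ext1 t
    exact isEmptyElim t

lemma map_index_zero (f g : C(Y, Z)) (c : SingularChain R Y 0) : map R f 0 c = map R g 0 c := by
  unfold map
  congr 2
  funext s
  exact Subsingleton.elim _ _

lemma subdiv_map_sub_map_eq_boundary {f g : C(Y, Z)} (H : f.Homotopy g) {n : ℕ}
    {c : SingularChain R Y n} (hc : IsCycle c) :
    subdiv R n (map R g n c) - map R f n c =
      boundary R n (homotopyOperator R (homotopyOnSimplex H) n c) := by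
  cases n with
  | zero =>
    rw [homotopyOperator_zero, map_zero, subdiv_zero, sub_eq_zero]
    exact map_index_zero _ _ _
  | succ n =>
    rw [boundary_homotopyOperator, homotopyOnSimplex_comp_zero, homotopyOnSimplex_comp_one,
      show boundary R n c = 0 from hc, map_zero, sub_zero]

/-- The inclusion of a subset. -/
abbrev incl (S : Set Y) : C(S, Y) := ⟨Subtype.val, continuous_subtype_val⟩

lemma mapsTo_incl (S : Set Y) : Set.MapsTo (incl S) Set.univ S := fun x _ ↦ x.2

lemma exists_cycle_lift {S : Set Y} {n : ℕ} {c : SingularChain R Y n} (hc : c ∈ chainsIn R S n)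
    (h : IsCycle c) : ∃ c' : SingularChain R S n, map R (incl S) n c' = c ∧ IsCycle c' := by
  obtain ⟨c', rfl⟩ := exists_map_eq hc
  exact ⟨c', rfl, h.of_map Subtype.val_injective⟩

lemma isBoundaryIn_subdiv_sub {S : Set Y} {n : ℕ} {c : SingularChain R Y n}
    (hc : c ∈ chainsIn R S n) (h : IsCycle c) : IsBoundaryIn S (subdiv R n c - c) := by
  obtain ⟨c, rfl, h'⟩ := exists_cycle_lift hc h
  rw [← map_subdiv, ← map_sub]
  refine IsBoundaryIn.map (S := Set.univ) ?_ (mapsTo_incl S)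
  have := subdiv_map_sub_map_eq_boundary (ContinuousMap.Homotopy.refl (ContinuousMap.id S)) h'
  rw [map_id] at this
  exact ⟨_, mem_chainsIn_univ _, this.symm⟩

lemma isBoundaryIn_subdiv_pow_sub {S : Set Y} {n : ℕ} {c : SingularChain R Y n}
    (hc : c ∈ chainsIn R S n) (h : IsCycle c) (k : ℕ) :
    IsBoundaryIn S ((subdiv R n ^ k) c - c) := by
  induction k with
  | zero => simpa using isBoundaryIn_zero S n
  | succ k ih =>
    rw [pow_succ', Module.End.mul_apply]
    simpa using (isBoundaryIn_subdiv_sub (subdiv_pow_mem_chainsIn hc k) (h.subdiv_pow k)).add ih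

lemma isBoundaryIn_map_sub_map {f g : C(Y, Z)} (H : f.Homotopic g) {n : ℕ}
    {c : SingularChain R Y n} (hc : IsCycle c) :
    IsBoundaryIn Set.univ (map R g n c - map R f n c) := by
  obtain ⟨H⟩ := H
  have h1 : IsBoundaryIn Set.univ (subdiv R n (map R g n c) - map R f n c) :=
    ⟨_, mem_chainsIn_univ _, (subdiv_map_sub_map_eq_boundary H hc).symm⟩
  have h2 := isBoundaryIn_subdiv_sub (S := Set.univ) (c := map R g n c)
    (mem_chainsIn_univ _) (hc.map g)
  simpa using h1.sub h2

variable (R) in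
/-- Every cycle in `S` of index `n` bounds in `S`. -/
def AcyclicAt (S : Set Y) (n : ℕ) : Prop :=
  ∀ c ∈ chainsIn R S n, IsCycle c → IsBoundaryIn S c

variable (R) in
/-- The reduced homology of `S` is free of rank one, concentrated in index `n`. -/
def SphereLike (S : Set Y) (n : ℕ) : Prop :=
  (∀ i ≠ n, AcyclicAt R S i) ∧ ∃ z ∈ chainsIn R S n, IsCycle z ∧
    (∀ r : R, IsBoundaryIn S (r • z) → r = 0) ∧
    ∀ c ∈ chainsIn R S n, IsCycle c → ∃ r : R, IsBoundaryIn S (c - r • z)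

lemma isBoundaryIn_map_incl {S : Set Y} {n : ℕ} {c : SingularChain R S n} :
    IsBoundaryIn S (map R (incl S) n c) ↔ IsBoundaryIn Set.univ c := by
  refine ⟨?_, fun h ↦ h.map (mapsTo_incl S)⟩
  rintro ⟨b, hb, h⟩
  obtain ⟨b, rfl⟩ := exists_map_eq hb
  refine ⟨b, mem_chainsIn_univ _, map_injective (f := incl S) Subtype.val_injective n ?_⟩
  rw [← h, map_boundary]

lemma acyclicAt_coe_iff {S : Set Y} {n : ℕ} :
    AcyclicAt R (Set.univ : Set S) n ↔ AcyclicAt R S n := by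
  constructor
  · intro h c hc hc'
    obtain ⟨c, rfl, hc''⟩ := exists_cycle_lift hc hc'
    exact isBoundaryIn_map_incl.2 (h c (mem_chainsIn_univ _) hc'')
  · intro h c hc hc'
    exact isBoundaryIn_map_incl.1 (h _ (map_mem_chainsIn (mapsTo_incl S) hc) (hc'.map _))

lemma sphereLike_coe_iff {S : Set Y} {n : ℕ} :
    SphereLike R (Set.univ : Set S) n ↔ SphereLike R S n := by
  refine and_congr (by simp only [acyclicAt_coe_iff]) ?_
  constructor
  · rintro ⟨z, hz, hz', h1, h2⟩
    refine ⟨_, map_mem_chainsIn (mapsTo_incl S) hz, hz'.map _, fun r hr ↦ h1 r ?_, fun c hc hc' ↦ ?_⟩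
    · rwa [← map_smul, isBoundaryIn_map_incl] at hr
    · obtain ⟨c, rfl, hc''⟩ := exists_cycle_lift hc hc'
      obtain ⟨r, hr⟩ := h2 c (mem_chainsIn_univ _) hc''
      refine ⟨r, ?_⟩
      rwa [← map_smul, ← map_sub, isBoundaryIn_map_incl]
  · rintro ⟨z, hz, hz', h1, h2⟩
    obtain ⟨z, rfl, hz''⟩ := exists_cycle_lift hz hz'
    refine ⟨z, mem_chainsIn_univ _, hz'', fun r hr ↦ h1 r ?_, fun c hc hc' ↦ ?_⟩
    · rwa [← map_smul, isBoundaryIn_map_incl]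
    · obtain ⟨r, hr⟩ := h2 _ (map_mem_chainsIn (mapsTo_incl S) hc) (hc'.map _)
      refine ⟨r, ?_⟩
      rwa [← map_smul, ← map_sub, isBoundaryIn_map_incl] at hr

lemma isBoundaryIn_map_iff (e : ContinuousMap.HomotopyEquiv Y Z) {n : ℕ} {c : SingularChain R Y n}
    (hc : IsCycle c) : IsBoundaryIn Set.univ (map R e.toFun n c) ↔ IsBoundaryIn Set.univ c := by
  refine ⟨fun h ↦ ?_, fun h ↦ h.map (Set.mapsTo_univ _ _)⟩
  have h1 := h.map (Set.mapsTo_univ e.invFun Set.univ)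
  have h2 := isBoundaryIn_map_sub_map e.left_inv hc
  rw [map_map] at h1
  rw [map_id] at h2
  simpa using h2.add h1

lemma AcyclicAt.of_homotopyEquiv (e : ContinuousMap.HomotopyEquiv Y Z) {n : ℕ}
    (h : AcyclicAt R (Set.univ : Set Z) n) : AcyclicAt R (Set.univ : Set Y) n := fun _ _ hc' ↦
  (isBoundaryIn_map_iff e hc').1 (h _ (mem_chainsIn_univ _) (hc'.map _))

lemma SphereLike.of_homotopyEquiv (e : ContinuousMap.HomotopyEquiv Y Z) {n : ℕ}
    (h : SphereLike R (Set.univ : Set Z) n) : SphereLike R (Set.univ : Set Y) n := by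
  obtain ⟨h0, z, hz, hz', h1, h2⟩ := h
  have key : IsBoundaryIn Set.univ (map R e.toFun n (map R e.invFun n z) - z) := by
    have := isBoundaryIn_map_sub_map e.right_inv hz'
    rw [map_id] at this
    rw [map_map]
    simpa using this.neg
  refine ⟨fun i hi ↦ (h0 i hi).of_homotopyEquiv e, map R e.invFun n z, mem_chainsIn_univ _,
    hz'.map _, fun r hr ↦ h1 r ?_, fun c hc hc' ↦ ?_⟩
  · have h3 := (key.smul r).neg.add (hr.map (Set.mapsTo_univ e.toFun Set.univ))
    rw [map_smul] at h3
    convert h3 using 1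
    rw [smul_sub]; abel
  · obtain ⟨r, hr⟩ := h2 (map R e.toFun n c) (mem_chainsIn_univ _) (hc'.map _)
    refine ⟨r, (isBoundaryIn_map_iff e (hc'.sub ((hz'.map _).smul r))).1 ?_⟩
    rw [map_sub, map_smul]
    have := hr.sub (key.smul r)
    convert this using 1
    rw [smul_sub]; abel

lemma boundary_const (y : Y) (n : ℕ) (r : R) :
    boundary R n (Finsupp.single (ContinuousMap.const _ y) r) =
      if Even n then Finsupp.single (ContinuousMap.const _ y) r else 0 := by
  have h : ∀ i, (ContinuousMap.const _ y : C(stdSimplex ℝ (Fin (n + 1)), Y)).comp (face i) =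
      ContinuousMap.const _ y := fun i ↦ rfl
  simp only [boundary_single, h]
  rw [← Finsupp.single_finsetSum, Fin.sum_neg_one_pow]
  simp only [Nat.even_add_one]
  split_ifs <;> simp_all

lemma map_const (y : Z) {n : ℕ} (c : SingularChain R Y n) :
    ∃ r : R, map R (ContinuousMap.const Y y) n c = Finsupp.single (ContinuousMap.const _ y) r := by
  induction c using Finsupp.induction_linear with
  | zero => exact ⟨0, by simp⟩
  | add a b ha hb =>
    obtain ⟨r, hr⟩ := ha
    obtain ⟨s, hs⟩ := hb
    exact ⟨r + s, by rw [map_add, hr, hs, Finsupp.single_add]⟩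
  | single s r => exact ⟨r, by rw [map_single]; rfl⟩

/-- A cycle is homologous to a multiple of a constant simplex. Boundaries of constant simplices
alternate between the constant simplex and zero: in even index it bounds, and in odd index a
multiple of it is a cycle only if it is zero. -/
lemma acyclicAt_univ_of_contractibleSpace [ContractibleSpace Y] (n : ℕ) :
    AcyclicAt R (Set.univ : Set Y) n := by
  intro c _ hc
  obtain ⟨y, hy⟩ := id_nullhomotopic Y
  have h1 := isBoundaryIn_map_sub_map hy hc
  have hc' := hc.map (ContinuousMap.const Y y)
  obtain ⟨r, hr⟩ := map_const y c
  rw [map_id] at h1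
  suffices IsBoundaryIn Set.univ (map R (ContinuousMap.const Y y) n c) by
    simpa using this.sub h1
  rw [hr] at hc' ⊢
  by_cases hn : Even n
  · exact ⟨Finsupp.single (ContinuousMap.const _ y) r, mem_chainsIn_univ _,
      by rw [boundary_const, if_pos hn]⟩
  · obtain _ | n := n
    · simp at hn
    · have h2 : boundary R n _ = 0 := hc'
      rw [boundary_const, if_pos (by simpa [Nat.even_add_one] using hn), Finsupp.single_eq_zero]
        at h2
      rw [h2, Finsupp.single_zero]
      exact isBoundaryIn_zero _ _

lemma acyclicAt_of_contractibleSpace (S : Set Y) [ContractibleSpace S] (n : ℕ) :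
    AcyclicAt R S n :=
  acyclicAt_coe_iff.1 (acyclicAt_univ_of_contractibleSpace n)

/-- Only the simplex on no vertices lies in the empty set, which is therefore a sphere of dimension
`-1`; this starts the induction for spheres. -/
lemma sphereLike_empty : SphereLike R (∅ : Set Y) 0 := by
  refine ⟨fun i hi c hc _ ↦ ?_, Finsupp.single default 1, by simp [chainsIn_zero], trivial,
    fun r ↦ ?_, fun c hc _ ↦ ⟨c default, ?_⟩⟩
  · obtain ⟨i, rfl⟩ := Nat.exists_eq_succ_of_ne_zero hi
    rw [chainsIn_empty, Submodule.mem_bot] at hc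
    rw [hc]
    exact isBoundaryIn_zero _ _
  · rintro ⟨b, hb, h⟩
    rw [chainsIn_empty, Submodule.mem_bot] at hb
    rw [hb, map_zero, Finsupp.smul_single, eq_comm, Finsupp.single_eq_zero] at h
    simpa using h
  · convert isBoundaryIn_zero (R := R) (∅ : Set Y) 0
    rw [Finsupp.smul_single, smul_eq_mul, mul_one, sub_eq_zero]
    exact Finsupp.unique_single c

/-! ### The Mayer–Vietoris argument for suspensions -/

section MayerVietoris

variable {O₁ O₂ : Set Y}

/-- Subdividing splits the cycle into `a + b`; the boundary of `a` is then a cycle in the overlap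
and represents the Mayer–Vietoris connecting map. -/
lemma exists_mem_inter_of_isBoundary {S : Set Y} (h₁ : IsOpen O₁) (h₂ : IsOpen O₂)
    (hS : S ⊆ O₁ ∪ O₂) {n : ℕ} {c : SingularChain R Y (n + 1)} (hc : c ∈ chainsIn R S (n + 1))
    (hc' : IsCycle c) : ∃ a ∈ chainsIn R (S ∩ O₁) (n + 1), ∃ b ∈ chainsIn R (S ∩ O₂) (n + 1),
      IsBoundaryIn S (a + b - c) ∧ boundary R n a = - boundary R n b ∧
      boundary R n a ∈ chainsIn R (S ∩ (O₁ ∩ O₂)) n := by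
  obtain ⟨k, a, ha, b, hb, hab⟩ := exists_subdiv_pow_eq_add h₁ h₂ hS hc
  have h : boundary R n a = - boundary R n b := by
    have : boundary R n ((subdiv R (n + 1) ^ k) c) = 0 := hc'.subdiv_pow k
    rw [hab, map_add] at this
    exact eq_neg_of_add_eq_zero_left this
  refine ⟨a, ha, b, hb, hab ▸ isBoundaryIn_subdiv_pow_sub hc hc' k, h, ?_⟩
  rw [Set.inter_inter_distrib_left, ← chainsIn_inter]
  refine ⟨boundary_mem_chainsIn ha, ?_⟩
  rw [h]
  exact neg_mem (boundary_mem_chainsIn hb)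

/-- A union of two acyclic open sets is sphere-like if the intersection is. -/
lemma SphereLike.union (h₁ : IsOpen O₁) (h₂ : IsOpen O₂) (a₁ : ∀ i, AcyclicAt R O₁ i)
    (a₂ : ∀ i, AcyclicAt R O₂ i) {n : ℕ} (h : SphereLike R (O₁ ∩ O₂) n) :
    SphereLike R (O₁ ∪ O₂) (n + 1) := by
  have e₁ : (O₁ ∪ O₂) ∩ O₁ = O₁ := Set.union_inter_cancel_left
  have e₂ : (O₁ ∪ O₂) ∩ O₂ = O₂ := Set.union_inter_cancel_right
  have e₃ : (O₁ ∪ O₂) ∩ (O₁ ∩ O₂) = O₁ ∩ O₂ :=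
    Set.inter_eq_right.2 (Set.inter_subset_left.trans Set.subset_union_left)
  obtain ⟨h0, z, hz, hz', h3, h4⟩ := h
  refine ⟨fun i hi c hc hc' ↦ ?_, ?_⟩
  · obtain _ | i := i
    · refine (a₁ 0 c (by rw [chainsIn_zero]; trivial) trivial).mono Set.subset_union_left
    · obtain ⟨a, ha, b, hb, hab, h5, h6⟩ := exists_mem_inter_of_isBoundary h₁ h₂ le_rfl hc hc'
      rw [e₁] at ha
      rw [e₂] at hb
      rw [e₃] at h6
      obtain ⟨w, hw, hw'⟩ := h0 i (by lia) _ h6 (isCycle_boundary a)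
      -- Since `∂a = ∂w = -∂b`, the chains `a - w` and `b + w` are cycles in the two acyclic halves,
      -- and they add up to `a + b`.
      have ha' := (a₁ _ (a - w) (sub_mem ha (chainsIn_mono Set.inter_subset_left _ hw))
        (by rw [IsCycle, map_sub, hw', sub_self])).mono (Set.subset_union_left (t := O₂))
      have hb' := (a₂ _ (b + w) (add_mem hb (chainsIn_mono Set.inter_subset_right _ hw))
        (by rw [IsCycle, map_add, hw', h5, add_neg_cancel])).mono (Set.subset_union_right (s := O₁))
      convert (ha'.add hb').sub hab using 1
      abel
  -- The generator is the suspension of `z`: fill `z` in each half and glue the two fillings to `a -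
  -- b`.
  · obtain ⟨a, ha, haz⟩ := a₁ n z (chainsIn_mono Set.inter_subset_left _ hz) hz'
    obtain ⟨b, hb, hbz⟩ := a₂ n z (chainsIn_mono Set.inter_subset_right _ hz) hz'
    refine ⟨a - b, sub_mem (chainsIn_mono Set.subset_union_left _ ha)
      (chainsIn_mono Set.subset_union_right _ hb), by rw [IsCycle, map_sub, haz, hbz, sub_self],
      fun r ↦ ?_, fun c hc hc' ↦ ?_⟩
    · rintro ⟨e, he, hez⟩
      obtain ⟨k, e₁', he₁, e₂', he₂, hee⟩ := exists_subdiv_pow_eq_add h₁ h₂ le_rfl he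
      rw [e₁] at he₁
      rw [e₂] at he₂
      have hsub : boundary R (n + 1) ((subdiv R (n + 2) ^ k) e) =
          (subdiv R (n + 1) ^ k) (boundary R (n + 1) e) := by
        clear hee
        induction k with
        | zero => simp
        | succ k ih =>
          rw [pow_succ', Module.End.mul_apply, boundary_subdiv, ih, pow_succ',
            Module.End.mul_apply]
      have hsub' : boundary R n ((subdiv R (n + 1) ^ k) a) = (subdiv R n ^ k) z := by
        rw [← haz]
        clear hee hsub
        induction k with
        | zero => simp
        | succ k ih =>
          rw [pow_succ', Module.End.mul_apply, boundary_subdiv, ih, pow_succ',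
            Module.End.mul_apply]
      rw [hee, hez, map_smul, map_sub, map_add] at hsub
      -- In the subdivided equation `∂e = r (a - b)`, moving the terms of each half to one side
      -- gives the same chain `w` in both `O₁` and `O₂`; its boundary is `-r` times the subdivided
      -- `z`.
      set w := boundary R (n + 1) e₁' - r • (subdiv R (n + 1) ^ k) a with hw
      have hw' : w = - boundary R (n + 1) e₂' - r • (subdiv R (n + 1) ^ k) b := by
        rw [hw, sub_eq_sub_iff_add_eq_add, ← sub_eq_zero]
        rw [← sub_eq_zero] at hsub
        rw [← hsub, smul_sub]
        abel
      have hwm : w ∈ chainsIn R (O₁ ∩ O₂) (n + 1) := by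
        rw [← chainsIn_inter]
        constructor
        · exact sub_mem (boundary_mem_chainsIn he₁)
            (Submodule.smul_mem _ _ (subdiv_pow_mem_chainsIn ha k))
        · rw [hw']
          exact sub_mem (neg_mem (boundary_mem_chainsIn he₂))
            (Submodule.smul_mem _ _ (subdiv_pow_mem_chainsIn hb k))
      have h5 : IsBoundaryIn (O₁ ∩ O₂) (r • (subdiv R n ^ k) z) := by
        refine ⟨-w, neg_mem hwm, ?_⟩
        rw [hw, map_neg, map_sub, boundary_boundary, map_smul, hsub']
        simp
      refine h3 r ?_
      convert h5.sub ((isBoundaryIn_subdiv_pow_sub hz hz' k).smul r) using 1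
      rw [smul_sub]; abel
    · obtain ⟨a', ha', b', hb', hab, h5, h6⟩ := exists_mem_inter_of_isBoundary h₁ h₂ le_rfl hc hc'
      rw [e₁] at ha'
      rw [e₂] at hb'
      rw [e₃] at h6
      -- The coefficient of `c` is that of its image under the connecting map; subtracting `r • a`
      -- and `w` makes the two halves into cycles.
      obtain ⟨r, w, hw, hw'⟩ := h4 _ h6 (isCycle_boundary a')
      have hA := (a₁ _ (a' - r • a - w) (sub_mem (sub_mem ha' (Submodule.smul_mem _ _ ha))
        (chainsIn_mono Set.inter_subset_left _ hw))
        (by rw [IsCycle, map_sub, hw', map_sub, map_smul, haz]; simp)).mono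
          (Set.subset_union_left (t := O₂))
      have hB := (a₂ _ (b' + r • b + w) (add_mem (add_mem hb' (Submodule.smul_mem _ _ hb))
        (chainsIn_mono Set.inter_subset_right _ hw))
        (by rw [IsCycle, map_add, hw', map_add, map_smul, hbz, h5]; simp)).mono
          (Set.subset_union_right (s := O₁))
      refine ⟨r, ?_⟩
      convert (hA.add hB).sub hab using 1
      rw [smul_sub]; abel

end MayerVietoris

end SingularChain

open stdSimplex

namespace SingularChain

variable {R : Type*} [CommRing R]

/-! ### Punctured Euclidean spaces and spheres -/

/-- The complement of the ray through `-s` times the zeroth basis vector. -/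
def slit (n : ℕ) (s : ℝ) : Set (Fin (n + 1) → ℝ) := {x | ¬ ((fun i : Fin n ↦ x i.succ) = 0 ∧ s * x 0 ≤ 0)}

lemma isOpen_slit (n : ℕ) (s : ℝ) : IsOpen (slit n s) := by
  rw [slit, ← isClosed_compl_iff]
  simp only [Set.compl_ofPred, not_not]
  exact (isClosed_eq (continuous_pi fun i ↦ continuous_apply _) continuous_const).inter
    (isClosed_le (continuous_const.mul (continuous_apply 0)) continuous_const)

/-- The set is star-shaped about `s` times the zeroth basis vector: a segment from there can meet
the removed ray only if its other end lies on the ray. -/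
lemma contractibleSpace_slit (n : ℕ) {s : ℝ} (hs : s ≠ 0) : ContractibleSpace (slit n s) := by
  refine StarConvex.contractibleSpace (x := Pi.single 0 s) ?_ ⟨Pi.single 0 s, ?_⟩
  · intro y hy a b ha hb hab h
    refine hy ?_
    have h1 (i : Fin n) : b * y i.succ = 0 := by
      have := congrFun h.1 i
      simpa using this
    have h2 := h.2
    simp only [Pi.add_apply, Pi.smul_apply, smul_eq_mul, Pi.single_eq_same] at h2
    have hb' : b ≠ 0 := by
      rintro rfl
      obtain rfl : a = 1 := by linarith
      have : 0 < s * s := mul_self_pos.2 hs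
      linarith
    refine ⟨?_, ?_⟩
    · ext i
      simpa [hb'] using h1 i
    · by_contra! h3
      have h4 : 0 < b * (s * y 0) := mul_pos (hb.lt_of_ne' hb') h3
      have h5 : 0 ≤ a * (s * s) := mul_nonneg ha (mul_self_nonneg s)
      nlinarith
  · rintro ⟨-, h⟩
    have : 0 < s * s := mul_self_pos.2 hs
    simp at h
    linarith

lemma slit_union (n : ℕ) : slit n 1 ∪ slit n (-1) = {0}ᶜ := by
  ext x
  simp only [slit, Set.mem_union, Set.mem_ofPred_eq, Set.mem_compl_iff, Set.mem_singleton_iff]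
  rw [← not_and_or, not_iff_not]
  constructor
  · rintro ⟨⟨h1, h2⟩, -, h3⟩
    ext i
    refine Fin.cases ?_ (fun i ↦ congrFun h1 i) i
    simp only [Pi.zero_apply]
    linarith
  · rintro rfl
    simp
    rfl

lemma slit_inter (n : ℕ) : slit n 1 ∩ slit n (-1) = {x | (fun i : Fin n ↦ x i.succ) ≠ 0} := by
  ext x
  simp only [slit, Set.mem_inter_iff, Set.mem_ofPred_eq]
  constructor
  · rintro ⟨h1, h2⟩ h
    rcases le_total (x 0) 0 with h3 | h3
    · exact h1 ⟨h, by linarith⟩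
    · exact h2 ⟨h, by linarith⟩
  · intro h
    exact ⟨fun h' ↦ h h'.1, fun h' ↦ h h'.1⟩

/-- Forgetting the zeroth coordinate. -/
noncomputable def tailMap (n : ℕ) : C({x : Fin (n + 1) → ℝ | (fun i : Fin n ↦ x i.succ) ≠ 0},
    ({0}ᶜ : Set (Fin n → ℝ))) where
  toFun x := ⟨fun i ↦ x.1 i.succ, x.2⟩
  continuous_toFun := Continuous.subtype_mk (continuous_pi fun i ↦
    (continuous_apply i.succ).comp continuous_subtype_val) _

/-- Adding a zeroth coordinate. -/
noncomputable def consMap (n : ℕ) : C(({0}ᶜ : Set (Fin n → ℝ)) × ℝ,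
    {x : Fin (n + 1) → ℝ | (fun i : Fin n ↦ x i.succ) ≠ 0}) where
  toFun x := ⟨Fin.cons x.2 x.1.1, fun h ↦ x.1.2 (by simpa using h)⟩
  continuous_toFun := by
    refine Continuous.subtype_mk (continuous_pi fun i ↦ ?_) _
    refine Fin.cases ?_ (fun i ↦ ?_) i
    · exact continuous_snd
    · exact (continuous_apply i).comp (continuous_subtype_val.comp continuous_fst)

/-- The complement of the zeroth axis is homotopy equivalent to a punctured space of one dimension
less. -/
noncomputable def axisComplHomotopyEquiv (n : ℕ) :
    ContinuousMap.HomotopyEquiv {x : Fin (n + 1) → ℝ | (fun i : Fin n ↦ x i.succ) ≠ 0}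
      ({0}ᶜ : Set (Fin n → ℝ)) where
  toFun := tailMap n
  invFun := (consMap n).comp ((ContinuousMap.id _).prodMk (ContinuousMap.const _ 0))
  left_inv := ⟨{
    toFun := fun x ↦ consMap n (tailMap n x.2, x.1 * x.2.1 0)
    continuous_toFun := (consMap n).continuous.comp (((tailMap n).continuous.comp
      continuous_snd).prodMk ((continuous_subtype_val.comp continuous_fst).mul
        ((continuous_apply 0).comp (continuous_subtype_val.comp continuous_snd))))
    map_zero_left := fun x ↦ by
      change consMap n (tailMap n x, 0 * x.1 0) = consMap n (tailMap n x, 0)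
      rw [zero_mul]
    map_one_left := fun x ↦ by
      apply Subtype.ext
      change (Fin.cons (1 * x.1 0) _ : Fin (n + 1) → ℝ) = x.1
      rw [one_mul]
      exact Fin.cons_self_tail x.1 }⟩
  right_inv := by
    convert! ContinuousMap.Homotopic.refl _

/-- Two opposite slit spaces cover the punctured space; both are contractible, and they meet in the
complement of an axis, which is homotopy equivalent to the punctured space of one dimension less. -/
lemma sphereLike_compl_zero (n : ℕ) : SphereLike R ({0}ᶜ : Set (Fin n → ℝ)) n := by
  induction n with
  | zero =>
    convert! sphereLike_empty
    exact Set.eq_empty_of_forall_notMem fun x hx ↦ hx (Subsingleton.elim _ _)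
  | succ n ih =>
    rw [← slit_union]
    have := contractibleSpace_slit n (one_ne_zero)
    have := contractibleSpace_slit n (neg_ne_zero.2 one_ne_zero : (-1 : ℝ) ≠ 0)
    refine SphereLike.union (isOpen_slit n 1) (isOpen_slit n (-1))
      (acyclicAt_of_contractibleSpace _) (acyclicAt_of_contractibleSpace _) ?_
    rw [slit_inter, ← sphereLike_coe_iff]
    exact (sphereLike_coe_iff.2 ih).of_homotopyEquiv (axisComplHomotopyEquiv n)

lemma norm_toLp_pos {n : ℕ} (x : ({0}ᶜ : Set (Fin n → ℝ))) : 0 < ‖WithLp.toLp 2 x.1‖ := by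
  have h : x.1 ≠ 0 := x.2
  simpa using h

lemma continuous_inv_norm_toLp (n : ℕ) :
    Continuous fun x : ({0}ᶜ : Set (Fin n → ℝ)) ↦ ‖WithLp.toLp 2 x.1‖⁻¹ :=
  Continuous.inv₀ ((PiLp.continuous_toLp 2 _).comp continuous_subtype_val).norm
    fun x ↦ (norm_toLp_pos x).ne'

/-- The inclusion of the sphere into the punctured space. -/
noncomputable def sphereIncl (n : ℕ) : C(TopCat.sphere.{u} n, ({0}ᶜ : Set (Fin (n + 1) → ℝ))) where
  toFun x := ⟨WithLp.ofLp x.down.1, fun h ↦ by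
    have h1 := x.down.2
    have h2 : x.down.1 = 0 := by simpa using h
    rw [h2] at h1
    simp at h1⟩
  continuous_toFun := Continuous.subtype_mk ((PiLp.continuous_ofLp _ _).comp
      (continuous_subtype_val.comp continuous_uliftDown)) _

/-- The radial projection to the sphere. -/
noncomputable def normalize (n : ℕ) : C(({0}ᶜ : Set (Fin (n + 1) → ℝ)), TopCat.sphere.{u} n) where
  toFun x := ⟨⟨‖WithLp.toLp 2 x.1‖⁻¹ • WithLp.toLp 2 x.1, by
    simp [norm_smul, -PiLp.norm_toLp, (norm_toLp_pos x).ne']⟩⟩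
  continuous_toFun := continuous_uliftUp.comp (Continuous.subtype_mk
    ((continuous_inv_norm_toLp _).smul
        ((PiLp.continuous_toLp 2 _).comp continuous_subtype_val)) _)

/-- Rescaling a nonzero vector. -/
noncomputable def rescale (n : ℕ) : C({r : ℝ // 0 < r} × ({0}ᶜ : Set (Fin n → ℝ)),
    ({0}ᶜ : Set (Fin n → ℝ))) where
  toFun x := ⟨x.1.1 • x.2.1, smul_ne_zero x.1.2.ne' x.2.2⟩
  continuous_toFun := Continuous.subtype_mk ((continuous_subtype_val.comp continuous_fst).smul
    (continuous_subtype_val.comp continuous_snd)) _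

/-- The sphere is homotopy equivalent to a punctured Euclidean space. -/
noncomputable def sphereHomotopyEquiv (n : ℕ) :
    ContinuousMap.HomotopyEquiv (TopCat.sphere.{u} n) ({0}ᶜ : Set (Fin (n + 1) → ℝ)) where
  toFun := sphereIncl n
  invFun := normalize n
  left_inv := by
    have : (normalize n).comp (sphereIncl n) = ContinuousMap.id (TopCat.sphere.{u} n) := by
      ext1 x
      have h1 : ‖x.down.1‖ = 1 := by simp
      apply ULift.ext
      apply Subtype.ext
      change ‖x.down.1‖⁻¹ • x.down.1 = x.down.1
      rw [h1, inv_one, one_smul]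
    rw [this]
  right_inv := ⟨{
    toFun := fun x ↦ rescale (n + 1) (⟨(1 - (x.1 : ℝ)) * ‖WithLp.toLp 2 x.2.1‖⁻¹ + x.1, by
          have h1 := norm_toLp_pos x.2
          rcases x.1.2.1.eq_or_lt with h | h
          · rw [← h]; simpa using h1
          · have := sub_nonneg.2 x.1.2.2
            positivity⟩, x.2)
    continuous_toFun := by
      have h := (continuous_inv_norm_toLp (n + 1)).comp (continuous_snd (X := unitInterval))
      have h' : Continuous fun x : unitInterval × ({0}ᶜ : Set (Fin (n + 1) → ℝ)) ↦ (x.1 : ℝ) :=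
        continuous_subtype_val.comp continuous_fst
      exact (rescale (n + 1)).continuous.comp
        ((Continuous.subtype_mk (((continuous_const.sub h').mul h).add h') _).prodMk continuous_snd)
    map_zero_left := fun x ↦ by
      apply Subtype.ext
      change ((1 - 0) * ‖WithLp.toLp 2 x.1‖⁻¹ + 0) • x.1 = ‖WithLp.toLp 2 x.1‖⁻¹ • x.1
      simp
    map_one_left := fun x ↦ by
      apply Subtype.ext
      change ((1 - 1) * ‖WithLp.toLp 2 x.1‖⁻¹ + 1) • x.1 = x.1
      simp }⟩

lemma sphereLike_sphere (n : ℕ) : SphereLike R (Set.univ : Set (TopCat.sphere.{u} n)) (n + 1) :=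
  (sphereLike_coe_iff.2 (sphereLike_compl_zero (n + 1))).of_homotopyEquiv (sphereHomotopyEquiv n)

end SingularChain

/-! ### Permutation modules of a cyclic group of prime order -/

section PermutationModule

variable {p : ℕ} [Fact p.Prime] {α : Type*} (f : Equiv.Perm α)

/-- The augmentation element `g - 1` acting on a permutation module. -/
noncomputable def permSubOne (R : Type*) [CommRing R] : Module.End R (α →₀ R) :=
  Finsupp.lmapDomain R R f - 1

/-- In characteristic `p` both polynomials become `X^p - 1` after multiplication by `X - 1`, which
can be cancelled. So the norm is a power of `g - 1`. -/
lemma sum_pow_eq_sub_one_pow {M : Type*} [AddCommGroup M] [Module (ZMod p) M]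
    (T : Module.End (ZMod p) M) : ∑ k ∈ Finset.range p, T ^ k = (T - 1) ^ (p - 1) := by
  have h : ∑ k ∈ Finset.range p, (Polynomial.X : Polynomial (ZMod p)) ^ k =
      (Polynomial.X - 1) ^ (p - 1) := by
    have h0 : (Polynomial.X - 1 : Polynomial (ZMod p)) ≠ 0 := by
      simpa using Polynomial.X_sub_C_ne_zero (1 : ZMod p)
    apply mul_right_cancel₀ h0
    rw [geom_sum_mul, ← pow_succ, Nat.sub_add_cancel (Fact.out : p.Prime).one_le,
      sub_pow_char, one_pow]
  simpa using congrArg (Polynomial.aeval T) h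

lemma sub_one_pow_prime {M : Type*} [AddCommGroup M] [Module (ZMod p) M]
    {T : Module.End (ZMod p) M} (hT : T ^ p = 1) : (T - 1) ^ p = 0 := by
  have h : (Polynomial.X - 1 : Polynomial (ZMod p)) ^ p = Polynomial.X ^ p - 1 := by
    rw [sub_pow_char, one_pow]
  simpa [hT] using congrArg (Polynomial.aeval T) h

lemma lmapDomain_pow_apply {R : Type*} [CommRing R] (k : ℕ) (z : α →₀ R) (a : α) :
    ((Finsupp.lmapDomain R R f ^ k) z) a = z ((f⁻¹ ^ k) a) := by
  induction k generalizing a with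
  | zero => simp
  | succ k ih =>
    rw [pow_succ', Module.End.mul_apply, Finsupp.lmapDomain_apply, Finsupp.mapDomain_equiv_apply, ih,
      pow_succ, Equiv.Perm.mul_apply]
    rfl

lemma lmapDomain_pow_eq_one {R : Type*} [CommRing R] {q : ℕ} (hf : f ^ q = 1) :
    Finsupp.lmapDomain R R f ^ q = 1 := by
  ext1 x
  ext a
  simp only [LinearMap.comp_apply, lmapDomain_pow_apply, inv_pow, hf]
  simp

lemma permSubOne_pow_pred_apply (z : α →₀ ZMod p) (a : α) :
    (permSubOne f (ZMod p) ^ (p - 1)) z a = ∑ k ∈ Finset.range p, z ((f⁻¹ ^ k) a) := by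
  rw [permSubOne, ← sum_pow_eq_sub_one_pow, LinearMap.sum_apply, Finsupp.finsetSum_apply]
  simp [lmapDomain_pow_apply]

lemma permSubOne_apply {R : Type*} [CommRing R] (z : α →₀ R) (a : α) :
    permSubOne f R z a = z (f⁻¹ a) - z a := by
  have := lmapDomain_pow_apply (R := R) f 1 z a
  rw [pow_one, pow_one] at this
  rw [permSubOne, LinearMap.sub_apply, Finsupp.sub_apply, this]
  rfl

/-- A set meeting every nontrivial orbit in exactly one point. -/
structure IsFreeTransversal (p : ℕ) (f : Equiv.Perm α) (T : Set α) : Prop where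
  ne {a : α} : a ∈ T → f a ≠ a
  existsUnique {a : α} : f a ≠ a → ∃! k, k < p ∧ (f⁻¹ ^ k) a ∈ T

variable {f}

/-- An invariant chain is constant on orbits, and exactly one of the `p` translates of a moved point
lies in `T`, so the norm of the restriction to `T` recovers the chain. -/
lemma eq_permSubOne_pow_filter {T : Set α} (hT : IsFreeTransversal p f T) [DecidablePred (· ∈ T)]
    {c : α →₀ ZMod p} (hc : permSubOne f (ZMod p) c = 0) (hfix : ∀ a, f a = a → c a = 0) :
    (permSubOne f (ZMod p) ^ (p - 1)) (c.filter (· ∈ T)) = c := by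
  have hinv : ∀ k a, c ((f⁻¹ ^ k) a) = c a := by
    intro k
    induction k with
    | zero => simp
    | succ k ih =>
      intro a
      rw [pow_succ, Equiv.Perm.mul_apply, ih]
      have := DFunLike.congr_fun hc a
      rw [permSubOne_apply] at this
      exact sub_eq_zero.1 this
  ext a
  rw [permSubOne_pow_pred_apply]
  by_cases ha : f a = a
  · rw [hfix a ha]
    refine Finset.sum_eq_zero fun k _ ↦ ?_
    rw [Finsupp.filter_apply, hinv, hfix a ha, ite_self]
  · obtain ⟨k, ⟨hk, hkT⟩, huniq⟩ := hT.existsUnique ha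
    rw [Finset.sum_eq_single k]
    · rw [Finsupp.filter_apply_pos _ _ hkT, hinv]
    · intro l hl hlk
      rw [Finsupp.filter_apply_neg]
      exact fun h ↦ hlk (huniq l ⟨Finset.mem_range.1 hl, h⟩)
    · intro h
      exact absurd (Finset.mem_range.2 hk) h

/-- The point then has a positive period below `p` as well as the period `p`; these are coprime, so
it has period one. -/
lemma apply_eq_self_of_pow_eq {k l : ℕ} (hf : f ^ p = 1) (hk : k < p) (hl : l < p) (hkl : k ≠ l)
    {a : α} (h : (f⁻¹ ^ k) a = (f⁻¹ ^ l) a) : f a = a := by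
  wlog hlt : k < l generalizing k l
  · exact this hl hk hkl.symm h.symm (by lia)
  obtain ⟨m, rfl⟩ := Nat.exists_eq_add_of_lt hlt
  have h1 : (f⁻¹ ^ (m + 1)) a = a := by
    apply (f⁻¹ ^ k).injective
    rw [← Equiv.Perm.mul_apply, ← pow_add, ← add_assoc, ← h]
  have h2 : (f⁻¹ ^ p) a = a := by rw [inv_pow, hf]; simp
  have h3 : Function.IsPeriodicPt (f⁻¹ : Equiv.Perm α) (m + 1) a := by
    rwa [Function.IsPeriodicPt, Function.IsFixedPt, Equiv.Perm.iterate_eq_pow]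
  have h4 : Function.IsPeriodicPt (f⁻¹ : Equiv.Perm α) p a := by
    rwa [Function.IsPeriodicPt, Function.IsFixedPt, Equiv.Perm.iterate_eq_pow]
  have h5 : Nat.gcd (m + 1) p = 1 := Nat.Coprime.symm
    ((Nat.Prime.coprime_iff_not_dvd Fact.out).2 fun hd ↦ by
      have := Nat.le_of_dvd (by lia) hd
      lia)
  have h6 := h3.gcd h4
  rw [h5, Function.IsPeriodicPt, Function.iterate_one, Function.IsFixedPt, Equiv.Perm.inv_eq_iff_eq]
    at h6
  exact h6.symm

lemma exists_isFreeTransversal (hf : f ^ p = 1) : ∃ T : Set α, IsFreeTransversal p f T := by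
  have hp : 0 < p := (Fact.out : p.Prime).pos
  have hf' : (f⁻¹) ^ p = 1 := by rw [inv_pow, hf, inv_one]
  have hmod (k : ℕ) : f⁻¹ ^ k = f⁻¹ ^ (k % p) := by
    conv_lhs => rw [← Nat.div_add_mod k p, pow_add, pow_mul, hf', one_pow, one_mul]
  let s : Setoid α :=
    { r := fun a b ↦ ∃ k : ℕ, (f⁻¹ ^ k) a = b
      iseqv := ⟨fun a ↦ ⟨0, rfl⟩, by
        rintro a b ⟨k, rfl⟩
        refine ⟨p - k % p, ?_⟩
        rw [hmod k, ← Equiv.Perm.mul_apply, ← pow_add, Nat.sub_add_cancel (Nat.mod_lt k hp).le, hf']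
        rfl, by
        rintro a b c ⟨k, rfl⟩ ⟨l, rfl⟩
        exact ⟨l + k, by rw [pow_add, Equiv.Perm.mul_apply]⟩⟩ }
  have hfix : ∀ k a, f ((f⁻¹ ^ k) a) = (f⁻¹ ^ k) a → f a = a := by
    intro k a h
    apply (f⁻¹ ^ k).injective
    rw [← h, ← Equiv.Perm.mul_apply, ← Equiv.Perm.mul_apply]
    congr 1
    exact ((Commute.refl f).inv_left.pow_left k).eq
  -- The transversal consists of one chosen representative in each nontrivial orbit.
  refine ⟨{a | f a ≠ a ∧ (Quotient.mk s a).out = a}, fun h ↦ h.1, fun {a} ha ↦ ?_⟩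
  obtain ⟨k, hk⟩ : ∃ k : ℕ, (f⁻¹ ^ k) a = (Quotient.mk s a).out :=
    s.symm (Quotient.exact (Quotient.out_eq (Quotient.mk s a)))
  have hq (l : ℕ) : Quotient.mk s ((f⁻¹ ^ l) a) = Quotient.mk s a :=
    Quotient.sound (s.symm ⟨l, rfl⟩)
  refine ⟨k % p, ⟨Nat.mod_lt k hp, ?_⟩, ?_⟩
  · rw [← hmod]
    refine ⟨fun h ↦ ha (hfix _ _ h), ?_⟩
    rw [hq, hk]
  · rintro l ⟨hl, -, hl'⟩
    by_contra hne
    refine ha (apply_eq_self_of_pow_eq hf hl (Nat.mod_lt k hp) hne ?_)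
    rw [← hl', hq, ← hmod, hk]

/-- The chains supported on the fixed points. -/
def fixedSupported (f : Equiv.Perm α) (R : Type*) [CommRing R] : Submodule R (α →₀ R) :=
  Finsupp.supported R R {a | f a = a}

lemma mem_fixedSupported {R : Type*} [CommRing R] {c : α →₀ R} :
    c ∈ fixedSupported f R ↔ ∀ a, f a ≠ a → c a = 0 := by
  rw [fixedSupported, Finsupp.mem_supported']
  rfl

lemma permSubOne_eq_zero_of_mem_fixedSupported {R : Type*} [CommRing R] {c : α →₀ R}
    (hc : c ∈ fixedSupported f R) : permSubOne f R c = 0 := by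
  rw [mem_fixedSupported] at hc
  ext a
  rw [permSubOne_apply, Finsupp.zero_apply]
  by_cases ha : f a = a
  · rw [Equiv.Perm.inv_eq_iff_eq.2 ha.symm, sub_self]
  · rw [hc a ha, hc _ fun h ↦ ha ?_, sub_self]
    have h' : f (f⁻¹ a) = a := f.apply_symm_apply a
    rw [h'] at h
    conv_lhs => rw [h]
    exact h'

lemma permSubOne_apply_of_fixed {R : Type*} [CommRing R] (z : α →₀ R) {a : α} (ha : f a = a) :
    permSubOne f R z a = 0 := by
  rw [permSubOne_apply, Equiv.Perm.inv_eq_iff_eq.2 ha.symm, sub_self]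

/-- A chain of the form `(g - 1) y` has coefficient zero at every fixed point. -/
lemma range_permSubOne_pow_inf_fixedSupported {j : ℕ} (hj : j ≠ 0) {c : α →₀ ZMod p}
    (hc : c ∈ fixedSupported f (ZMod p)) (h : ∃ z, (permSubOne f (ZMod p) ^ j) z = c) : c = 0 := by
  obtain ⟨z, rfl⟩ := h
  rw [mem_fixedSupported] at hc
  ext a
  by_cases ha : f a = a
  · obtain ⟨i, rfl⟩ := Nat.exists_eq_succ_of_ne_zero hj
    rw [pow_succ', Module.End.mul_apply, permSubOne_apply_of_fixed _ ha]
    rfl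
  · exact hc a ha

/-- An element killed by `(g - 1)^j` is a multiple of `(g - 1)^(p - j)` up to fixed points. -/
lemma exists_eq_permSubOne_pow_add (hf : f ^ p = 1) {j : ℕ} (hj : 0 < j) (hjp : j < p)
    {c : α →₀ ZMod p} (hc : (permSubOne f (ZMod p) ^ j) c = 0) :
    ∃ z, ∃ w ∈ fixedSupported f (ZMod p), c = (permSubOne f (ZMod p) ^ (p - j)) z + w := by
  classical
  have one : ∀ c : α →₀ ZMod p, permSubOne f (ZMod p) c = 0 → ∃ z, ∃ w ∈ fixedSupported f (ZMod p),
      c = (permSubOne f (ZMod p) ^ (p - 1)) z + w := by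
    intro c hc
    obtain ⟨T, hT⟩ := exists_isFreeTransversal hf
    have hw : c.filter (fun a ↦ f a = a) ∈ fixedSupported f (ZMod p) := by
      rw [mem_fixedSupported]
      exact fun a ha ↦ Finsupp.filter_apply_neg _ _ ha
    refine ⟨(c - c.filter (fun a ↦ f a = a)).filter (· ∈ T), _, hw, ?_⟩
    rw [eq_permSubOne_pow_filter hT, sub_add_cancel]
    · rw [map_sub, hc, permSubOne_eq_zero_of_mem_fixedSupported hw, sub_zero]
    · intro a ha
      rw [Finsupp.sub_apply, Finsupp.filter_apply_pos (fun a ↦ f a = a) _ ha, sub_self]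
  induction j generalizing c with
  | zero => simp at hj
  | succ j ih =>
    obtain rfl | hj' := Nat.eq_zero_or_pos j
    · exact one c (by simpa using hc)
    · rw [pow_succ', Module.End.mul_apply] at hc
      -- Here `t^j c` is killed by `t`, so it equals `t^(p-1) z + w`.
      obtain ⟨z, w, hw, h⟩ := one _ hc
      have hpow : permSubOne f (ZMod p) ^ (p - 1) =
          permSubOne f (ZMod p) ^ j * permSubOne f (ZMod p) ^ (p - (j + 1)) := by
        rw [← pow_add]
        congr 1
        lia
      rw [hpow, Module.End.mul_apply] at h
      -- As `t^(p-1)` factors through `t^j`, the fixed part `w` lies in the image of `t^j` and must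
      -- vanish. The induction hypothesis then applies to `c - t^(p-j-1) z`.
      have hw0 : w = 0 := by
        refine range_permSubOne_pow_inf_fixedSupported hj'.ne' hw
          ⟨c - (permSubOne f (ZMod p) ^ (p - (j + 1))) z, ?_⟩
        rw [map_sub, h, add_sub_cancel_left]
      obtain ⟨z', w', hw', h'⟩ := ih hj' (by lia)
        (c := c - (permSubOne f (ZMod p) ^ (p - (j + 1))) z)
        (by rw [map_sub, h, hw0, add_zero, sub_self])
      have hpow' : permSubOne f (ZMod p) ^ (p - j) =
          permSubOne f (ZMod p) ^ (p - (j + 1)) * permSubOne f (ZMod p) := by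
        rw [← pow_succ]
        congr 1
        lia
      rw [hpow', Module.End.mul_apply] at h'
      refine ⟨z + permSubOne f (ZMod p) z', w', hw', ?_⟩
      rw [map_add, add_assoc, ← h', add_sub_cancel]

end PermutationModule

/-! ### Complexes of modules and lengths of their homology -/

section Complexes

variable {R : Type} [CommRing R]

/-- The chain complex attached to a sequence of modules and differentials. -/
noncomputable def moduleComplex (M : ℕ → Type u) [∀ n, AddCommGroup (M n)] [∀ n, Module R (M n)]
    (d : ∀ n, M (n + 1) →ₗ[R] M n) (hd : ∀ n x, d n (d (n + 1) x) = 0) :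
    ChainComplex (ModuleCat.{u} R) ℕ :=
  ChainComplex.of (fun n ↦ ModuleCat.of R (M n)) (fun n ↦ ModuleCat.ofHom (d n)) fun n ↦ by
    ext x
    exact hd n x

section

variable {M : ℕ → Type u} [∀ n, AddCommGroup (M n)] [∀ n, Module R (M n)]
  {d : ∀ n, M (n + 1) →ₗ[R] M n} {hd : ∀ n x, d n (d (n + 1) x) = 0}
  {M' : ℕ → Type u} [∀ n, AddCommGroup (M' n)] [∀ n, Module R (M' n)]
  {d' : ∀ n, M' (n + 1) →ₗ[R] M' n} {hd' : ∀ n x, d' n (d' (n + 1) x) = 0}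
  {M'' : ℕ → Type u} [∀ n, AddCommGroup (M'' n)] [∀ n, Module R (M'' n)]
  {d'' : ∀ n, M'' (n + 1) →ₗ[R] M'' n} {hd'' : ∀ n x, d'' n (d'' (n + 1) x) = 0}

lemma moduleComplex_d (n : ℕ) : (moduleComplex M d hd).d (n + 1) n = ModuleCat.ofHom (d n) :=
  ChainComplex.of_d (fun n ↦ ModuleCat.of R (M n)) (fun n ↦ ModuleCat.ofHom (d n)) n

/-- The chain map attached to a sequence of linear maps. -/
noncomputable def moduleComplexHom (hd : ∀ n x, d n (d (n + 1) x) = 0)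
    (hd' : ∀ n x, d' n (d' (n + 1) x) = 0) (φ : ∀ n, M n →ₗ[R] M' n)
    (hφ : ∀ n x, φ n (d n x) = d' n (φ (n + 1) x)) :
    moduleComplex M d hd ⟶ moduleComplex M' d' hd' :=
  ChainComplex.ofHom (fun n ↦ ModuleCat.ofHom (φ n)) fun n ↦ by
    rw [moduleComplex_d, moduleComplex_d]
    ext x
    exact (hφ n x).symm

/-- The short complex of complexes attached to two composable sequences of linear maps. -/
noncomputable def moduleShortComplex (hd : ∀ n x, d n (d (n + 1) x) = 0)
    (hd' : ∀ n x, d' n (d' (n + 1) x) = 0) (hd'' : ∀ n x, d'' n (d'' (n + 1) x) = 0)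
    (φ : ∀ n, M n →ₗ[R] M' n) (hφ : ∀ n x, φ n (d n x) = d' n (φ (n + 1) x))
    (ψ : ∀ n, M' n →ₗ[R] M'' n) (hψ : ∀ n x, ψ n (d' n x) = d'' n (ψ (n + 1) x))
    (h : ∀ n, Function.Exact (φ n) (ψ n)) :
    ShortComplex (ChainComplex (ModuleCat.{u} R) ℕ) :=
  ShortComplex.mk (moduleComplexHom hd hd' φ hφ) (moduleComplexHom hd' hd'' ψ hψ) (by
    ext n x
    exact (h n).apply_apply_eq_zero x)

lemma moduleShortComplex_shortExact (hd : ∀ n x, d n (d (n + 1) x) = 0)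
    (hd' : ∀ n x, d' n (d' (n + 1) x) = 0) (hd'' : ∀ n x, d'' n (d'' (n + 1) x) = 0)
    (φ : ∀ n, M n →ₗ[R] M' n) (hφ : ∀ n x, φ n (d n x) = d' n (φ (n + 1) x))
    (ψ : ∀ n, M' n →ₗ[R] M'' n) (hψ : ∀ n x, ψ n (d' n x) = d'' n (ψ (n + 1) x))
    (h : ∀ n, Function.Exact (φ n) (ψ n)) (hi : ∀ n, Function.Injective (φ n))
    (hs : ∀ n, Function.Surjective (ψ n)) :
    (moduleShortComplex hd hd' hd'' φ hφ ψ hψ h).ShortExact :=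
  HomologicalComplex.shortExact_of_degreewise_shortExact _ fun n ↦
    ModuleCat.shortComplex_shortExact _ (h n) (hi n) (hs n)

end

/-- The length of the homology in a given degree. -/
noncomputable def homologyLength (K : ChainComplex (ModuleCat.{u} R) ℕ) (n : ℕ) : ℕ∞ :=
  Module.length R (K.homology n)

/-- Lengths with values in `ℕ∞` let the long exact sequence be read as inequalities without any
finiteness of homology. -/
lemma length_le_add_of_exact {S : ShortComplex (ModuleCat.{u} R)} (hS : S.Exact) :
    Module.length R S.X₂ ≤ Module.length R S.X₁ + Module.length R S.X₃ := by
  rw [Module.length_eq_add_of_exact (LinearMap.ker S.g.hom).subtype S.g.hom.rangeRestrict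
    (Submodule.injective_subtype _) S.g.hom.surjective_rangeRestrict
    (by intro x; simp [Subtype.ext_iff])]
  gcongr
  · rw [← hS.moduleCat_range_eq_ker]
    exact Module.length_le_of_surjective S.f.hom.rangeRestrict S.f.hom.surjective_rangeRestrict
  · exact Module.length_le_of_injective _ (Submodule.injective_subtype _)

section LongExact

variable {S : ShortComplex (ChainComplex (ModuleCat.{u} R) ℕ)}

lemma homologyLength_X₁_le (hS : S.ShortExact) (n : ℕ) :
    homologyLength S.X₁ n ≤ homologyLength S.X₃ (n + 1) + homologyLength S.X₂ n :=
  length_le_add_of_exact (hS.homology_exact₁ (n + 1) n rfl)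

lemma homologyLength_X₂_le (hS : S.ShortExact) (n : ℕ) :
    homologyLength S.X₂ n ≤ homologyLength S.X₁ n + homologyLength S.X₃ n :=
  length_le_add_of_exact (hS.homology_exact₂ n)

lemma homologyLength_X₃_succ_le (hS : S.ShortExact) (n : ℕ) :
    homologyLength S.X₃ (n + 1) ≤ homologyLength S.X₂ (n + 1) + homologyLength S.X₁ n :=
  length_le_add_of_exact (hS.homology_exact₃ (n + 1) n rfl)

lemma surjective_homologyMap_zero (hS : S.ShortExact) :
    Function.Surjective (HomologicalComplex.homologyMap S.g 0) := by
  have := hS.epi_g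
  rw [← ModuleCat.epi_iff_surjective]
  exact HomologicalComplex.epi_homologyMap_of_epi_of_not_rel _ _ (by simp)

lemma homologyLength_X₃_zero_le (hS : S.ShortExact) :
    homologyLength S.X₃ 0 ≤ homologyLength S.X₂ 0 :=
  Module.length_le_of_surjective (HomologicalComplex.homologyMap S.g 0).hom
    (surjective_homologyMap_zero hS)

/-- The two vanishing neighbours cut the long exact sequence down to a short one. Quantifying over
`m` makes `h₁` empty when `n = 0`. -/
lemma homologyLength_X₂_eq (hS : S.ShortExact) (n : ℕ) (h₃ : homologyLength S.X₃ (n + 1) = 0)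
    (h₁ : ∀ m, m + 1 = n → homologyLength S.X₁ m = 0) :
    homologyLength S.X₂ n = homologyLength S.X₁ n + homologyLength S.X₃ n := by
  refine Module.length_eq_add_of_exact (HomologicalComplex.homologyMap S.f n).hom
    (HomologicalComplex.homologyMap S.g n).hom ?_ ?_ ?_
  · rw [homologyLength, Module.length_eq_zero_iff] at h₃
    rw [injective_iff_map_eq_zero]
    intro x hx
    obtain ⟨y, rfl⟩ := (ShortComplex.moduleCat_exact_iff _).1
      (hS.homology_exact₁ (n + 1) n rfl) x hx
    rw [Subsingleton.elim y 0]
    exact map_zero (hS.δ (n + 1) n rfl).hom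
  · obtain _ | m := n
    · exact surjective_homologyMap_zero hS
    · have := h₁ m rfl
      rw [homologyLength, Module.length_eq_zero_iff] at this
      intro x
      exact (ShortComplex.moduleCat_exact_iff _).1 (hS.homology_exact₃ (m + 1) m rfl) x
        (Subsingleton.elim _ _)
  · exact (ShortComplex.ShortExact.moduleCat_exact_iff_function_exact _).1 (hS.homology_exact₂ n)

end LongExact

lemma homologyLength_congr {K L : ChainComplex (ModuleCat.{u} R) ℕ} (e : K ≅ L) (n : ℕ) :
    homologyLength K n = homologyLength L n :=
  ((HomologicalComplex.homologyFunctor _ _ n).mapIso e).toLinearEquiv.length_eq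

lemma length_homology_eq (S : ShortComplex (ModuleCat.{u} R)) :
    Module.length R S.homology = Module.length R (LinearMap.ker S.g.hom ⧸
      (LinearMap.range S.f.hom).comap (LinearMap.ker S.g.hom).subtype) := by
  refine S.moduleCatHomologyIso.toLinearEquiv.length_eq.trans ?_
  refine (Submodule.quotEquivOfEq _ _ ?_).length_eq
  ext x
  constructor
  · rintro ⟨y, rfl⟩
    exact ⟨y, rfl⟩
  · rintro ⟨y, hy⟩
    exact ⟨y, Subtype.ext hy⟩

lemma length_homology_eq_of_g_eq_zero (S : ShortComplex (ModuleCat.{u} R)) (hS : S.g = 0) :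
    Module.length R S.homology = Module.length R (S.X₂ ⧸ LinearMap.range S.f.hom) := by
  rw [length_homology_eq]
  have h : LinearMap.ker S.g.hom = ⊤ := by rw [hS]; exact LinearMap.ker_zero
  refine (Submodule.Quotient.equiv _ _ (LinearEquiv.ofTop _ h) ?_).length_eq
  ext x
  constructor
  · rintro ⟨y, hy, rfl⟩
    exact hy
  · intro hx
    exact ⟨⟨x, h ▸ trivial⟩, hx, rfl⟩

lemma homologyLength_eq_sc' (K : ChainComplex (ModuleCat.{u} R) ℕ) (i j k : ℕ)
    (hi : (ComplexShape.down ℕ).prev j = i) (hk : (ComplexShape.down ℕ).next j = k) :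
    homologyLength K j = Module.length R (K.sc' i j k).homology :=
  (ShortComplex.homologyMapIso (K.isoSc' i j k hi hk)).toLinearEquiv.length_eq

section

variable {M : ℕ → Type u} [∀ n, AddCommGroup (M n)] [∀ n, Module R (M n)]
  {d : ∀ n, M (n + 1) →ₗ[R] M n} {hd : ∀ n x, d n (d (n + 1) x) = 0}

lemma homologyLength_moduleComplex_succ (n : ℕ) :
    homologyLength (moduleComplex M d hd) (n + 1) = Module.length R (LinearMap.ker (d n) ⧸
      (LinearMap.range (d (n + 1))).comap (LinearMap.ker (d n)).subtype) := by
  rw [homologyLength_eq_sc' _ (n + 2) (n + 1) n (by simp) (by simp), length_homology_eq]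
  change Module.length R (LinearMap.ker ((moduleComplex M d hd).d (n + 1) n).hom ⧸
    (LinearMap.range ((moduleComplex M d hd).d (n + 2) (n + 1)).hom).comap
      (LinearMap.ker ((moduleComplex M d hd).d (n + 1) n).hom).subtype) = _
  rw [moduleComplex_d, moduleComplex_d]
  rfl

lemma homologyLength_moduleComplex_zero :
    homologyLength (moduleComplex M d hd) 0 = Module.length R (M 0 ⧸ LinearMap.range (d 0)) := by
  rw [homologyLength_eq_sc' _ 1 0 0 (by simp) (by simp), length_homology_eq_of_g_eq_zero]
  · change Module.length R (M 0 ⧸ LinearMap.range ((moduleComplex M d hd).d 1 0).hom) = _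
    rw [moduleComplex_d]
    rfl
  · exact (moduleComplex M d hd).shape _ _ (by simp)

lemma homologyLength_moduleComplex_succ_eq_zero_iff (n : ℕ) :
    homologyLength (moduleComplex M d hd) (n + 1) = 0 ↔
      ∀ x, d n x = 0 → ∃ y, d (n + 1) y = x := by
  rw [homologyLength_moduleComplex_succ, Module.length_eq_zero_iff,
    Submodule.Quotient.subsingleton_iff, eq_top_iff]
  constructor
  · intro h x hx
    exact h (x := ⟨x, hx⟩) trivial
  · intro h x _
    exact h x.1 x.2

lemma homologyLength_moduleComplex_zero_eq_zero_iff :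
    homologyLength (moduleComplex M d hd) 0 = 0 ↔ ∀ x, ∃ y, d 0 y = x := by
  rw [homologyLength_moduleComplex_zero, Module.length_eq_zero_iff,
    Submodule.Quotient.subsingleton_iff, LinearMap.range_eq_top]
  rfl

variable {M' : ℕ → Type u} [∀ n, AddCommGroup (M' n)] [∀ n, Module R (M' n)]
  {d' : ∀ n, M' (n + 1) →ₗ[R] M' n} {hd' : ∀ n x, d' n (d' (n + 1) x) = 0}

/-- The sequence of complexes splits by chain maps, so its homology sequence splits as well. -/
lemma homologyLength_prod {hd₂ : ∀ n x, (d n).prodMap (d' n) ((d (n + 1)).prodMap (d' (n + 1)) x) = 0}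
    (n : ℕ) : homologyLength (moduleComplex (fun n ↦ M n × M' n)
      (fun n ↦ (d n).prodMap (d' n)) hd₂) n =
        homologyLength (moduleComplex M d hd) n + homologyLength (moduleComplex M' d' hd') n := by
  have hex (n : ℕ) : Function.Exact (LinearMap.inl R (M n) (M' n)) (LinearMap.snd R (M n) (M' n)) := by
    intro x
    constructor
    · intro h
      exact ⟨x.1, Prod.ext rfl h.symm⟩
    · rintro ⟨y, rfl⟩
      rfl
  let S := moduleShortComplex hd hd₂ hd' (fun n ↦ LinearMap.inl R (M n) (M' n))
    (fun n x ↦ by simp) (fun n ↦ LinearMap.snd R (M n) (M' n)) (fun n x ↦ by simp) hex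
  have hS : S.ShortExact := moduleShortComplex_shortExact hd hd₂ hd' _ _ _ _ hex
    (fun n ↦ LinearMap.inl_injective) (fun n ↦ LinearMap.snd_surjective)
  refine Module.length_eq_add_of_exact (HomologicalComplex.homologyMap S.f n).hom
    (HomologicalComplex.homologyMap S.g n).hom ?_ ?_
    ((ShortComplex.ShortExact.moduleCat_exact_iff_function_exact _).1 (hS.homology_exact₂ n))
  · let r : S.X₂ ⟶ S.X₁ :=
      moduleComplexHom hd₂ hd (fun n ↦ LinearMap.fst R (M n) (M' n)) (fun n x ↦ by simp)
    have hr : S.f ≫ r = 𝟙 _ := by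
      ext n x
      rfl
    refine Function.LeftInverse.injective (g := (HomologicalComplex.homologyMap r n).hom) ?_
    intro x
    have := HomologicalComplex.homologyMap_comp S.f r n
    rw [hr, HomologicalComplex.homologyMap_id] at this
    exact (congrArg (fun f ↦ f.hom x) this).symm
  · let r : S.X₃ ⟶ S.X₂ :=
      moduleComplexHom hd' hd₂ (fun n ↦ LinearMap.inr R (M n) (M' n)) (fun n x ↦ by simp)
    have hr : r ≫ S.g = 𝟙 _ := by
      ext n x
      rfl
    refine Function.RightInverse.surjective (g := (HomologicalComplex.homologyMap r n).hom) ?_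
    intro x
    have := HomologicalComplex.homologyMap_comp r S.g n
    rw [hr, HomologicalComplex.homologyMap_id] at this
    exact (congrArg (fun f ↦ f.hom x) this).symm

end

end Complexes

/-! ### Smith theory for a complex with an operator of order `p` -/

/-- A complex over `ZMod p` with an action of a cyclic group of order `p` that is, degreewise, the
sum of a trivial representation `F` and a free one; `t` is the action of `g - 1`. -/
structure SmithData (p : ℕ) {M : ℕ → Type u} [∀ n, AddCommGroup (M n)]
    [∀ n, Module (ZMod p) (M n)] (d : ∀ n, M (n + 1) →ₗ[ZMod p] M n) where
  /-- The action of `g - 1`. -/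
  t (n : ℕ) : Module.End (ZMod p) (M n)
  /-- The fixed subcomplex. -/
  F (n : ℕ) : Submodule (ZMod p) (M n)
  d_d (n : ℕ) (x : M (n + 2)) : d n (d (n + 1) x) = 0
  t_d (n : ℕ) (x : M (n + 1)) : t n (d n x) = d n (t (n + 1) x)
  d_mem (n : ℕ) (x : M (n + 1)) : x ∈ F (n + 1) → d n x ∈ F n
  t_eq_zero (n : ℕ) (x : M n) : x ∈ F n → t n x = 0
  eq_zero (n : ℕ) (x : M n) : t n x ∈ F n → t n x = 0
  t_pow (n : ℕ) : t n ^ p = 0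
  exists_eq (n j : ℕ) : 0 < j → j < p → ∀ x : M n, (t n ^ j) x = 0 →
    ∃ z, ∃ w ∈ F n, x = (t n ^ (p - j)) z + w

namespace SmithData

variable {p : ℕ} {M : ℕ → Type u} [∀ n, AddCommGroup (M n)]
  [∀ n, Module (ZMod p) (M n)] {d : ∀ n, M (n + 1) →ₗ[ZMod p] M n} (D : SmithData p d)

lemma t_pow_d (j n : ℕ) (x : M (n + 1)) : (D.t n ^ j) (d n x) = d n ((D.t (n + 1) ^ j) x) := by
  induction j with
  | zero => rfl
  | succ j ih => rw [pow_succ', Module.End.mul_apply, ih, D.t_d, pow_succ', Module.End.mul_apply]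

lemma t_pow_eq_zero {j : ℕ} (hj : 0 < j) (n : ℕ) {x : M n} (hx : x ∈ D.F n) :
    (D.t n ^ j) x = 0 := by
  obtain ⟨i, rfl⟩ := Nat.exists_eq_succ_of_ne_zero hj.ne'
  rw [pow_succ, Module.End.mul_apply, D.t_eq_zero n x hx, map_zero]

/-- The whole complex. -/
noncomputable def total : ChainComplex (ModuleCat.{u} (ZMod p)) ℕ := moduleComplex M d D.d_d

/-- The fixed subcomplex. -/
noncomputable def fixed : ChainComplex (ModuleCat.{u} (ZMod p)) ℕ :=
  moduleComplex (fun n ↦ D.F n) (fun n ↦ (d n).restrict (D.d_mem n))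
    fun n x ↦ Subtype.ext (D.d_d n x.1)

lemma d_mem_range (j n : ℕ) (x : M (n + 1)) (hx : x ∈ LinearMap.range (D.t (n + 1) ^ j)) :
    d n x ∈ LinearMap.range (D.t n ^ j) := by
  obtain ⟨y, rfl⟩ := hx
  exact ⟨d n y, D.t_pow_d j n y⟩

/-- The image of the `j`-th power of `g - 1`. -/
noncomputable def image (j : ℕ) : ChainComplex (ModuleCat.{u} (ZMod p)) ℕ :=
  moduleComplex (fun n ↦ LinearMap.range (D.t n ^ j)) (fun n ↦ (d n).restrict (D.d_mem_range j n))
    fun n x ↦ Subtype.ext (D.d_d n x.1)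

/-- The sum of an image and the fixed subcomplex. -/
noncomputable def imageProdFixed (j : ℕ) : ChainComplex (ModuleCat.{u} (ZMod p)) ℕ :=
  moduleComplex (fun n ↦ LinearMap.range (D.t n ^ j) × D.F n)
    (fun n ↦ ((d n).restrict (D.d_mem_range j n)).prodMap ((d n).restrict (D.d_mem n)))
    fun n x ↦ Prod.ext (Subtype.ext (D.d_d n x.1.1)) (Subtype.ext (D.d_d n x.2.1))

lemma homologyLength_imageProdFixed (j n : ℕ) : homologyLength (D.imageProdFixed j) n =
    homologyLength (D.image j) n + homologyLength D.fixed n :=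
  homologyLength_prod n

/-- The kernel of `t^j` is the direct sum of `im t^(p-j)` and `F`: `exists_eq` gives generation, and
`eq_zero` gives trivial intersection because `p - j` is positive. -/
lemma exists_shortExact {j : ℕ} (hj : 0 < j) (hjp : j < p) :
    ∃ S : ShortComplex (ChainComplex (ModuleCat.{u} (ZMod p)) ℕ), S.ShortExact ∧
      S.X₁ = D.imageProdFixed (p - j) ∧ S.X₂ = D.total ∧ S.X₃ = D.image j := by
  have hex (n : ℕ) : Function.Exact ((LinearMap.range (D.t n ^ (p - j))).subtype.coprod
      (D.F n).subtype) (D.t n ^ j).rangeRestrict := by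
    intro x
    rw [← LinearMap.mem_ker, LinearMap.ker_rangeRestrict, LinearMap.mem_ker]
    constructor
    · intro hx
      obtain ⟨z, w, hw, rfl⟩ := D.exists_eq n j hj hjp x hx
      exact ⟨(⟨_, z, rfl⟩, ⟨w, hw⟩), rfl⟩
    · rintro ⟨⟨⟨_, z, rfl⟩, ⟨w, hw⟩⟩, rfl⟩
      change (D.t n ^ j) ((D.t n ^ (p - j)) z + w) = 0
      rw [map_add, ← Module.End.mul_apply, ← pow_add, Nat.add_sub_cancel' hjp.le, D.t_pow,
        D.t_pow_eq_zero hj n hw]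
      simp
  refine ⟨_, moduleShortComplex_shortExact (M := fun n ↦ LinearMap.range (D.t n ^ (p - j)) × D.F n)
    (d := fun n ↦ ((d n).restrict (D.d_mem_range (p - j) n)).prodMap ((d n).restrict (D.d_mem n)))
    (M'' := fun n ↦ LinearMap.range (D.t n ^ j))
    (d'' := fun n ↦ (d n).restrict (D.d_mem_range j n))
    (fun n x ↦ Prod.ext (Subtype.ext (D.d_d n x.1.1)) (Subtype.ext (D.d_d n x.2.1)))
    D.d_d (fun n x ↦ Subtype.ext (D.d_d n x.1)) _ ?_ _ ?_ hex ?_ ?_, rfl, rfl, rfl⟩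
  · intro n x
    simp [LinearMap.coprod_apply]
  · intro n x
    exact Subtype.ext (D.t_pow_d j n x)
  · intro n
    rw [injective_iff_map_eq_zero]
    rintro ⟨⟨_, z, rfl⟩, ⟨w, hw⟩⟩ h
    have h' : (D.t n ^ (p - j)) z + w = 0 := h
    obtain ⟨i, hi⟩ := Nat.exists_eq_succ_of_ne_zero (Nat.sub_pos_of_lt hjp).ne'
    have h0 : (D.t n ^ (p - j)) z = 0 := by
      rw [hi, pow_succ', Module.End.mul_apply] at h' ⊢
      refine D.eq_zero n _ ?_
      rw [eq_neg_of_add_eq_zero_left h']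
      exact neg_mem hw
    refine Prod.ext (Subtype.ext h0) (Subtype.ext ?_)
    rwa [h0, zero_add] at h'
  · intro n
    exact LinearMap.surjective_rangeRestrict _

/-- The map is `t`. If `t^(j+1) y = 0`, then `y` is `t^(p-j-1) z` up to a fixed chain, and `t^j`
turns this into `t^(p-1) z`. -/
lemma exists_shortExact_image {j : ℕ} (hj : 0 < j) (hjp : j + 1 < p) :
    ∃ S : ShortComplex (ChainComplex (ModuleCat.{u} (ZMod p)) ℕ), S.ShortExact ∧
      S.X₁ = D.image (p - 1) ∧ S.X₂ = D.image j ∧ S.X₃ = D.image (j + 1) := by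
  have hle (n : ℕ) : LinearMap.range (D.t n ^ (p - 1)) ≤ LinearMap.range (D.t n ^ j) := by
    rintro _ ⟨x, rfl⟩
    refine ⟨(D.t n ^ (p - 1 - j)) x, ?_⟩
    rw [← Module.End.mul_apply, ← pow_add, Nat.add_sub_cancel' (by lia)]
  have hmap (n : ℕ) (x) (hx : x ∈ LinearMap.range (D.t n ^ j)) :
      D.t n x ∈ LinearMap.range (D.t n ^ (j + 1)) := by
    obtain ⟨y, rfl⟩ := hx
    exact ⟨y, by rw [pow_succ', Module.End.mul_apply]⟩
  have hex (n : ℕ) : Function.Exact (Submodule.inclusion (hle n))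
      ((D.t n).restrict (hmap n)) := by
    rintro ⟨_, y, rfl⟩
    rw [Subtype.ext_iff]
    change (D.t n) ((D.t n ^ j) y) = 0 ↔ _
    rw [← Module.End.mul_apply, ← pow_succ']
    constructor
    · intro h
      obtain ⟨z, w, hw, rfl⟩ := D.exists_eq n (j + 1) (by lia) hjp y h
      refine ⟨⟨_, z, rfl⟩, Subtype.ext ?_⟩
      change (D.t n ^ (p - 1)) z = (D.t n ^ j) ((D.t n ^ (p - (j + 1))) z + w)
      rw [map_add, D.t_pow_eq_zero hj n hw, add_zero, ← Module.End.mul_apply, ← pow_add]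
      congr 2
      lia
    · rintro ⟨⟨_, z, rfl⟩, h⟩
      have h' : (D.t n ^ (p - 1)) z = (D.t n ^ j) y := congrArg Subtype.val h
      rw [pow_succ', Module.End.mul_apply, ← h', ← Module.End.mul_apply, ← pow_succ',
        Nat.sub_add_cancel (by lia), D.t_pow]
      rfl
  refine ⟨_, moduleShortComplex_shortExact
    (d := fun n ↦ (d n).restrict (D.d_mem_range (p - 1) n))
    (d' := fun n ↦ (d n).restrict (D.d_mem_range j n))
    (d'' := fun n ↦ (d n).restrict (D.d_mem_range (j + 1) n))
    (fun n x ↦ Subtype.ext (D.d_d n x.1)) (fun n x ↦ Subtype.ext (D.d_d n x.1))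
    (fun n x ↦ Subtype.ext (D.d_d n x.1)) _ ?_ _ ?_ hex ?_ ?_, rfl, rfl, rfl⟩
  · intro n x
    rfl
  · intro n x
    exact Subtype.ext (D.t_d n x)
  · intro n
    exact Submodule.inclusion_injective _
  · rintro n ⟨_, y, rfl⟩
    refine ⟨⟨_, y, rfl⟩, Subtype.ext ?_⟩
    change (D.t n) ((D.t n ^ j) y) = (D.t n ^ (j + 1)) y
    rw [pow_succ', Module.End.mul_apply]

variable {N : ℕ}

/-- Vanishing spreads from `t^(p-1)` to the smaller powers by descending induction on `j`. -/
lemma homologyLength_image_eq_zero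
    (hN : ∀ i, N ≤ i → homologyLength (D.image (p - 1)) i = 0) {j : ℕ} (hj : 0 < j) (hjp : j < p)
    {i : ℕ} (hi : N ≤ i) : homologyLength (D.image j) i = 0 := by
  obtain ⟨k, hk⟩ := Nat.exists_eq_add_of_le (Nat.le_sub_one_of_lt hjp)
  induction k generalizing j with
  | zero => rw [add_zero] at hk; rw [← hk, hN i hi]
  | succ k ih =>
    obtain ⟨S, hS, h₁, h₂, h₃⟩ := D.exists_shortExact_image hj (by lia)
    have h := homologyLength_X₂_le hS i
    rw [h₁, h₂, h₃, hN i hi, ih (j := j + 1) (by lia) (by lia) (by lia), add_zero] at h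
    exact le_antisymm h bot_le

lemma image_add_fixed_le {j : ℕ} (hj : 0 < j) (hjp : j < p) (i : ℕ) :
    homologyLength (D.image (p - j)) i + homologyLength D.fixed i ≤
      homologyLength (D.image j) (i + 1) + homologyLength D.total i := by
  obtain ⟨S, hS, h₁, h₂, h₃⟩ := D.exists_shortExact hj hjp
  have h := homologyLength_X₁_le hS i
  rwa [h₁, h₂, h₃, homologyLength_imageProdFixed] at h

/-- The Smith inequality. -/
theorem image_add_sum_fixed_le (hN : ∀ i, N ≤ i → homologyLength (D.image (p - 1)) i = 0)
    (k n : ℕ) (hk : N ≤ n + k) {j : ℕ} (hj : 0 < j) (hjp : j < p) :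
    homologyLength (D.image j) n + ∑ i ∈ Finset.range k, homologyLength D.fixed (n + i) ≤
      ∑ i ∈ Finset.range k, homologyLength D.total (n + i) := by
  induction k generalizing n j with
  | zero => simp [D.homologyLength_image_eq_zero hN hj hjp (i := n) hk]
  | succ k ih =>
    -- The connecting map raises the degree by one and exchanges `j` with `p - j`, so the induction
    -- has to treat all `j` at once.
    have h1 := ih (n + 1) (by lia) (j := p - j) (by lia) (by lia)
    have h2 := D.image_add_fixed_le (j := p - j) (by lia) (by lia) n
    rw [Nat.sub_sub_self hjp.le] at h2
    simp only [Finset.sum_range_succ', add_zero, ← add_assoc, Nat.add_right_comm n _ 1] at h1 ⊢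
    calc _ = homologyLength (D.image j) n + homologyLength D.fixed n +
          ∑ i ∈ Finset.range k, homologyLength D.fixed (n + 1 + i) := by
          abel
      _ ≤ homologyLength (D.image (p - j)) (n + 1) + homologyLength D.total n +
          ∑ i ∈ Finset.range k, homologyLength D.fixed (n + 1 + i) := by gcongr
      _ = homologyLength (D.image (p - j)) (n + 1) +
          ∑ i ∈ Finset.range k, homologyLength D.fixed (n + 1 + i) + homologyLength D.total n := by
          abel
      _ ≤ _ := by
          gcongr

variable [Fact p.Prime]

lemma sum_fixed_le (hN : ∀ i, N ≤ i → homologyLength (D.image (p - 1)) i = 0) {k : ℕ} (hk : N ≤ k) :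
    ∑ i ∈ Finset.range k, homologyLength D.fixed i ≤
      ∑ i ∈ Finset.range k, homologyLength D.total i := by
  have := D.image_add_sum_fixed_le hN k 0 (by lia) one_pos (Fact.out : p.Prime).one_lt
  simp only [zero_add] at this
  exact le_add_self.trans this

theorem fixed_eq_zero (hN : ∀ i, N ≤ i → homologyLength (D.image (p - 1)) i = 0)
    (h : ∀ i, homologyLength D.total i = 0) (i : ℕ) : homologyLength D.fixed i = 0 := by
  have h1 := D.sum_fixed_le hN (k := N + i + 1) (by lia)
  simp only [h, Finset.sum_const_zero] at h1
  exact Finset.sum_eq_zero_iff.1 (le_antisymm h1 bot_le) i (by simp)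

/-- Below `m` one climbs: `H_(i+1)(im t^j)` lies between `H_(i+1)` of the whole complex and `H_i` of
`im t^(p-j) ⊕ F`, both zero. Above `m` the Smith inequality has right-hand side zero. -/
lemma image_eq_zero (hN : ∀ i, N ≤ i → homologyLength (D.image (p - 1)) i = 0) {m : ℕ}
    (h : ∀ i, i ≠ m → homologyLength D.total i = 0) (hf : ∀ i, homologyLength D.fixed i = 0)
    {j : ℕ} (hj : 0 < j) (hjp : j < p) {i : ℕ} (hi : i ≠ m) : homologyLength (D.image j) i = 0 := by
  rcases hi.lt_or_gt with hi | hi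
  · induction i generalizing j with
    | zero =>
      obtain ⟨S, hS, h₁, h₂, h₃⟩ := D.exists_shortExact hj hjp
      have h' := homologyLength_X₃_zero_le hS
      rw [h₃, h₂, h 0 (by lia)] at h'
      exact le_antisymm h' bot_le
    | succ i ih =>
      obtain ⟨S, hS, h₁, h₂, h₃⟩ := D.exists_shortExact hj hjp
      have h' := homologyLength_X₃_succ_le hS i
      rw [h₁, h₂, h₃, homologyLength_imageProdFixed, h _ (by lia), hf,
        ih (by lia) (by lia) (by lia) (by lia)] at h'
      exact le_antisymm h' bot_le
  · have h' := D.image_add_sum_fixed_le hN N i (by lia) hj hjp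
    rw [Finset.sum_eq_zero (f := fun k ↦ homologyLength D.total (i + k))
      fun k _ ↦ h _ (by lia)] at h'
    exact le_antisymm (le_self_add.trans h') bot_le

/-- This replaces the congruence of Euler characteristics modulo `p`. If the fixed part had no
homology, the homology of the image complexes would sit in degree `m`, their lengths would be
additive, and `p` times a length would equal one. -/
lemma exists_fixed_ne_zero (hN : ∀ i, N ≤ i → homologyLength (D.image (p - 1)) i = 0) {m : ℕ}
    (h : ∀ i, i ≠ m → homologyLength D.total i = 0) (hm : homologyLength D.total m = 1) :
    ∃ i, homologyLength D.fixed i ≠ 0 := by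
  by_contra! hf
  have hz : ∀ j, 0 < j → j < p → ∀ i, i ≠ m → homologyLength (D.image j) i = 0 :=
    fun j hj hjp i hi ↦ D.image_eq_zero hN h hf hj hjp hi
  have h1 : ∀ j, 0 < j → j < p →
      homologyLength (D.image (p - j)) m + homologyLength (D.image j) m = 1 := by
    intro j hj hjp
    obtain ⟨S, hS, h₁, h₂, h₃⟩ := D.exists_shortExact hj hjp
    have h' := homologyLength_X₂_eq hS m (by rw [h₃, hz j hj hjp _ (by lia)]) (by
      rintro i rfl
      rw [h₁, homologyLength_imageProdFixed, hf, hz _ (by lia) (by lia) _ (by lia), add_zero])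
    rw [h₁, h₂, h₃, homologyLength_imageProdFixed, hf, hm, add_zero] at h'
    exact h'.symm
  -- Here `k + 1 = p - j`; lowering `j` by one adds one more copy of the homology of `im t^(p-1)`.
  have h2 : ∀ k, ∀ j, 0 < j → j + k + 1 = p →
      homologyLength (D.image j) m = (k + 1) * homologyLength (D.image (p - 1)) m := by
    intro k
    induction k with
    | zero =>
      intro j hj hjp
      obtain rfl : j = p - 1 := by lia
      simp
    | succ k ih =>
      intro j hj hjp
      obtain ⟨S, hS, h₁, h₂, h₃⟩ := D.exists_shortExact_image (j := j) hj (by lia)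
      have h' := homologyLength_X₂_eq hS m (by rw [h₃, hz _ (by lia) (by lia) _ (by lia)]) (by
        rintro i rfl
        rw [h₁, hz _ (by lia) (by lia) _ (by lia)])
      rw [h₁, h₂, h₃, ih (j + 1) (by lia) (by lia)] at h'
      rw [h']
      push_cast
      ring
  have hp := (Fact.out : p.Prime).two_le
  have h3 := h1 1 one_pos (by lia)
  rw [h2 (p - 2) 1 one_pos (by lia)] at h3
  generalize homologyLength (D.image (p - 1)) m = a at h3
  -- The equation `h3` amounts to `p * a = 1`; it rules out the infinite value, and the finite ones
  -- because `p ≥ 2`.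
  induction a using ENat.recTopCoe with
  | top => simp at h3
  | coe a =>
    norm_cast at h3
    have : a * (p - 2 + 2) = 1 := by rw [← h3]; ring
    have := Nat.isUnit_iff.1 (IsUnit.of_mul_eq_one_right _ this)
    lia

/-- If the whole complex has one-dimensional homology, then so has the fixed subcomplex. -/
theorem exists_fixed_eq (hN : ∀ i, N ≤ i → homologyLength (D.image (p - 1)) i = 0) {m : ℕ}
    (h : ∀ i, i ≠ m → homologyLength D.total i = 0) (hm : homologyLength D.total m = 1) :
    ∃ l, homologyLength D.fixed l = 1 ∧ ∀ i, i ≠ l → homologyLength D.fixed i = 0 := by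
  obtain ⟨l, hl⟩ := D.exists_fixed_ne_zero hN h hm
  have hle : ∀ s : Finset ℕ, ∑ i ∈ s, homologyLength D.fixed i ≤ 1 := by
    intro s
    obtain ⟨k, hk⟩ := s.exists_nat_subset_range
    calc _ ≤ ∑ i ∈ Finset.range (k + N), homologyLength D.fixed i :=
          Finset.sum_le_sum_of_subset (hk.trans (Finset.range_mono (by lia)))
      _ ≤ _ := D.sum_fixed_le hN (by lia)
      _ ≤ ∑ i ∈ Finset.range (k + N), if i = m then 1 else 0 := by
          refine Finset.sum_le_sum fun i _ ↦ ?_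
          split_ifs with him
          · rw [him, hm]
          · rw [h i him]
      _ ≤ 1 := by
          rw [Finset.sum_ite_eq']
          split_ifs <;> simp
  have hl1 : homologyLength D.fixed l = 1 :=
    le_antisymm (by simpa using hle {l}) (Order.one_le_iff_ne_zero.2 hl)
  refine ⟨l, hl1, fun i hi ↦ ?_⟩
  have := hle {i, l}
  rw [Finset.sum_pair hi, hl1] at this
  by_contra h0
  have h1 := Order.one_le_iff_ne_zero.2 h0
  have h2 : (1 + 1 : ℕ∞) ≤ 1 := (add_le_add_left h1 1).trans this
  exact absurd h2 (by decide)

end SmithData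

open stdSimplex

namespace SingularChain

/-! ### The norm operator of a cyclic group -/

section Norm

variable (p : ℕ) {Y Z : Type*} [TopologicalSpace Y] [TopologicalSpace Z]

/-- The operator `(g - 1) ^ (p - 1)`, which is the norm element of the group ring if `g` generates
a group of order `p`. -/
noncomputable def norm (g : C(Y, Y)) (n : ℕ) : Module.End (ZMod p) (SingularChain (ZMod p) Y n) :=
  (map (ZMod p) g n - 1) ^ (p - 1)

variable {p} {g : C(Y, Y)}

/-- The norm is a polynomial in the action, so every equivariant linear operator commutes with it:
boundary, subdivision, homotopy operators, restriction to invariant sets of simplices. -/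
lemma apply_norm {g' : C(Z, Z)} {m n : ℕ}
    (L : SingularChain (ZMod p) Y m →ₗ[ZMod p] SingularChain (ZMod p) Z n)
    (hL : ∀ c, L (map (ZMod p) g m c) = map (ZMod p) g' n (L c)) (c : SingularChain (ZMod p) Y m) :
    L (norm p g m c) = norm p g' n (L c) := by
  rw [norm, norm]
  generalize p - 1 = j
  induction j with
  | zero => rfl
  | succ j ih =>
    rw [pow_succ', pow_succ', Module.End.mul_apply, Module.End.mul_apply, LinearMap.sub_apply,
      LinearMap.sub_apply, map_sub, hL, Module.End.one_apply, Module.End.one_apply, ih]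

lemma boundary_norm {n : ℕ} (c : SingularChain (ZMod p) Y (n + 1)) :
    boundary (ZMod p) n (norm p g (n + 1) c) = norm p g n (boundary (ZMod p) n c) :=
  apply_norm _ (fun c ↦ (map_boundary g c).symm) c

lemma subdiv_norm {n : ℕ} (c : SingularChain (ZMod p) Y n) :
    subdiv (ZMod p) n (norm p g n c) = norm p g n (subdiv (ZMod p) n c) :=
  apply_norm _ (fun c ↦ (map_subdiv g c).symm) c

lemma subdiv_pow_norm {n : ℕ} (c : SingularChain (ZMod p) Y n) (k : ℕ) :
    (subdiv (ZMod p) n ^ k) (norm p g n c) = norm p g n ((subdiv (ZMod p) n ^ k) c) :=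
  apply_norm _ (fun c ↦ (map_subdiv_pow g c k).symm) c

lemma norm_mem_chainsIn {S : Set Y} (hS : Set.MapsTo g S S) {n : ℕ}
    {c : SingularChain (ZMod p) Y n} (hc : c ∈ chainsIn (ZMod p) S n) :
    norm p g n c ∈ chainsIn (ZMod p) S n := by
  rw [norm]
  generalize p - 1 = j
  induction j with
  | zero => exact hc
  | succ j ih =>
    rw [pow_succ', Module.End.mul_apply]
    exact sub_mem (map_mem_chainsIn hS ih) ih

/-- A norm supported in an invariant set is the norm of a chain supported in that set. -/
lemma exists_norm_eq {S : Set Y} (hS : ∀ y, g y ∈ S ↔ y ∈ S) {n : ℕ}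
    {c : SingularChain (ZMod p) Y n} (hc : norm p g n c ∈ chainsIn (ZMod p) S n) :
    ∃ c' ∈ chainsIn (ZMod p) S n, norm p g n c' = norm p g n c := by
  classical
  -- Since `S` is invariant, discarding the simplices that leave `S` commutes with `g`, hence with
  -- the norm.
  let P : C(stdSimplex ℝ (Fin n), Y) → Prop := fun s ↦ Set.range s ⊆ S
  have hP (s) : P (g.comp s) ↔ P s := by
    simp only [P, Set.range_subset_iff]
    exact forall_congr' fun x ↦ hS (s x)
  let L : SingularChain (ZMod p) Y n →ₗ[ZMod p] SingularChain (ZMod p) Y n :=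
    { toFun := Finsupp.filter P
      map_add' := fun _ _ ↦ Finsupp.filter_add
      map_smul' := fun _ _ ↦ Finsupp.filter_smul }
  have hL (c) : L (map (ZMod p) g n c) = map (ZMod p) g n (L c) := by
    induction c using Finsupp.induction_linear with
    | zero => simp
    | add x y hx hy => simp only [map_add, hx, hy]
    | single s r =>
      rw [map_single]
      change Finsupp.filter P _ = map _ _ _ (Finsupp.filter P _)
      by_cases h : P s
      · rw [Finsupp.filter_single_of_pos _ h, Finsupp.filter_single_of_pos _ ((hP s).2 h),
          map_single]
      · rw [Finsupp.filter_single_of_neg _ h, Finsupp.filter_single_of_neg _ (mt (hP s).1 h),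
          map_zero]
  refine ⟨L c, ?_, ?_⟩
  · refine (Finsupp.mem_supported' _ _).2 fun s hs ↦ ?_
    exact Finsupp.filter_apply_neg _ _ hs
  · rw [← apply_norm L hL]
    change Finsupp.filter P _ = _
    rw [Finsupp.filter_eq_self_iff]
    intro s hs
    by_contra h
    exact hs ((Finsupp.mem_supported' _ _).1 hc s h)

variable (p g) in
/-- Every cycle of index `n` that is the norm of a chain in `S` bounds the norm of a chain
in `S`. -/
def NormAcyclicAt (S : Set Y) (n : ℕ) : Prop :=
  ∀ c ∈ chainsIn (ZMod p) S n, IsCycle (norm p g n c) →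
    ∃ b ∈ chainsIn (ZMod p) S (n + 1), boundary (ZMod p) n (norm p g (n + 1) b) = norm p g n c

/-- The restriction of a map to an invariant subset. -/
def restrictMapsTo (g : C(Y, Y)) {S : Set Y} (hS : Set.MapsTo g S S) : C(S, S) :=
  ⟨hS.restrict, g.continuous.restrict hS⟩

lemma map_incl_norm {S : Set Y} (hS : Set.MapsTo g S S) {n : ℕ}
    (c : SingularChain (ZMod p) S n) : map (ZMod p) (incl S) n (norm p (restrictMapsTo g hS) n c) =
      norm p g n (map (ZMod p) (incl S) n c) :=
  apply_norm _ (fun c ↦ by rw [map_map, map_map]; rfl) c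

lemma NormAcyclicAt.of_univ {S : Set Y} (hS : Set.MapsTo g S S) {n : ℕ}
    (h : NormAcyclicAt p (restrictMapsTo g hS) Set.univ n) : NormAcyclicAt p g S n := by
  intro c hc hc'
  obtain ⟨c, rfl⟩ := exists_map_eq hc
  obtain ⟨b, -, hb⟩ := h c (mem_chainsIn_univ _)
    (by rw [← map_incl_norm hS] at hc'; exact hc'.of_map Subtype.val_injective)
  refine ⟨map (ZMod p) (incl S) _ b, map_mem_chainsIn (mapsTo_incl S) (mem_chainsIn_univ b), ?_⟩
  rw [← map_incl_norm hS, ← map_boundary, hb, map_incl_norm]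

/-- The operator of the constant homotopy is equivariant, so the chain joining a norm to its
subdivision is itself a norm. -/
lemma exists_boundary_norm_eq_subdiv_sub_univ {n : ℕ} {c : SingularChain (ZMod p) Y n}
    (hc' : IsCycle (norm p g n c)) : ∃ b,
      boundary (ZMod p) n (norm p g (n + 1) b) =
        norm p g n (subdiv (ZMod p) n c) - norm p g n c := by
  cases n with
  | zero => exact ⟨0, by rw [subdiv_zero]; simp⟩
  | succ n =>
    refine ⟨homotopyOperator (ZMod p) ContinuousMap.fst _ c, ?_⟩
    rw [← apply_norm (g := g) (homotopyOperator (ZMod p) ContinuousMap.fst (n + 1))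
      (fun c ↦ (map_homotopyOperator ContinuousMap.fst g (by ext1 x; rfl) c).symm),
      boundary_homotopyOperator, show boundary _ _ _ = 0 from hc', map_zero, sub_zero]
    have h (v : stdSimplex ℝ (Fin 2)) : (ContinuousMap.fst : C(Y × stdSimplex ℝ (Fin 2), Y)).comp
      ((ContinuousMap.id _).prodMk (ContinuousMap.const _ v)) = ContinuousMap.id _ := rfl
    rw [h, h, map_id, subdiv_norm]

lemma exists_boundary_norm_eq_subdiv_sub {S : Set Y} (hS : Set.MapsTo g S S) {n : ℕ}
    {c : SingularChain (ZMod p) Y n} (hc : c ∈ chainsIn (ZMod p) S n)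
    (hc' : IsCycle (norm p g n c)) : ∃ b ∈ chainsIn (ZMod p) S (n + 1),
      boundary (ZMod p) n (norm p g (n + 1) b) =
        norm p g n (subdiv (ZMod p) n c) - norm p g n c := by
  obtain ⟨c, rfl⟩ := exists_map_eq hc
  obtain ⟨b, hb⟩ := exists_boundary_norm_eq_subdiv_sub_univ (g := restrictMapsTo g hS) (c := c)
    (by rw [← map_incl_norm hS] at hc'; exact hc'.of_map Subtype.val_injective)
  refine ⟨map (ZMod p) (incl S) _ b, map_mem_chainsIn (mapsTo_incl S) (mem_chainsIn_univ b), ?_⟩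
  rw [← map_incl_norm hS, ← map_boundary, hb, map_sub, map_incl_norm, map_incl_norm, map_subdiv]

lemma exists_boundary_norm_eq_subdiv_pow_sub {S : Set Y} (hS : Set.MapsTo g S S) {n : ℕ}
    {c : SingularChain (ZMod p) Y n} (hc : c ∈ chainsIn (ZMod p) S n)
    (hc' : IsCycle (norm p g n c)) (k : ℕ) : ∃ b ∈ chainsIn (ZMod p) S (n + 1),
      boundary (ZMod p) n (norm p g (n + 1) b) =
        norm p g n ((subdiv (ZMod p) n ^ k) c) - norm p g n c := by
  induction k with
  | zero => exact ⟨0, zero_mem _, by simp⟩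
  | succ k ih =>
    obtain ⟨b, hb, hb'⟩ := ih
    obtain ⟨b', h, h'⟩ := exists_boundary_norm_eq_subdiv_sub hS (subdiv_pow_mem_chainsIn hc k)
      (by rw [← subdiv_pow_norm]; exact hc'.subdiv_pow k)
    refine ⟨b' + b, add_mem h hb, ?_⟩
    rw [map_add, map_add, h', hb', pow_succ', Module.End.mul_apply]
    abel

lemma boundary_norm_homotopyOperator (H : C(Y × stdSimplex ℝ (Fin 2), Y))
    (hg : ∀ y t, H (g y, t) = g (H (y, t))) (h0 : ∀ y, H (y, vertex 0) = y) {n : ℕ}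
    {c : SingularChain (ZMod p) Y (n + 1)} (hc : IsCycle (norm p g (n + 1) c)) :
    boundary (ZMod p) (n + 1) (norm p g (n + 2) (homotopyOperator (ZMod p) H _ c)) =
      norm p g (n + 1) (subdiv (ZMod p) (n + 1) (map (ZMod p)
        (H.comp ((ContinuousMap.id _).prodMk (ContinuousMap.const _ (vertex 1)))) (n + 1) c)) -
        norm p g (n + 1) c := by
  set r : C(Y, Y) := H.comp ((ContinuousMap.id _).prodMk (ContinuousMap.const _ (vertex 1))) with hr
  have hr0 : H.comp ((ContinuousMap.id _).prodMk (ContinuousMap.const _ (vertex 0))) =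
      ContinuousMap.id _ := by
    ext1 y
    exact h0 y
  rw [← apply_norm (g := g) (homotopyOperator (ZMod p) H (n + 1))
    (fun c ↦ (map_homotopyOperator H g (by ext1 x; exact hg x.1 x.2) c).symm),
    boundary_homotopyOperator, show boundary _ _ _ = 0 from hc, map_zero, sub_zero, hr0, map_id,
    ← hr, apply_norm (g := g) (g' := g) (map (ZMod p) r (n + 1)), subdiv_norm]
  intro c
  rw [map_map, map_map]
  congr 2
  ext1 y
  exact hg y (vertex 1)

/-- Invariance of the acyclicity of norms under equivariant deformations. -/
lemma NormAcyclicAt.of_deformation {S A : Set Y} (hS : Set.MapsTo g S S) (hAS : A ⊆ S)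
    (H : C(S × stdSimplex ℝ (Fin 2), S))
    (hg : ∀ y t, H (hS.restrict g S S y, t) = hS.restrict g S S (H (y, t)))
    (h0 : ∀ y, H (y, vertex 0) = y)
    (h1 : ∀ y, (H (y, vertex 1) : Y) ∈ A) {n : ℕ} (h : NormAcyclicAt p g A (n + 1)) :
    NormAcyclicAt p g S (n + 1) := by
  intro c hc hc'
  obtain ⟨c, rfl⟩ := exists_map_eq hc
  change IsCycle (norm p g (n + 1) (map (ZMod p) (incl S) (n + 1) c)) at hc'
  rw [← map_incl_norm hS] at hc'
  have key := congrArg (map (ZMod p) (incl S) (n + 1)) (boundary_norm_homotopyOperator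
    (g := restrictMapsTo g hS) H hg h0 (hc'.of_map Subtype.val_injective))
  rw [map_boundary, map_sub, map_incl_norm, map_incl_norm, map_incl_norm, map_subdiv, map_map]
    at key
  set x := map (ZMod p) (incl S) (n + 1 + 1) (homotopyOperator (ZMod p) H (n + 1) c)
  set w := map (ZMod p) ((incl S).comp (H.comp
    ((ContinuousMap.id _).prodMk (ContinuousMap.const _ (vertex 1))))) (n + 1) c with hw
  obtain ⟨b, hb, hb'⟩ := h (subdiv (ZMod p) (n + 1) w)
    (subdiv_mem_chainsIn (map_mem_chainsIn (S := Set.univ) (fun y _ ↦ h1 y) (mem_chainsIn_univ c)))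
    (by
      rw [← sub_add_cancel (norm p g (n + 1) (subdiv _ _ _))
        (norm p g (n + 1) (map (ZMod p) (incl S) (n + 1) c)), ← key]
      refine (isCycle_boundary _).add ?_
      rwa [← map_incl_norm hS])
  refine ⟨b - x, sub_mem (chainsIn_mono hAS _ hb)
    (map_mem_chainsIn (mapsTo_incl S) (mem_chainsIn_univ _)), ?_⟩
  rw [map_sub, map_sub, hb', key]
  change _ = norm p g (n + 1) (map (ZMod p) (incl S) (n + 1) c)
  abel

/-- The Mayer–Vietoris argument for norms. -/
lemma NormAcyclicAt.union {S O₁ O₂ : Set Y} (h₁ : IsOpen O₁) (h₂ : IsOpen O₂) (hS : S ⊆ O₁ ∪ O₂)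
    (gS : ∀ y, g y ∈ S ↔ y ∈ S) (g₁ : ∀ y, g y ∈ O₁ ↔ y ∈ O₁) (g₂ : ∀ y, g y ∈ O₂ ↔ y ∈ O₂)
    {n : ℕ} (a₁ : NormAcyclicAt p g (S ∩ O₁) (n + 1)) (a₂ : NormAcyclicAt p g (S ∩ O₂) (n + 1))
    (a : NormAcyclicAt p g (S ∩ (O₁ ∩ O₂)) n) : NormAcyclicAt p g S (n + 1) := by
  intro c hc hc'
  obtain ⟨k, x, hx, y, hy, hxy⟩ := exists_subdiv_pow_eq_add h₁ h₂ hS hc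
  obtain ⟨b, hb, hb'⟩ := exists_boundary_norm_eq_subdiv_pow_sub (fun y hy ↦ (gS y).2 hy) hc hc' k
  have m₁ : Set.MapsTo g (S ∩ O₁) (S ∩ O₁) := fun y hy ↦ ⟨(gS y).2 hy.1, (g₁ y).2 hy.2⟩
  have m₂ : Set.MapsTo g (S ∩ O₂) (S ∩ O₂) := fun y hy ↦ ⟨(gS y).2 hy.1, (g₂ y).2 hy.2⟩
  have hneg : norm p g n (boundary (ZMod p) n x) = - norm p g n (boundary (ZMod p) n y) := by
    have h : boundary (ZMod p) n (norm p g (n + 1) ((subdiv (ZMod p) (n + 1) ^ k) c)) = 0 := by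
      rw [← subdiv_pow_norm]
      exact hc'.subdiv_pow k
    rw [hxy, map_add, map_add, boundary_norm, boundary_norm] at h
    exact eq_neg_of_add_eq_zero_left h
  -- The norm of `∂x` lies in the overlap although `∂x` need not; replacing `∂x` by a chain `w` of
  -- the overlap with the same norm makes `a` applicable.
  obtain ⟨w, hw, hwx⟩ := exists_norm_eq (S := S ∩ (O₁ ∩ O₂)) (g := g)
    (fun y ↦ and_congr (gS y) (and_congr (g₁ y) (g₂ y))) (c := boundary (ZMod p) n x) (by
      rw [Set.inter_inter_distrib_left, ← chainsIn_inter]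
      refine ⟨norm_mem_chainsIn m₁ (boundary_mem_chainsIn hx), ?_⟩
      rw [hneg]
      exact neg_mem (norm_mem_chainsIn m₂ (boundary_mem_chainsIn hy)))
  obtain ⟨e, he, hew⟩ := a w hw (by
    rw [hwx, ← boundary_norm]
    exact isCycle_boundary _)
  have he₁ := chainsIn_mono (Set.inter_subset_inter_right S
    (Set.inter_subset_left (s := O₁) (t := O₂))) _ he
  have he₂ := chainsIn_mono (Set.inter_subset_inter_right S
    (Set.inter_subset_right (s := O₁) (t := O₂))) _ he
  obtain ⟨b₁, hb₁, hb₁'⟩ := a₁ (x - e) (sub_mem hx he₁) (by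
    rw [IsCycle, map_sub, map_sub, hew, hwx, boundary_norm, sub_self])
  obtain ⟨b₂, hb₂, hb₂'⟩ := a₂ (y + e) (add_mem hy he₂) (by
    rw [IsCycle, map_add, map_add, hew, hwx, boundary_norm, hneg, add_neg_cancel])
  refine ⟨b₁ + b₂ - b, sub_mem (add_mem (chainsIn_mono Set.inter_subset_left _ hb₁)
    (chainsIn_mono Set.inter_subset_left _ hb₂)) hb, ?_⟩
  rw [map_sub, map_sub, map_add, map_add, hb₁', hb₂', hb', hxy, map_sub, map_add, map_add]
  abel

end Norm

/-! ### Locally constant decompositions -/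

section LocallyConstant

variable {R : Type*} [CommRing R] {Y E : Type*} [TopologicalSpace Y] {q : Y → E}

lemma apply_eq_of_isLocallyConstant (hq : IsLocallyConstant q) {n : ℕ}
    (s : C(stdSimplex ℝ (Fin n), Y)) (x y : stdSimplex ℝ (Fin n)) : q (s x) = q (s y) := by
  have : PreconnectedSpace (stdSimplex ℝ (Fin n)) :=
    Subtype.preconnectedSpace (convex_stdSimplex ℝ (Fin n)).isPreconnected
  exact (hq.comp_continuous s.continuous).apply_eq_of_preconnectedSpace x y

open Classical in
/-- The projection to the chains in the pieces with index in `A`. -/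
noncomputable def piece (q : Y → E) (A : Set E) (n : ℕ) :
    SingularChain R Y (n + 1) →ₗ[R] SingularChain R Y (n + 1) where
  toFun := Finsupp.filter fun s ↦ q (s (vertex 0)) ∈ A
  map_add' _ _ := Finsupp.filter_add
  map_smul' _ _ := Finsupp.filter_smul

open Classical in
lemma piece_apply_of_notMem (A : Set E) {n : ℕ} {c : SingularChain R Y (n + 1)}
    {s : C(stdSimplex ℝ (Fin (n + 1)), Y)} (hs : q (s (vertex 0)) ∉ A) : piece q A n c s = 0 :=
  Finsupp.filter_apply_neg (fun s : C(stdSimplex ℝ (Fin (n + 1)), Y) ↦ q (s (vertex 0)) ∈ A) _ hs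

open Classical in
lemma piece_apply_of_mem {A : Set E} {n : ℕ} {c : SingularChain R Y (n + 1)}
    {s : C(stdSimplex ℝ (Fin (n + 1)), Y)} (hs : q (s (vertex 0)) ∈ A) : piece q A n c s = c s :=
  Finsupp.filter_apply_pos (fun s : C(stdSimplex ℝ (Fin (n + 1)), Y) ↦ q (s (vertex 0)) ∈ A) _ hs

open Classical in
lemma piece_single_of_mem {A : Set E} {n : ℕ} {s : C(stdSimplex ℝ (Fin (n + 1)), Y)}
    (hs : q (s (vertex 0)) ∈ A) (r : R) :
    piece q A n (Finsupp.single s r) = Finsupp.single s r :=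
  Finsupp.filter_single_of_pos (fun s : C(stdSimplex ℝ (Fin (n + 1)), Y) ↦ q (s (vertex 0)) ∈ A) hs

open Classical in
lemma piece_single_of_notMem {A : Set E} {n : ℕ} {s : C(stdSimplex ℝ (Fin (n + 1)), Y)}
    (hs : q (s (vertex 0)) ∉ A) (r : R) : piece q A n (Finsupp.single s r) = 0 :=
  Finsupp.filter_single_of_neg (fun s : C(stdSimplex ℝ (Fin (n + 1)), Y) ↦ q (s (vertex 0)) ∈ A) hs

lemma piece_add_piece_compl (A : Set E) {n : ℕ} (c : SingularChain R Y (n + 1)) :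
    piece q A n c + piece q Aᶜ n c = c := by
  induction c using Finsupp.induction_linear with
  | zero => simp
  | add x y hx hy =>
    rw [map_add, map_add, add_add_add_comm, hx, hy]
  | single s r =>
    by_cases hs : q (s (vertex 0)) ∈ A
    · rw [piece_single_of_mem hs, piece_single_of_notMem (by simpa using hs), add_zero]
    · rw [piece_single_of_notMem hs, piece_single_of_mem (A := Aᶜ) hs, zero_add]

lemma boundary_piece (hq : IsLocallyConstant q) (A : Set E) {n : ℕ}
    (c : SingularChain R Y (n + 2)) :
    boundary R (n + 1) (piece q A (n + 1) c) = piece q A n (boundary R (n + 1) c) := by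
  induction c using Finsupp.induction_linear with
  | zero => simp
  | add x y hx hy => rw [map_add, map_add, map_add, map_add, hx, hy]
  | single s r =>
    have h : ∀ i, q ((s.comp (face i)) (vertex 0)) = q (s (vertex 0)) := fun i ↦
      apply_eq_of_isLocallyConstant hq s _ _
    rw [boundary_single', map_smul, map_sum]
    by_cases hs : q (s (vertex 0)) ∈ A
    · rw [piece_single_of_mem hs, boundary_single']
      congr 1
      refine Finset.sum_congr rfl fun i _ ↦ ?_
      rw [map_smul, piece_single_of_mem]
      rwa [h]
    · rw [piece_single_of_notMem hs, map_zero, Finset.sum_eq_zero, smul_zero]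
      intro i _
      rw [map_smul, piece_single_of_notMem (by rwa [h]), smul_zero]

lemma piece_mem_chainsIn (hq : IsLocallyConstant q) (A : Set E) {n : ℕ}
    (c : SingularChain R Y (n + 1)) : piece q A n c ∈ chainsIn R (q ⁻¹' A) (n + 1) := by
  refine (Finsupp.mem_supported' _ _).2 fun s hs ↦ piece_apply_of_notMem A fun h ↦ hs ?_
  rintro _ ⟨x, rfl⟩
  rw [Set.mem_preimage, apply_eq_of_isLocallyConstant hq s x (vertex 0)]
  exact h

/-- A simplex is connected and so lies in one piece; a chain meets finitely many pieces, and these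
are split off one at a time. The index is at least two because the augmentation mixes the pieces. -/
lemma acyclicAt_univ_of_isLocallyConstant (hq : IsLocallyConstant q) {n : ℕ}
    (h : ∀ e, AcyclicAt R (q ⁻¹' {e}) (n + 2)) : AcyclicAt R (Set.univ : Set Y) (n + 2) := by
  classical
  suffices ∀ (I : Finset E) (c : SingularChain R Y (n + 2)), IsCycle c →
      (∀ s, c s ≠ 0 → q (s (vertex 0)) ∈ I) → IsBoundaryIn Set.univ c from
    fun c _ hc ↦ this (c.support.image fun s ↦ q (s (vertex 0))) c hc fun s hs ↦
      Finset.mem_image_of_mem (fun s ↦ q (s (vertex 0))) (Finsupp.mem_support_iff.2 hs)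
  have hcyc (A : Set E) (c : SingularChain R Y (n + 2)) (hc : IsCycle c) :
      IsCycle (piece q A (n + 1) c) := by
    rw [IsCycle, boundary_piece hq, show boundary R (n + 1) c = 0 from hc, map_zero]
  intro I
  induction I using Finset.induction_on with
  | empty =>
    intro c _ hI
    obtain rfl : c = 0 := by
      ext s
      by_contra hs
      exact absurd (hI s hs) (Finset.notMem_empty _)
    exact isBoundaryIn_zero _ _
  | insert e I _ ih =>
    intro c hc hI
    have h1 := (h e _ (piece_mem_chainsIn hq _ c) (hcyc _ c hc)).mono (Set.subset_univ _)
    have h2 := ih (piece q {e}ᶜ (n + 1) c) (hcyc _ c hc) (by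
      intro s hs
      have hse : q (s (vertex 0)) ∈ ({e}ᶜ : Set E) := by
        by_contra h
        exact hs (piece_apply_of_notMem _ h)
      rw [piece_apply_of_mem hse] at hs
      exact Finset.mem_of_mem_insert_of_ne (hI s hs) hse)
    rw [← piece_add_piece_compl (q := q) {e} c]
    exact h1.add h2

end LocallyConstant

/-! ### Norms on spaces whose pieces are permuted by the group -/

section FreePieces

variable {p : ℕ} [Fact p.Prime] {Y E : Type*} [TopologicalSpace Y] {q : Y → E}

/-- Postcomposition with a map of order `p`, as a permutation of the simplices. -/
def simplexPerm (g : C(Y, Y)) (hg : ∀ y, g^[p] y = y) (n : ℕ) :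
    Equiv.Perm C(stdSimplex ℝ (Fin n), Y) where
  toFun s := g.comp s
  invFun s := ⟨fun x ↦ g^[p - 1] (s x), (g.continuous.iterate _).comp s.continuous⟩
  left_inv s := by
    ext1 x
    change g^[p - 1] (g (s x)) = s x
    rw [← Function.iterate_succ_apply, Nat.succ_eq_add_one,
      Nat.sub_add_cancel (Fact.out : p.Prime).one_le, hg]
  right_inv s := by
    ext1 x
    change g (g^[p - 1] (s x)) = s x
    rw [← Function.iterate_succ_apply' (f := g), Nat.succ_eq_add_one,
      Nat.sub_add_cancel (Fact.out : p.Prime).one_le, hg]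

variable {g : C(Y, Y)}

lemma simplexPerm_pow_apply (hg : ∀ y, g^[p] y = y) (n k : ℕ) (s : C(stdSimplex ℝ (Fin n), Y)) (x : stdSimplex ℝ (Fin n)) :
    (simplexPerm g hg n ^ k) s x = g^[k] (s x) := by
  induction k with
  | zero => rfl
  | succ k ih =>
    rw [pow_succ', Equiv.Perm.mul_apply, Function.iterate_succ_apply', ← ih]
    rfl

lemma simplexPerm_pow_eq_one (hg : ∀ y, g^[p] y = y) (n : ℕ) : simplexPerm g hg n ^ p = 1 := by
  ext s x
  rw [simplexPerm_pow_apply, hg]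
  rfl

lemma permSubOne_simplexPerm_pow (hg : ∀ y, g^[p] y = y) (n : ℕ) :
    permSubOne (simplexPerm g hg n) (ZMod p) ^ (p - 1) = norm p g n := rfl

/-- Norms on a space that decomposes into acyclic pieces that are permuted by the group, the ones
that are preserved being fixed pointwise. -/
lemma normAcyclicAt_univ_of_isLocallyConstant (hg : ∀ y, g^[p] y = y) (hq : IsLocallyConstant q) {γ : Equiv.Perm E}
    (hγ : γ ^ p = 1) (hqg : ∀ y, q (g y) = γ (q y)) (hfix : ∀ y, γ (q y) = q y → g y = y) {n : ℕ}
    (h : ∀ e, AcyclicAt (ZMod p) (q ⁻¹' {e}) (n + 2)) :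
    NormAcyclicAt p g Set.univ (n + 2) := by
  classical
  intro c _ hc
  set f := simplexPerm g hg (n + 2)
  obtain ⟨T, hT⟩ := exists_isFreeTransversal hγ
  have hfq (s) : q (f s (vertex 0)) = γ (q (s (vertex 0))) := hqg _
  have hfq' (k : ℕ) (s) : q ((f⁻¹ ^ k) s (vertex 0)) = (γ⁻¹ ^ k) (q (s (vertex 0))) := by
    induction k with
    | zero => rfl
    | succ k ih =>
      rw [pow_succ', pow_succ', Equiv.Perm.mul_apply, Equiv.Perm.mul_apply, ← ih,
        eq_comm, Equiv.Perm.inv_eq_iff_eq, ← hfq]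
      congr 2
      exact (f.apply_symm_apply _).symm
  -- A simplex in a preserved piece is fixed, so the moved simplices are those in moved pieces and a
  -- transversal of pieces gives one of simplices.
  have hT' : IsFreeTransversal p f {s | q (s (vertex 0)) ∈ T} := by
    refine ⟨fun {s} hs h ↦ hT.ne hs ?_, fun {s} hs ↦ ?_⟩
    · rw [← hfq, h]
    · have h1 : γ (q (s (vertex 0))) ≠ q (s (vertex 0)) := by
        intro h1
        refine hs ?_
        ext1 x
        refine hfix _ ?_
        rwa [apply_eq_of_isLocallyConstant hq s x (vertex 0)]
      obtain ⟨k, ⟨hk, hkT⟩, hu⟩ := hT.existsUnique h1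
      refine ⟨k, ⟨hk, ?_⟩, fun l hl ↦ hu l ⟨hl.1, ?_⟩⟩
      · change q _ ∈ T
        rwa [hfq']
      · rw [← hfq']
        exact hl.2
  have hp := (Fact.out : p.Prime).one_lt
  -- A norm is invariant and vanishes on fixed simplices, so it is the norm of its restriction to
  -- the pieces in `T`. That restriction is still a cycle, and the norm of a filling of it is the
  -- desired filling.
  have h1 : norm p g (n + 2) (piece q T (n + 1) (norm p g (n + 2) c)) = norm p g (n + 2) c := by
    refine eq_permSubOne_pow_filter (f := f) hT' (c := norm p g (n + 2) c) ?_ ?_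
    · rw [← permSubOne_simplexPerm_pow hg, ← Module.End.mul_apply, ← pow_succ',
        Nat.sub_add_cancel hp.le, permSubOne,
        sub_one_pow_prime (lmapDomain_pow_eq_one _ (simplexPerm_pow_eq_one hg _))]
      rfl
    · intro s hs
      obtain ⟨j, hj⟩ := Nat.exists_eq_succ_of_ne_zero (Nat.sub_pos_of_lt hp).ne'
      rw [← permSubOne_simplexPerm_pow hg, hj, pow_succ', Module.End.mul_apply,
        permSubOne_apply_of_fixed _ hs]
  obtain ⟨b, hb, hb'⟩ := acyclicAt_univ_of_isLocallyConstant hq h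
    (piece q T (n + 1) (norm p g (n + 2) c)) (mem_chainsIn_univ _) (by
      rw [IsCycle, boundary_piece hq, show boundary _ _ _ = 0 from hc, map_zero])
  exact ⟨b, hb, by rw [boundary_norm, hb', h1]⟩

end FreePieces

end SingularChain

/-! ### Equivariant characteristic maps -/

section CellMap

open Metric Topology.RelCWComplex
open scoped Pointwise

variable (G : Type*) [Group G] {X : Type u} [TopologicalSpace X] [MulAction G X]
  [Topology.CWComplex (Set.univ : Set X)] {n : ℕ}

/-- The orbit relation on the cells. -/
def cellSetoid (X : Type u) [TopologicalSpace X] [MulAction G X]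
    [Topology.CWComplex (Set.univ : Set X)] (n : ℕ) : Setoid (cell (Set.univ : Set X) n) where
  r i j := ∃ g : G, g • openCell n i = openCell n j
  iseqv := ⟨fun i ↦ ⟨1, one_smul _ _⟩, by
    rintro i j ⟨g, h⟩
    exact ⟨g⁻¹, by rw [← h, inv_smul_smul]⟩, by
    rintro i j k ⟨g, h⟩ ⟨g', h'⟩
    exact ⟨g' * g, by rw [mul_smul, h, h']⟩⟩

/-- A representative of the orbit of a cell. -/
noncomputable def cellRep (i : cell (Set.univ : Set X) n) : cell (Set.univ : Set X) n :=
  (Quotient.mk (cellSetoid G X n) i).out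

lemma exists_smul_openCell_cellRep (i : cell (Set.univ : Set X) n) :
    ∃ g : G, g • openCell n (cellRep G i) = openCell n i :=
  Quotient.exact (Quotient.out_eq (Quotient.mk (cellSetoid G X n) i))

/-- A group element carrying the representative of the orbit of a cell to the cell. -/
noncomputable def cellTransport (i : cell (Set.univ : Set X) n) : G :=
  (exists_smul_openCell_cellRep G i).choose

lemma cellTransport_smul (i : cell (Set.univ : Set X) n) :
    cellTransport G i • openCell n (cellRep G i) = openCell n i :=
  (exists_smul_openCell_cellRep G i).choose_spec

/-- An equivariant choice of characteristic maps. -/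
noncomputable def cellMap (i : cell (Set.univ : Set X) n) (y : Fin n → ℝ) : X :=
  cellTransport G i • map n (cellRep G i) y

lemma image_cellMap (i : cell (Set.univ : Set X) n) (S : Set (Fin n → ℝ)) :
    cellMap G i '' S = cellTransport G i • (map n (cellRep G i) '' S) := by
  rw [← Set.image_smul, Set.image_image]
  rfl

lemma image_cellMap_ball (i : cell (Set.univ : Set X) n) :
    cellMap G i '' ball 0 1 = openCell n i := by
  rw [image_cellMap, ← cellTransport_smul G i]
  rfl

lemma injOn_cellMap (i : cell (Set.univ : Set X) n) : Set.InjOn (cellMap G i) (ball 0 1) := by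
  intro x hx y hy h
  refine (map n (cellRep G i)).injOn ?_ ?_ (MulAction.injective _ h) <;> rwa [source_eq]

lemma cellMap_mem_openCell (i : cell (Set.univ : Set X) n) {y : Fin n → ℝ} (hy : ‖y‖ < 1) :
    cellMap G i y ∈ openCell n i := by
  rw [← image_cellMap_ball G]
  exact ⟨y, by simpa using hy, rfl⟩

section Continuous

variable [ContinuousConstSMul G X]

lemma continuousOn_cellMap (i : cell (Set.univ : Set X) n) :
    ContinuousOn (cellMap G i) (closedBall 0 1) :=
  (continuousOn n (cellRep G i)).const_smul _

/-- A parametrization of an open cell by the whole Euclidean space. -/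
noncomputable def cellEmbedding (i : cell (Set.univ : Set X) n) (y : Fin n → ℝ) : X :=
  cellMap G i (Homeomorph.unitBall y : ball (0 : Fin n → ℝ) 1)

lemma continuous_cellEmbedding (i : cell (Set.univ : Set X) n) :
    Continuous (cellEmbedding G i) := by
  refine (continuousOn_cellMap G i).comp_continuous (by fun_prop) fun y ↦ ?_
  exact ball_subset_closedBall (Homeomorph.unitBall y).2

lemma range_cellEmbedding (i : cell (Set.univ : Set X) n) :
    Set.range (cellEmbedding G i) = openCell n i := by
  have h : cellEmbedding G i = cellMap G i ∘ Subtype.val ∘ Homeomorph.unitBall := rfl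
  rw [h, Set.range_comp, Set.range_comp, Homeomorph.unitBall.surjective.range_eq, Set.image_univ,
    Subtype.range_coe, image_cellMap_ball]

/-- The inverse of the characteristic map of the representative is continuous on its open cell, and
translation by `cellTransport` is a homeomorphism. -/
lemma isEmbedding_cellEmbedding (i : cell (Set.univ : Set X) n) :
    Topology.IsEmbedding (cellEmbedding G i) := by
  have hinj : Function.Injective (cellEmbedding G i) := by
    intro x y h
    exact Homeomorph.unitBall.injective (Subtype.ext (injOn_cellMap G i
      (Homeomorph.unitBall x).2 (Homeomorph.unitBall y).2 h))
  refine ⟨⟨le_antisymm (continuous_cellEmbedding G i).le_induced ?_⟩, hinj⟩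
  intro U hU
  have hsymm := continuousOn_symm n (cellRep G i)
  have htar : (map n (cellRep G i)).target = openCell n (cellRep G i) := by
    rw [← PartialEquiv.image_source_eq_target, source_eq, openCell]
  rw [htar, _root_.continuousOn_iff'] at hsymm
  obtain ⟨V, hV, hV'⟩ := isOpen_induced_iff.1 (Homeomorph.unitBall.symm.continuous.isOpen_preimage U hU)
  obtain ⟨W, hW, hW'⟩ := hsymm V hV
  refine isOpen_induced_iff.2 ⟨cellTransport G i • W, hW.smul _, ?_⟩
  ext y
  have hy := (Homeomorph.unitBall y).2
  have hmem : map n (cellRep G i) (Homeomorph.unitBall y) ∈ openCell n (cellRep G i) := ⟨_, hy, rfl⟩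
  have h1 := Set.ext_iff.1 hW' (map n (cellRep G i) (Homeomorph.unitBall y))
  rw [Set.mem_inter_iff, Set.mem_inter_iff, and_iff_left hmem, and_iff_left hmem,
    Set.mem_preimage, PartialEquiv.left_inv _ (by rwa [source_eq])] at h1
  have h2 := Set.ext_iff.1 hV' (Homeomorph.unitBall y)
  rw [Set.mem_preimage, Set.mem_preimage, Homeomorph.symm_apply_apply] at h2
  rw [Set.mem_preimage, cellEmbedding, cellMap, Set.smul_mem_smul_set_iff, ← h1, h2]

end Continuous

end CellMap

/-! ### Equivariance of the chosen characteristic maps and of the skeleta -/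

namespace IsGCWComplex

open Metric Topology.RelCWComplex
open scoped Pointwise

variable {G : Type*} [Group G] {X : Type u} [TopologicalSpace X] [T2Space X] [MulAction G X]
  [ContinuousConstSMul G X] [Topology.CWComplex (Set.univ : Set X)] {n : ℕ}

lemma exists_smul_openCell_eq (hX : IsGCWComplex G X) (g : G)
    (i : cell (Set.univ : Set X) n) : ∃ j : cell (Set.univ : Set X) n, g • openCell n i = openCell n j :=
  hX.exists_image_openCell_eq g n i

lemma smul_eq_of_mem_closedCell (hX : IsGCWComplex G X) {g : G} {i : cell (Set.univ : Set X) n}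
    (h : g • openCell n i = openCell n i) {x : X} (hx : x ∈ closedCell n i) : g • x = x := by
  have h1 : IsClosed {x : X | g • x = x} := isClosed_eq (continuous_const_smul g) continuous_id
  rw [← closure_openCell_eq_closedCell] at hx
  exact closure_minimal (fun x hx ↦ hX.smul_eq_of_image_openCell_eq g n i h x hx) h1 hx

/-- Both cells have the same representative, and the two ways of reaching the second cell from it
differ by an element stabilizing the representative. Such an element fixes the closed cell
pointwise, so the choice of transport does not matter. -/
lemma smul_cellMap (hX : IsGCWComplex G X) {g : G} {i j : cell (Set.univ : Set X) n}
    (h : g • openCell n i = openCell n j) {y : Fin n → ℝ} (hy : ‖y‖ ≤ 1) :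
    g • cellMap G i y = cellMap G j y := by
  have hrep : cellRep G i = cellRep G j := by
    rw [cellRep, cellRep]
    congr 1
    exact Quotient.sound ⟨g, h⟩
  have h1 : ((cellTransport G j)⁻¹ * (g * cellTransport G i)) • openCell n (cellRep G i) =
      openCell n (cellRep G i) := by
    rw [mul_smul, mul_smul, cellTransport_smul, h, ← cellTransport_smul G j, inv_smul_smul, hrep]
  have h2 := hX.smul_eq_of_mem_closedCell h1 (x := map n (cellRep G i) y)
    ⟨y, by simpa using hy, rfl⟩
  rw [mul_smul, mul_smul, inv_smul_eq_iff] at h2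
  exact h2.trans (by rw [cellMap, hrep])

lemma image_cellMap_closedBall (i : cell (Set.univ : Set X) n) :
    cellMap G i '' closedBall 0 1 = closedCell n i := by
  rw [image_cellMap]
  change cellTransport G i • closedCell n (cellRep G i) = _
  rw [← closure_openCell_eq_closedCell, ← closure_openCell_eq_closedCell, ← closure_smul,
    cellTransport_smul]

lemma smul_mem_skeletonLT (hX : IsGCWComplex G X) (g : G) {m : ℕ∞} {x : X} (hx : x ∈ skeletonLT (Set.univ : Set X) m) :
    g • x ∈ skeletonLT (Set.univ : Set X) m := by
  rw [Topology.CWComplex.mem_skeletonLT_iff] at hx ⊢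
  obtain ⟨k, hk, i, hi⟩ := hx
  obtain ⟨j, hj⟩ := hX.exists_smul_openCell_eq g i
  exact ⟨k, hk, j, hj ▸ Set.smul_mem_smul_set hi⟩

lemma smul_mem_skeletonLT_iff (hX : IsGCWComplex G X) (g : G) {m : ℕ∞} {x : X} :
    g • x ∈ skeletonLT (Set.univ : Set X) m ↔ x ∈ skeletonLT (Set.univ : Set X) m :=
  ⟨fun h ↦ by simpa using hX.smul_mem_skeletonLT g⁻¹ h, hX.smul_mem_skeletonLT g⟩

lemma cellMap_mem_skeletonLT (hX : IsGCWComplex G X) (i : cell (Set.univ : Set X) n) {y : Fin n → ℝ} (hy : ‖y‖ = 1) :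
    cellMap G i y ∈ skeletonLT (Set.univ : Set X) n :=
  hX.smul_mem_skeletonLT _ (cellFrontier_subset_skeletonLT n _ ⟨y, by simpa using hy, rfl⟩)

end IsGCWComplex

/-! ### The strata of a CW complex and their centres -/

section Strata

open Metric Topology.RelCWComplex

variable {X : Type u} [TopologicalSpace X] [T2Space X] [Topology.CWComplex (Set.univ : Set X)]
  {n : ℕ}

lemma mem_skeletonLT_succ_iff {x : X} : x ∈ skeletonLT (Set.univ : Set X) ((n + 1 : ℕ) : ℕ∞) ↔
    x ∈ skeletonLT (Set.univ : Set X) n ∨ ∃ i : cell (Set.univ : Set X) n, x ∈ openCell n i := by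
  simp only [Topology.CWComplex.mem_skeletonLT_iff, Nat.cast_lt, Nat.lt_succ_iff_lt_or_eq,
    exists_prop]
  constructor
  · rintro ⟨m, hm | rfl, h⟩
    exacts [.inl ⟨m, hm, h⟩, .inr h]
  · rintro (⟨m, hm, h⟩ | h)
    exacts [⟨m, .inl hm, h⟩, ⟨n, .inr rfl, h⟩]

lemma notMem_skeletonLT_of_mem_openCell {m : ℕ} (hnm : n ≤ m) {i : cell (Set.univ : Set X) m}
    {x : X} (hx : x ∈ openCell m i) : x ∉ skeletonLT (Set.univ : Set X) n := fun h ↦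
  Set.disjoint_left.1 (disjoint_skeletonLT_openCell (C := (Set.univ : Set X)) (n := n) (m := m)
    (j := i) (by exact_mod_cast hnm)) h hx

lemma eq_of_mem_openCell {i j : cell (Set.univ : Set X) n} {x : X} (hi : x ∈ openCell n i)
    (hj : x ∈ openCell n j) : i = j := by
  have := eq_of_not_disjoint_openCell (Set.not_disjoint_iff.2 ⟨x, hi, hj⟩)
  simpa using this

lemma dim_eq_of_mem_openCell {m : ℕ} {i : cell (Set.univ : Set X) n} {j : cell (Set.univ : Set X) m}
    {x : X} (hi : x ∈ openCell n i) (hj : x ∈ openCell m j) : n = m :=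
  congrArg Sigma.fst (eq_of_not_disjoint_openCell (Set.not_disjoint_iff.2 ⟨x, hi, hj⟩))

lemma closedCell_subset_skeletonLT_of_lt {m : ℕ} (h : m < n) (i : cell (Set.univ : Set X) m) :
    closedCell m i ⊆ skeletonLT (Set.univ : Set X) n :=
  (closedCell_subset_skeletonLT m i).trans (skeletonLT_mono (by exact_mod_cast h))

/-- An open `n`-cell is open in the `n`-skeleton. -/
lemma isClosed_skeletonLT_union_openCell_ne (i : cell (Set.univ : Set X) n) :
    IsClosed ((skeletonLT (Set.univ : Set X) n : Set X) ∪
      ⋃ (j : cell (Set.univ : Set X) n) (_ : j ≠ i), openCell n j) := by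
  refine Topology.CWComplex.isClosed_of_isClosed_inter_openCell_or_isClosed_inter_closedCell
    (C := Set.univ) (Set.subset_univ _) fun m _ l ↦ ?_
  have hempty (h : ∀ x ∈ openCell m l, x ∉ skeletonLT (Set.univ : Set X) n ∧
      ∀ j ≠ i, x ∉ openCell n j) : IsClosed (((skeletonLT (Set.univ : Set X) n : Set X) ∪
      ⋃ (j : cell (Set.univ : Set X) n) (_ : j ≠ i), openCell n j) ∩ openCell m l) := by
    convert isClosed_empty
    rw [Set.eq_empty_iff_forall_notMem]
    rintro x ⟨hx | hx, hxl⟩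
    · exact (h x hxl).1 hx
    · simp only [Set.mem_iUnion] at hx
      obtain ⟨j, hj, hx⟩ := hx
      exact (h x hxl).2 j hj hx
  rcases lt_trichotomy m n with h | rfl | h
  · right
    rw [Set.inter_eq_self_of_subset_right]
    · exact isClosed_closedCell
    · exact (closedCell_subset_skeletonLT_of_lt h l).trans Set.subset_union_left
  · by_cases hl : l = i
    · left
      subst hl
      exact hempty fun x hx ↦ ⟨notMem_skeletonLT_of_mem_openCell le_rfl hx,
        fun j hj hx' ↦ hj (eq_of_mem_openCell hx' hx)⟩
    · right
      rw [Set.inter_eq_self_of_subset_right]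
      · exact isClosed_closedCell
      · rw [← cellFrontier_union_openCell_eq_closedCell]
        refine Set.union_subset_union (cellFrontier_subset_skeletonLT m l) ?_
        exact Set.subset_iUnion₂_of_subset l hl le_rfl
  · left
    exact hempty fun x hx ↦ ⟨notMem_skeletonLT_of_mem_openCell h.le hx,
      fun j _ hx' ↦ h.ne (dim_eq_of_mem_openCell hx' hx)⟩

variable (G : Type*) [Group G] [MulAction G X]

/-- The centres of the `n`-cells. -/
def cellCenters (X : Type u) [TopologicalSpace X] [Topology.CWComplex (Set.univ : Set X)] (n : ℕ)
    (G : Type*) [Group G] [MulAction G X] : Set X :=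
  Set.range fun i : cell (Set.univ : Set X) n ↦ cellMap G i 0

lemma cellMap_zero_mem_openCell (i : cell (Set.univ : Set X) n) :
    cellMap G i 0 ∈ openCell n i :=
  cellMap_mem_openCell G i (by simp)

/-- In a CW complex this can be tested cell by cell, and an open cell contains at most one centre.
-/
lemma isClosed_cellCenters : IsClosed (cellCenters X n G) := by
  refine Topology.CWComplex.isClosed_of_isClosed_inter_openCell_or_isClosed_inter_closedCell
    (C := Set.univ) (Set.subset_univ _) fun m _ l ↦ Or.inl ?_
  refine Set.Subsingleton.isClosed ?_
  rintro _ ⟨⟨i, rfl⟩, hi⟩ _ ⟨⟨j, rfl⟩, hj⟩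
  obtain rfl := dim_eq_of_mem_openCell (cellMap_zero_mem_openCell G i) hi
  change cellMap G i 0 = cellMap G j 0
  rw [eq_of_mem_openCell (cellMap_zero_mem_openCell G i) hi,
    eq_of_mem_openCell (cellMap_zero_mem_openCell G j) hj]

lemma notMem_skeletonLT_of_mem_cellCenters {x : X} (hx : x ∈ cellCenters X n G) :
    x ∉ skeletonLT (Set.univ : Set X) n := by
  obtain ⟨i, rfl⟩ := hx
  exact notMem_skeletonLT_of_mem_openCell le_rfl (cellMap_zero_mem_openCell G i)

lemma cellMap_mem_cellCenters_iff {i : cell (Set.univ : Set X) n} {y : Fin n → ℝ} (hy : ‖y‖ < 1) :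
    cellMap G i y ∈ cellCenters X n G ↔ y = 0 := by
  constructor
  · rintro ⟨j, hj⟩
    have h := eq_of_mem_openCell (cellMap_zero_mem_openCell G j)
      (hj ▸ cellMap_mem_openCell G i hy)
    subst h
    exact injOn_cellMap G j (by simpa using hy) (by simp) hj.symm
  · rintro rfl
    exact ⟨i, rfl⟩

/-- The `n`-skeleton without the centres of the `n`-cells. -/
def puncturedSkeleton (X : Type u) [TopologicalSpace X] [T2Space X]
    [Topology.CWComplex (Set.univ : Set X)] (n : ℕ) (G : Type*) [Group G] [MulAction G X] : Set X :=
  (skeletonLT (Set.univ : Set X) ((n + 1 : ℕ) : ℕ∞) : Set X) ∩ (cellCenters X n G)ᶜ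

variable {G}

lemma skeletonLT_subset_puncturedSkeleton :
    (skeletonLT (Set.univ : Set X) n : Set X) ⊆ puncturedSkeleton X n G := fun _ hx ↦
  ⟨mem_skeletonLT_succ_iff.2 (.inl hx), fun h ↦ notMem_skeletonLT_of_mem_cellCenters G h hx⟩

lemma mem_puncturedSkeleton_cases {x : X} (hx : x ∈ puncturedSkeleton X n G) :
    x ∈ skeletonLT (Set.univ : Set X) n ∨ ∃ (i : cell (Set.univ : Set X) n) (y : Fin n → ℝ),
      0 < ‖y‖ ∧ ‖y‖ < 1 ∧ cellMap G i y = x := by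
  obtain ⟨h1, h2⟩ := hx
  obtain h1 | ⟨i, hi⟩ := mem_skeletonLT_succ_iff.1 h1
  · exact .inl h1
  · rw [← image_cellMap_ball G] at hi
    obtain ⟨y, hy, rfl⟩ := hi
    rw [mem_ball_zero_iff] at hy
    refine .inr ⟨i, y, norm_pos_iff.2 fun h ↦ h2 ?_, hy, rfl⟩
    exact (cellMap_mem_cellCenters_iff G hy).2 h

/-! ### Radial deformation -/

section Radial

/-- The radial motion in the punctured ball. -/
noncomputable def radial (y : Fin n → ℝ) (t : ℝ) : Fin n → ℝ := ((1 - t) + t / ‖y‖) • y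

lemma norm_radial {y : Fin n → ℝ} (hy : 0 < ‖y‖) {t : ℝ} (ht : 0 ≤ t) (ht' : t ≤ 1) :
    ‖radial y t‖ = (1 - t) * ‖y‖ + t := by
  rw [radial, norm_smul, Real.norm_of_nonneg (add_nonneg (by linarith) (by positivity)), add_mul,
    div_mul_cancel₀ _ hy.ne']

lemma norm_radial_pos {y : Fin n → ℝ} (hy : 0 < ‖y‖) {t : ℝ} (ht : 0 ≤ t) (ht' : t ≤ 1) :
    0 < ‖radial y t‖ := by
  rw [norm_radial hy ht ht']
  rcases ht'.lt_or_eq with h | rfl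
  · have := mul_pos (sub_pos.2 h) hy
    linarith
  · simp

lemma norm_radial_le {y : Fin n → ℝ} (hy : 0 < ‖y‖) (hy' : ‖y‖ ≤ 1) {t : ℝ} (ht : 0 ≤ t)
    (ht' : t ≤ 1) : ‖radial y t‖ ≤ 1 := by
  rw [norm_radial hy ht ht']
  nlinarith

lemma radial_zero (y : Fin n → ℝ) : radial y 0 = y := by simp [radial]

lemma radial_of_norm_eq_one {y : Fin n → ℝ} (hy : ‖y‖ = 1) (t : ℝ) : radial y t = y := by
  simp [radial, hy]

variable (G) in
open Classical in
/-- The radial deformation of the punctured skeleton. -/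
noncomputable def radialDeformation (n : ℕ) (x : X) (t : ℝ) : X :=
  -- The pair is unique, since open cells are disjoint and characteristic maps are injective on the
  -- open ball. All points outside the punctured open `n`-cells stay where they are.
  if h : ∃ q : cell (Set.univ : Set X) n × (Fin n → ℝ),
    0 < ‖q.2‖ ∧ ‖q.2‖ < 1 ∧ cellMap G q.1 q.2 = x then
  cellMap G h.choose.1 (radial h.choose.2 t) else x

lemma radialDeformation_of_mem {x : X} (hx : x ∈ skeletonLT (Set.univ : Set X) n) (t : ℝ) :
    radialDeformation G n x t = x := by
  rw [radialDeformation, dif_neg]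
  rintro ⟨q, -, hq, rfl⟩
  exact notMem_skeletonLT_of_mem_openCell le_rfl (cellMap_mem_openCell G q.1 hq) hx

end Radial

end Strata

/-! ### Equivariance and continuity of the radial deformation -/

namespace IsGCWComplex

open Metric Topology.RelCWComplex
open scoped Pointwise

variable {G : Type*} [Group G] {X : Type u} [TopologicalSpace X] [T2Space X] [MulAction G X]
  [ContinuousConstSMul G X] [Topology.CWComplex (Set.univ : Set X)] {n : ℕ}

/-- Radial motion is constant on the unit sphere, which lands in the lower skeleton; hence the
formula holds up to the boundary, as continuity on closed cells requires. -/
lemma radialDeformation_cellMap (hX : IsGCWComplex G X) (i : cell (Set.univ : Set X) n)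
    {y : Fin n → ℝ} (hy : 0 < ‖y‖) (hy' : ‖y‖ ≤ 1) (t : ℝ) :
    radialDeformation G n (cellMap G i y) t = cellMap G i (radial y t) := by
  rcases hy'.lt_or_eq with hy' | hy'
  · have h : ∃ q : cell (Set.univ : Set X) n × (Fin n → ℝ),
        0 < ‖q.2‖ ∧ ‖q.2‖ < 1 ∧ cellMap G q.1 q.2 = cellMap G i y := ⟨(i, y), hy, hy', rfl⟩
    rw [radialDeformation, dif_pos h]
    obtain ⟨-, h2, h3⟩ := h.choose_spec
    generalize h.choose = q at h2 h3
    obtain ⟨j, z⟩ := q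
    dsimp only at h2 h3 ⊢
    obtain rfl := eq_of_mem_openCell (cellMap_mem_openCell G j h2)
      (h3 ▸ cellMap_mem_openCell G i hy')
    rw [injOn_cellMap G j (by simpa using h2) (by simpa using hy') h3]
  · rw [radialDeformation_of_mem (hX.cellMap_mem_skeletonLT i hy'), radial_of_norm_eq_one hy']

lemma cellMap_mem_puncturedSkeleton (hX : IsGCWComplex G X) (i : cell (Set.univ : Set X) n)
    {y : Fin n → ℝ} (hy : 0 < ‖y‖) (hy' : ‖y‖ ≤ 1) : cellMap G i y ∈ puncturedSkeleton X n G := by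
  rcases hy'.lt_or_eq with hy' | hy'
  · refine ⟨mem_skeletonLT_succ_iff.2 (.inr ⟨i, cellMap_mem_openCell G i hy'⟩), fun h ↦ ?_⟩
    rw [cellMap_mem_cellCenters_iff G hy'] at h
    simp [h] at hy
  · exact skeletonLT_subset_puncturedSkeleton (hX.cellMap_mem_skeletonLT i hy')

lemma radialDeformation_mem (hX : IsGCWComplex G X) {x : X} (hx : x ∈ puncturedSkeleton X n G)
    {t : ℝ} (ht : 0 ≤ t) (ht' : t ≤ 1) : radialDeformation G n x t ∈ puncturedSkeleton X n G := by
  obtain h | ⟨i, y, hy, hy', rfl⟩ := mem_puncturedSkeleton_cases hx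
  · rwa [radialDeformation_of_mem h]
  · rw [hX.radialDeformation_cellMap i hy hy'.le]
    exact hX.cellMap_mem_puncturedSkeleton i (norm_radial_pos hy ht ht')
      (norm_radial_le hy hy'.le ht ht')

lemma radialDeformation_zero (hX : IsGCWComplex G X) {x : X} (hx : x ∈ puncturedSkeleton X n G) :
    radialDeformation G n x 0 = x := by
  obtain h | ⟨i, y, hy, hy', rfl⟩ := mem_puncturedSkeleton_cases hx
  · rw [radialDeformation_of_mem h]
  · rw [hX.radialDeformation_cellMap i hy hy'.le, radial_zero]

lemma radialDeformation_one_mem (hX : IsGCWComplex G X) {x : X}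
    (hx : x ∈ puncturedSkeleton X n G) :
    radialDeformation G n x 1 ∈ skeletonLT (Set.univ : Set X) n := by
  obtain h | ⟨i, y, hy, hy', rfl⟩ := mem_puncturedSkeleton_cases hx
  · rwa [radialDeformation_of_mem h]
  · rw [hX.radialDeformation_cellMap i hy hy'.le]
    refine hX.cellMap_mem_skeletonLT i ?_
    simp [norm_radial hy zero_le_one le_rfl]

lemma smul_mem_cellCenters (hX : IsGCWComplex G X) (g : G) {x : X} (hx : x ∈ cellCenters X n G) :
    g • x ∈ cellCenters X n G := by
  obtain ⟨i, rfl⟩ := hx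
  obtain ⟨j, hj⟩ := hX.exists_smul_openCell_eq g i
  exact ⟨j, (hX.smul_cellMap hj (by simp)).symm⟩

lemma smul_mem_cellCenters_iff (hX : IsGCWComplex G X) (g : G) {x : X} :
    g • x ∈ cellCenters X n G ↔ x ∈ cellCenters X n G :=
  ⟨fun h ↦ by simpa using hX.smul_mem_cellCenters g⁻¹ h, hX.smul_mem_cellCenters g⟩

lemma smul_mem_puncturedSkeleton_iff (hX : IsGCWComplex G X) (g : G) {x : X} :
    g • x ∈ puncturedSkeleton X n G ↔ x ∈ puncturedSkeleton X n G :=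
  and_congr (hX.smul_mem_skeletonLT_iff g) (not_congr (hX.smul_mem_cellCenters_iff g))

lemma radialDeformation_smul (hX : IsGCWComplex G X) (g : G) {x : X}
    (hx : x ∈ puncturedSkeleton X n G) {t : ℝ} (ht : 0 ≤ t) (ht' : t ≤ 1) :
    radialDeformation G n (g • x) t = g • radialDeformation G n x t := by
  obtain h | ⟨i, y, hy, hy', rfl⟩ := mem_puncturedSkeleton_cases hx
  · rw [radialDeformation_of_mem h, radialDeformation_of_mem (hX.smul_mem_skeletonLT g h)]
  · obtain ⟨j, hj⟩ := hX.exists_smul_openCell_eq g i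
    rw [hX.smul_cellMap hj hy'.le, hX.radialDeformation_cellMap j hy hy'.le,
      hX.radialDeformation_cellMap i hy hy'.le,
      hX.smul_cellMap hj (norm_radial_le hy hy'.le ht ht')]

/-- The radial motion of a cell, as a map from the punctured ball to the space of paths. -/
noncomputable def radialPath (i : cell (Set.univ : Set X) n) :
    C({y : Fin n → ℝ // 0 < ‖y‖ ∧ ‖y‖ ≤ 1}, C(unitInterval, X)) :=
  ContinuousMap.curry ⟨fun q ↦ cellMap G i (radial q.1.1 q.2.1), by
    refine (continuousOn_cellMap G i).comp_continuous ?_ fun q ↦ ?_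
    · have h : Continuous fun q : {y : Fin n → ℝ // 0 < ‖y‖ ∧ ‖y‖ ≤ 1} × unitInterval ↦
          (q.2.1 / ‖q.1.1‖ : ℝ) :=
        (continuous_subtype_val.comp continuous_snd).div
          (continuous_norm.comp (continuous_subtype_val.comp continuous_fst)) fun q ↦ q.1.2.1.ne'
      unfold radial
      fun_prop
    · rw [mem_closedBall_zero_iff]
      exact norm_radial_le q.1.2.1 q.1.2.2 q.2.2.1 q.2.2.2⟩

/-- The radial deformation, as a map to the space of paths. -/
noncomputable def deformationPath (hX : IsGCWComplex G X) (x : puncturedSkeleton X n G) :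
    C(unitInterval, X) :=
  ⟨fun t ↦ radialDeformation G n x.1 t.1, by
    obtain h | ⟨i, y, hy, hy', h⟩ := mem_puncturedSkeleton_cases x.2
    · simp only [radialDeformation_of_mem h]
      exact continuous_const
    · simp only [← h, hX.radialDeformation_cellMap i hy hy'.le]
      exact (radialPath (G := G) i ⟨y, hy, hy'.le⟩).continuous⟩

lemma deformationPath_of_mem (hX : IsGCWComplex G X) {x : puncturedSkeleton X n G}
    (hx : x.1 ∈ skeletonLT (Set.univ : Set X) n) :
    hX.deformationPath x = ContinuousMap.const _ x.1 := by
  ext1 t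
  exact radialDeformation_of_mem hx _

lemma deformationPath_cellMap (hX : IsGCWComplex G X) (i : cell (Set.univ : Set X) n)
    {y : Fin n → ℝ} (hy : 0 < ‖y‖) (hy' : ‖y‖ ≤ 1)
    (h : cellMap G i y ∈ puncturedSkeleton X n G) :
    hX.deformationPath ⟨cellMap G i y, h⟩ = radialPath (G := G) i ⟨y, hy, hy'⟩ := by
  ext1 t
  exact hX.radialDeformation_cellMap i hy hy' _

/-- Joint continuity is traded for continuity into the path space, which can be tested on the cells
of `X` alone, without a cell structure on the product with the interval; uncurrying then recovers
the deformation. -/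
lemma continuous_deformationPath (hX : IsGCWComplex G X) :
    Continuous (hX.deformationPath (n := n)) := by
  rw [continuous_iff_isClosed]
  intro K hK
  -- The punctured skeleton need not be closed in `X`; adjoining the centres gives a set whose
  -- closedness can be tested on the cells of `X`.
  set A : Set X := {x | ∃ h : x ∈ puncturedSkeleton X n G, hX.deformationPath ⟨x, h⟩ ∈ K} ∪
    cellCenters X n G with hA
  suffices IsClosed A by
    convert this.preimage continuous_subtype_val
    ext x
    simp only [hA, Set.mem_preimage, Set.mem_union, Set.mem_ofPred_eq]
    exact ⟨fun h ↦ .inl ⟨x.2, h⟩, fun h ↦ (h.resolve_right x.2.2).2⟩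
  refine Topology.CWComplex.isClosed_of_isClosed_inter_openCell_or_isClosed_inter_closedCell
    (C := Set.univ) (Set.subset_univ _) fun m _ l ↦ ?_
  rcases lt_trichotomy m n with h | rfl | h
  · right
    convert (isClosed_closedCell (C := (Set.univ : Set X)) (i := l)).inter
      (hK.preimage (ContinuousMap.continuous_const' (X := unitInterval) (Y := X))) using 1
    ext x
    rw [Set.mem_inter_iff, Set.mem_inter_iff, and_comm, and_congr_right]
    intro hx
    have hx' := closedCell_subset_skeletonLT_of_lt h l hx
    have hx'' := skeletonLT_subset_puncturedSkeleton (G := G) hx'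
    simp only [hA, Set.mem_preimage, Set.mem_union, Set.mem_ofPred_eq]
    constructor
    · rintro (⟨h1, h2⟩ | h1)
      · rwa [hX.deformationPath_of_mem hx'] at h2
      · exact absurd h1 hx''.2
    · intro h1
      refine .inl ⟨hx'', ?_⟩
      rwa [hX.deformationPath_of_mem hx']
  · right
    obtain ⟨C, hC, hCK⟩ := isClosed_induced_iff.1
      (hK.preimage (radialPath (G := G) l).continuous)
    have hCK' (y : {y : Fin m → ℝ // 0 < ‖y‖ ∧ ‖y‖ ≤ 1}) : y.1 ∈ C ↔ radialPath (G := G) l y ∈ K :=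
      Set.ext_iff.1 hCK y
    -- The set `C` is determined only on the punctured ball; adjoining the origin accounts for the
    -- centre, which belongs to `A`.
    have hcomp : IsCompact (closedBall (0 : Fin m → ℝ) 1 ∩ (C ∪ {0})) :=
      (isCompact_closedBall _ _).inter_right (hC.union isClosed_singleton)
    convert (hcomp.image_of_continuousOn
      ((continuousOn_cellMap G l).mono Set.inter_subset_left)).isClosed using 1
    ext x
    constructor
    · rintro ⟨hx, hxl⟩
      rw [← image_cellMap_closedBall (G := G)] at hxl
      obtain ⟨y, hy, rfl⟩ := hxl
      refine ⟨y, ⟨hy, ?_⟩, rfl⟩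
      by_cases hy0 : y = 0
      · exact .inr hy0
      · rw [mem_closedBall_zero_iff] at hy
        have hy1 := norm_pos_iff.2 hy0
        rcases hx with ⟨h1, h2⟩ | h1
        · rw [hX.deformationPath_cellMap l hy1 hy] at h2
          exact .inl ((hCK' _).2 h2)
        · exact absurd h1 (hX.cellMap_mem_puncturedSkeleton l hy1 hy).2
    · rintro ⟨y, ⟨hy, hyC⟩, rfl⟩
      refine ⟨?_, by rw [← image_cellMap_closedBall (G := G)]; exact ⟨y, hy, rfl⟩⟩
      by_cases hy0 : y = 0
      · exact .inr ⟨l, by rw [hy0]⟩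
      · rw [mem_closedBall_zero_iff] at hy
        have hy1 := norm_pos_iff.2 hy0
        refine .inl ⟨hX.cellMap_mem_puncturedSkeleton l hy1 hy, ?_⟩
        rw [hX.deformationPath_cellMap l hy1 hy]
        exact (hCK' ⟨y, hy1, hy⟩).1 (hyC.resolve_right hy0)
  · left
    convert isClosed_empty
    rw [Set.eq_empty_iff_forall_notMem]
    rintro x ⟨hx, hxl⟩
    have hx' := notMem_skeletonLT_of_mem_openCell (n := n + 1) h hxl
    rcases hx with ⟨h1, -⟩ | ⟨i, rfl⟩
    · exact hx' h1.1
    · exact hx' (mem_skeletonLT_succ_iff.2 (.inr ⟨i, cellMap_zero_mem_openCell G i⟩))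

/-- The radial deformation of the punctured skeleton. -/
noncomputable def deformation (hX : IsGCWComplex G X) (n : ℕ) :
    C(puncturedSkeleton X n G × unitInterval, puncturedSkeleton X n G) :=
  ⟨fun q ↦ ⟨radialDeformation G n q.1.1 q.2.1, hX.radialDeformation_mem q.1.2 q.2.2.1 q.2.2.2⟩,
    Continuous.subtype_mk (ContinuousMap.continuous_uncurry_of_continuous
      ⟨hX.deformationPath, hX.continuous_deformationPath⟩) _⟩

end IsGCWComplex

open stdSimplex

/-! ### Preliminaries for the induction over skeleta -/

namespace SingularChain

section

variable {R : Type*} [CommRing R] {Y Z : Type*} [TopologicalSpace Y] [TopologicalSpace Z]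

lemma acyclicAt_image_iff {f : Y → Z} (hf : Topology.IsEmbedding f) {A : Set Y} {n : ℕ} :
    AcyclicAt R (f '' A) n ↔ AcyclicAt R A n := by
  rw [← acyclicAt_coe_iff, ← acyclicAt_coe_iff (S := A)]
  exact ⟨.of_homotopyEquiv (hf.homeomorphImage A).toHomotopyEquiv,
    .of_homotopyEquiv (hf.homeomorphImage A).symm.toHomotopyEquiv⟩

lemma normAcyclicAt_empty (p : ℕ) (g : C(Y, Y)) (n : ℕ) :
    NormAcyclicAt p g (∅ : Set Y) (n + 1) := by
  intro c hc _
  rw [chainsIn_empty, Submodule.mem_bot] at hc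
  exact ⟨0, zero_mem _, by rw [hc, map_zero, map_zero, map_zero]⟩

end

end SingularChain

section

variable {G : Type*} [Group G] {X : Type u} [TopologicalSpace X] [MulAction G X]
  [ContinuousConstSMul G X]

/-- The action of a group element, as a continuous map. -/
def smulMap (g : G) : C(X, X) := ⟨fun x ↦ g • x, continuous_const_smul g⟩

lemma smulMap_iterate {g : G} {p : ℕ} (hg : g ^ p = 1) (x : X) : (smulMap g)^[p] x = x := by
  change (fun x ↦ g • x)^[p] x = x
  rw [smul_iterate, hg]
  exact one_smul G x

end

/-! ### Vanishing of norm homology by induction over skeleta -/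

namespace IsGCWComplex

open Metric Topology.RelCWComplex SingularChain
open scoped Pointwise

variable {G : Type*} [Group G] {X : Type u} [TopologicalSpace X] [T2Space X] [MulAction G X]
  [ContinuousConstSMul G X] [Topology.CWComplex (Set.univ : Set X)] {n : ℕ}

variable (G) in
lemma acyclicAt_range_cellEmbedding {R : Type*} [CommRing R] (i : cell (Set.univ : Set X) n)
    (m : ℕ) : AcyclicAt R (Set.range (cellEmbedding G i)) m := by
  rw [← Set.image_univ, acyclicAt_image_iff (isEmbedding_cellEmbedding G i)]
  exact acyclicAt_univ_of_contractibleSpace m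

variable (G) in
lemma acyclicAt_openCell_inter {R : Type*} [CommRing R]
    (i : cell (Set.univ : Set X) n) {m : ℕ}
    (hm : m ≠ n) : AcyclicAt R (openCell n i ∩ (cellCenters X n G)ᶜ) m := by
  have h : openCell n i ∩ (cellCenters X n G)ᶜ = cellEmbedding G i '' {0}ᶜ := by
    have h0 (y : Fin n → ℝ) : cellEmbedding G i y ∈ cellCenters X n G ↔ y = 0 := by
      have hy := (Homeomorph.unitBall y).2
      rw [mem_ball_zero_iff] at hy
      rw [cellEmbedding, cellMap_mem_cellCenters_iff G hy, Homeomorph.unitBall_apply_coe]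
      refine ⟨fun h ↦ Homeomorph.unitBall.injective (Subtype.ext ?_), fun h ↦ ?_⟩
      · rw [Homeomorph.unitBall_apply_coe, Homeomorph.unitBall_apply_coe, h,
          OpenPartialHomeomorph.univUnitBall_apply_zero]
      · rw [h, OpenPartialHomeomorph.univUnitBall_apply_zero]
    rw [← range_cellEmbedding G]
    ext x
    constructor
    · rintro ⟨⟨y, rfl⟩, hy⟩
      exact ⟨y, fun h ↦ hy ((h0 y).2 h), rfl⟩
    · rintro ⟨y, hy, rfl⟩
      exact ⟨⟨y, rfl⟩, fun h ↦ hy ((h0 y).1 h)⟩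
  rw [h, acyclicAt_image_iff (isEmbedding_cellEmbedding G i)]
  exact (sphereLike_compl_zero n).1 m hm

variable {p : ℕ} [Fact p.Prime] {g : G}

/-- Within `W` the traces of the open `n`-cells are open and disjoint, and the group permutes them,
fixing the preserved ones pointwise. -/
lemma normAcyclicAt_of_subset_openCells (hX : IsGCWComplex G X) (hg : g ^ p = 1) {W : Set X}
    (hW : ∀ x ∈ W, ∃ i : cell (Set.univ : Set X) n, x ∈ openCell n i)
    (gW : ∀ x, g • x ∈ W ↔ x ∈ W) {m : ℕ}
    (h : ∀ i : cell (Set.univ : Set X) n, AcyclicAt (ZMod p) (openCell n i ∩ W) (m + 2)) :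
    NormAcyclicAt p (smulMap g) W (m + 2) := by
  have hmaps : Set.MapsTo (smulMap g) W W := fun x hx ↦ (gW x).2 hx
  have hW' (x : W) := hW x.1 x.2
  choose i hi using hW'
  -- Labelling points by the open cell as a set lets the group act through `Set X`; labels that are
  -- not cells have empty fibres.
  let q : W → Set X := fun x ↦ openCell n (i x)
  have hq (x : W) (j : cell (Set.univ : Set X) n) (hj : x.1 ∈ openCell n j) :
      q x = openCell n j := by
    change openCell n (i x) = _
    rw [eq_of_mem_openCell (hi x) hj]
  have hfib (j : cell (Set.univ : Set X) n) : q ⁻¹' {openCell n j} =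
      Subtype.val ⁻¹' openCell n j := by
    ext x
    refine ⟨fun hx ↦ ?_, hq x j⟩
    have : openCell n (i x) = openCell n j := hx
    exact this ▸ hi x
  have hfib' (e : Set X) : (∃ j : cell (Set.univ : Set X) n, e = openCell n j) ∨
      q ⁻¹' {e} = ∅ := by
    by_cases he : (q ⁻¹' {e}).Nonempty
    · obtain ⟨x, rfl⟩ := he
      exact .inl ⟨i x, rfl⟩
    · exact .inr (Set.not_nonempty_iff_eq_empty.1 he)
  refine NormAcyclicAt.of_univ hmaps (normAcyclicAt_univ_of_isLocallyConstant
    (q := q) (γ := MulAction.toPermHom G (Set X) g) ?_ ?_ ?_ ?_ ?_ ?_)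
  · have h1 (k : ℕ) (x : W) : ((restrictMapsTo (smulMap g) hmaps)^[k] x).1 =
        (smulMap (X := X) g)^[k] x.1 := by
      induction k with
      | zero => rfl
      | succ k ih => rw [Function.iterate_succ_apply', Function.iterate_succ_apply', ← ih]; rfl
    exact fun x ↦ Subtype.ext ((h1 p x).trans (smulMap_iterate hg x.1))
  · rw [IsLocallyConstant.iff_isOpen_fiber]
    intro e
    obtain ⟨j, rfl⟩ | he := hfib' e
    · convert (isClosed_skeletonLT_union_openCell_ne j).isOpen_compl.preimage
        (continuous_subtype_val (p := (· ∈ W))) using 1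
      rw [hfib]
      ext x
      simp only [Set.mem_preimage, Set.mem_compl_iff, Set.mem_union, Set.mem_iUnion, not_or,
        not_exists]
      constructor
      · intro hx
        exact ⟨notMem_skeletonLT_of_mem_openCell le_rfl hx,
          fun l hl hx' ↦ hl (eq_of_mem_openCell hx' hx)⟩
      · rintro ⟨-, hx⟩
        by_contra hxj
        exact hx (i x) (fun h ↦ hxj (h ▸ hi x)) (hi x)
    · rw [he]
      exact isOpen_empty
  · rw [← map_pow, hg, map_one]
  · intro x
    obtain ⟨j, hj⟩ := hX.exists_smul_openCell_eq g (i x)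
    change _ = g • openCell n (i x)
    rw [hj]
    refine hq _ j ?_
    rw [← hj]
    exact Set.smul_mem_smul_set (hi x)
  · intro x hx
    exact Subtype.ext (hX.smul_eq_of_mem_closedCell hx (openCell_subset_closedCell _ _ (hi x)))
  · intro e
    obtain ⟨j, rfl⟩ | he := hfib' e
    · rw [hfib, ← acyclicAt_image_iff Topology.IsEmbedding.subtypeVal, Subtype.image_preimage_coe,
        Set.inter_comm]
      exact h j
    · rw [he]
      exact sphereLike_empty.1 _ (by lia)

/-- The norms on the skeleton of dimension less than `n` are acyclic above dimension `n`. -/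
theorem normAcyclicAt_skeletonLT (hX : IsGCWComplex G X) (hg : g ^ p = 1) (n k : ℕ) (hk : n < k) :
    NormAcyclicAt p (smulMap g) (skeletonLT (Set.univ : Set X) n : Set X) k := by
  induction n generalizing k with
  | zero =>
    obtain ⟨k, rfl⟩ := Nat.exists_eq_succ_of_ne_zero hk.ne'
    rw [Nat.cast_zero, Topology.CWComplex.skeletonLT_zero_eq_empty]
    exact normAcyclicAt_empty _ _ _
  | succ n ih =>
    obtain ⟨k, rfl⟩ := Nat.exists_eq_succ_of_ne_zero (Nat.ne_zero_of_lt hk)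
    have hcell (x) (hx : x ∈ (skeletonLT (Set.univ : Set X) ((n + 1 : ℕ) : ℕ∞) : Set X))
        (hx' : x ∉ (skeletonLT (Set.univ : Set X) n : Set X)) :
        ∃ i : cell (Set.univ : Set X) n, x ∈ openCell n i :=
      (mem_skeletonLT_succ_iff.1 hx).resolve_left hx'
    have hcell' (i : cell (Set.univ : Set X) n) :
        openCell n i ⊆ (skeletonLT (Set.univ : Set X) ((n + 1 : ℕ) : ℕ∞) : Set X) ∩
          (skeletonLT (Set.univ : Set X) n : Set X)ᶜ := fun x hx ↦
      ⟨mem_skeletonLT_succ_iff.2 (.inr ⟨i, hx⟩), notMem_skeletonLT_of_mem_openCell le_rfl hx⟩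
    have g₀ (x : X) := hX.smul_mem_skeletonLT_iff g (m := ((n + 1 : ℕ) : ℕ∞)) (x := x)
    have g₁ (x : X) := not_congr (hX.smul_mem_cellCenters_iff (n := n) g (x := x))
    have g₂ (x : X) := not_congr (hX.smul_mem_skeletonLT_iff g (m := (n : ℕ∞)) (x := x))
    refine NormAcyclicAt.union (O₁ := (cellCenters X n G)ᶜ)
      (O₂ := (skeletonLT (Set.univ : Set X) n : Set X)ᶜ) (isClosed_cellCenters G).isOpen_compl
      (skeletonLT (Set.univ : Set X) n).closed.isOpen_compl ?_ g₀ g₁ g₂ ?_ ?_ ?_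
    · intro x _
      by_contra h
      rw [Set.mem_union, not_or, Set.notMem_compl_iff, Set.notMem_compl_iff] at h
      exact notMem_skeletonLT_of_mem_cellCenters G h.1 h.2
    · have hmaps : Set.MapsTo (smulMap g) (puncturedSkeleton X n G) (puncturedSkeleton X n G) :=
        fun x hx ↦ (hX.smul_mem_puncturedSkeleton_iff g).2 hx
      refine NormAcyclicAt.of_deformation (S := puncturedSkeleton X n G) hmaps
        skeletonLT_subset_puncturedSkeleton ((hX.deformation n).comp
          ((ContinuousMap.id _).prodMap (toContinuousMap stdSimplexHomeomorphUnitInterval)))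
        ?_ ?_ ?_ (ih (k + 1) (by lia))
      · intro x t
        have ht := (stdSimplexHomeomorphUnitInterval t).2
        exact Subtype.ext (hX.radialDeformation_smul g x.2 ht.1 ht.2)
      · intro x
        exact Subtype.ext (hX.radialDeformation_zero x.2)
      · intro x
        exact hX.radialDeformation_one_mem x.2
    -- From `n < k` the index `k + 1` is at least two, as decomposing into pieces requires; open
    -- cells are contractible.
    · obtain ⟨m, rfl⟩ : ∃ m, k = m + 1 := ⟨k - 1, by lia⟩
      refine hX.normAcyclicAt_of_subset_openCells hg (n := n) (fun x hx ↦ hcell x hx.1 hx.2)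
        (fun x ↦ and_congr (g₀ x) (g₂ x)) fun i ↦ ?_
      rw [Set.inter_eq_self_of_subset_left (hcell' i), ← range_cellEmbedding G]
      exact acyclicAt_range_cellEmbedding G i _
    -- For `n = 0` the index `k` may be one, too small for decomposing, but a `0`-cell is its own
    -- centre and the overlap is empty. Otherwise `k` is at least two, and since `k ≠ n` the
    -- punctured cells are acyclic in index `k`.
    · obtain rfl | hn := Nat.eq_zero_or_pos n
      · convert normAcyclicAt_empty p (smulMap g) (k - 1) using 1
        · rw [Set.eq_empty_iff_forall_notMem]
          rintro x ⟨hx, hx1, hx2⟩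
          obtain ⟨i, hi⟩ := hcell x hx hx2
          refine hx1 ⟨i, ?_⟩
          have h := cellMap_zero_mem_openCell G i
          rw [openCell_zero_eq_singleton, Set.mem_singleton_iff] at h hi
          exact h.trans hi.symm
        · lia
      · obtain ⟨m, rfl⟩ : ∃ m, k = m + 2 := ⟨k - 2, by lia⟩
        refine hX.normAcyclicAt_of_subset_openCells hg (n := n) (fun x hx ↦ hcell x hx.1 hx.2.2)
          (fun x ↦ and_congr (g₀ x) (and_congr (g₁ x) (g₂ x))) fun i ↦ ?_
        have h : openCell n i ∩ ((skeletonLT (Set.univ : Set X) ((n + 1 : ℕ) : ℕ∞) : Set X) ∩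
            ((cellCenters X n G)ᶜ ∩ (skeletonLT (Set.univ : Set X) n : Set X)ᶜ)) =
            openCell n i ∩ (cellCenters X n G)ᶜ := by
          ext x
          have := @hcell' i x
          simp only [Set.mem_inter_iff] at this ⊢
          tauto
        rw [h]
        exact acyclicAt_openCell_inter G i (by lia)

end IsGCWComplex

/-! ### Comparison with the singular homology of Mathlib -/

namespace SingularChain

section

variable (R : Type) [CommRing R] (Y : Type u) [TopologicalSpace Y]

/-- The augmented singular chain complex, shifted so that the augmentation is in degree zero. -/
noncomputable def augmentedComplex : ChainComplex (ModuleCat.{u} R) ℕ :=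
  moduleComplex (fun n ↦ SingularChain R Y n) (fun n ↦ boundary R n) fun _ c ↦ boundary_boundary c

/-- The singular chain complex. -/
noncomputable def complex : ChainComplex (ModuleCat.{u} R) ℕ :=
  moduleComplex (fun n ↦ SingularChain R Y (n + 1)) (fun n ↦ boundary R (n + 1))
    fun _ c ↦ boundary_boundary c

/-- The singular chain complex of Mathlib. -/
noncomputable abbrev mathlibComplex : ChainComplex (ModuleCat.{u} R) ℕ :=
  (TopCat.toSSet.obj (TopCat.of Y)).chainComplex (ModuleCat.of R (ULift.{u} R))

open Simplicial

/-- The identification of singular simplices. -/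
noncomputable def simplexEquiv (n : ℕ) :
    C(stdSimplex ℝ (Fin (n + 1)), Y) ≃ (TopCat.toSSet.obj (TopCat.of Y)) _⦋n⦌ :=
  ((TopCat.of Y).toSSetObjEquiv (.op ⦋n⦌)).symm

variable {Y} in
lemma δ_simplexEquiv {n : ℕ} (i : Fin (n + 2)) (s : C(stdSimplex ℝ (Fin (n + 2)), Y)) :
    (TopCat.toSSet.obj (TopCat.of Y)).δ i (simplexEquiv Y (n + 1) s) =
      simplexEquiv Y n (s.comp (stdSimplex.face i)) := by
  apply (simplexEquiv Y n).symm.injective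
  rw [Equiv.symm_apply_apply]
  ext1 x
  rfl

/-- The comparison map on chains. -/
noncomputable def toMathlib (n : ℕ) :
    SingularChain R Y (n + 1) →ₗ[R] (mathlibComplex R Y).X n :=
  Finsupp.linearCombination R fun s ↦
    ((TopCat.toSSet.obj (TopCat.of Y)).ιChainComplex
      (R := ModuleCat.of R (ULift.{u} R)) (simplexEquiv Y n s)).hom (ULift.up 1)

/-- The inverse of the comparison map on chains. -/
noncomputable def ofMathlib (n : ℕ) :
    (mathlibComplex R Y).X n ⟶ ModuleCat.of R (SingularChain R Y (n + 1)) :=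
  ((TopCat.toSSet.obj (TopCat.of Y)).isColimitChainComplexXCofan
    (ModuleCat.of R (ULift.{u} R)) n).desc (Limits.Cofan.mk _ fun x ↦
      ModuleCat.ofHom (Finsupp.lsingle ((simplexEquiv Y n).symm x) ∘ₗ
        (ULift.moduleEquiv : ULift.{u} R ≃ₗ[R] R).toLinearMap))

lemma ι_ofMathlib (n : ℕ) (x : (TopCat.toSSet.obj (TopCat.of Y)) _⦋n⦌) :
    (TopCat.toSSet.obj (TopCat.of Y)).ιChainComplex (R := ModuleCat.of R (ULift.{u} R)) x ≫
      ofMathlib R Y n = ModuleCat.ofHom (Finsupp.lsingle ((simplexEquiv Y n).symm x) ∘ₗ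
        (ULift.moduleEquiv : ULift.{u} R ≃ₗ[R] R).toLinearMap) :=
  ((TopCat.toSSet.obj (TopCat.of Y)).isColimitChainComplexXCofan
    (ModuleCat.of R (ULift.{u} R)) n).fac _ ⟨x⟩

/-- The comparison map on chains is an isomorphism. -/
noncomputable def mathlibIso (n : ℕ) :
    ModuleCat.of R (SingularChain R Y (n + 1)) ≅ (mathlibComplex R Y).X n where
  hom := ModuleCat.ofHom (toMathlib R Y n)
  inv := ofMathlib R Y n
  hom_inv_id := by
    refine ModuleCat.hom_ext (Finsupp.lhom_ext' fun s ↦ LinearMap.ext_ring ?_)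
    have := congrArg (fun f ↦ f.hom (ULift.up 1)) (ι_ofMathlib R Y n (simplexEquiv Y n s))
    simp only [Equiv.symm_apply_apply] at this
    change (ofMathlib R Y n).hom (toMathlib R Y n (Finsupp.single s 1)) = Finsupp.single s 1
    rw [toMathlib, Finsupp.linearCombination_single, one_smul]
    exact this
  inv_hom_id := by
    refine SSet.chainComplex_hom_ext fun x ↦ ?_
    refine ModuleCat.hom_ext (LinearMap.ext fun r ↦ ?_)
    refine (congrArg (toMathlib R Y n)
      (congrArg (fun f ↦ f.hom r) (ι_ofMathlib R Y n x))).trans ?_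
    change toMathlib R Y n (Finsupp.single ((simplexEquiv Y n).symm x) r.down) =
      ((TopCat.toSSet.obj (TopCat.of Y)).ιChainComplex (R := ModuleCat.of R (ULift.{u} R)) x).hom r
    rw [toMathlib, Finsupp.linearCombination_single, Equiv.apply_symm_apply, ← map_smul]
    congr 1
    exact ULift.ext _ _ (mul_one r.down)

/-- The comparison of the singular chain complexes. -/
noncomputable def complexIso : complex R Y ≅ mathlibComplex R Y :=
  HomologicalComplex.Hom.isoOfComponents (mathlibIso R Y) fun i j hij ↦ by
    obtain rfl : j + 1 = i := hij
    have hd : (complex R Y).d (j + 1) j = ModuleCat.ofHom (boundary R (j + 1)) := moduleComplex_d _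
    refine Eq.trans ?_ (congrArg (· ≫ (mathlibIso R Y j).hom) hd.symm)
    refine ModuleCat.hom_ext (Finsupp.lhom_ext' fun s ↦ LinearMap.ext_ring ?_)
    change ((mathlibComplex R Y).d (j + 1) j).hom (toMathlib R Y (j + 1) (Finsupp.single s 1)) =
      toMathlib R Y j (boundary R (j + 1) (Finsupp.single s 1))
    have h := congrArg (fun f ↦ f.hom (ULift.up 1)) ((TopCat.toSSet.obj
      (TopCat.of Y)).ιChainComplex_d (R := ModuleCat.of R (ULift.{u} R)) (simplexEquiv Y (j + 1) s))
    rw [boundary_single', one_smul, map_sum, toMathlib, Finsupp.linearCombination_single, one_smul]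
    refine h.trans ?_
    rw [ModuleCat.hom_sum, LinearMap.sum_apply]
    refine Finset.sum_congr rfl fun i _ ↦ ?_
    rw [map_smul, toMathlib, Finsupp.linearCombination_single, one_smul, δ_simplexEquiv]
    rcases Nat.even_or_odd (i : ℕ) with hi | hi <;> simp [hi.neg_one_pow]

end

end SingularChain

/-! ### Lengths of quotients -/

section

variable {R : Type*} [CommRing R] {M₀ M₁ M₂ : Type*} [AddCommGroup M₀] [Module R M₀]
  [AddCommGroup M₁] [Module R M₁] [AddCommGroup M₂] [Module R M₂]

/-- The length of the range of `d₀` enters both sides; the additive form avoids subtracting lengths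
that may be infinite. -/
lemma length_quotient_add_length_quotient (d₀ : M₁ →ₗ[R] M₀) (d₁ : M₂ →ₗ[R] M₁)
    (h : ∀ x, d₀ (d₁ x) = 0) :
    Module.length R (M₁ ⧸ LinearMap.range d₁) + Module.length R (M₀ ⧸ LinearMap.range d₀) =
      Module.length R (LinearMap.ker d₀ ⧸
        (LinearMap.range d₁).comap (LinearMap.ker d₀).subtype) + Module.length R M₀ := by
  have hle : LinearMap.range d₁ ≤ LinearMap.ker d₀ := by
    rintro _ ⟨c, rfl⟩
    exact h c
  have h1 : Module.length R (M₁ ⧸ LinearMap.range d₁) =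
      Module.length R (LinearMap.ker d₀ ⧸ (LinearMap.range d₁).comap (LinearMap.ker d₀).subtype) +
        Module.length R (LinearMap.range d₀) := by
    refine Module.length_eq_add_of_exact
      (Submodule.mapQ _ _ (LinearMap.ker d₀).subtype le_rfl)
      ((LinearMap.range d₁).liftQ d₀.rangeRestrict (by
        rw [LinearMap.ker_rangeRestrict]; exact hle)) ?_ ?_ ?_
    · rw [← LinearMap.ker_eq_bot, LinearMap.ker_eq_bot']
      intro x hx
      obtain ⟨x, rfl⟩ := Submodule.Quotient.mk_surjective _ x
      exact (Submodule.Quotient.mk_eq_zero _).2 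
        ((Submodule.Quotient.mk_eq_zero (LinearMap.range d₁) (x := x.1)).1 hx)
    · rintro ⟨_, x, rfl⟩
      exact ⟨Submodule.Quotient.mk x, rfl⟩
    · intro x
      obtain ⟨x, rfl⟩ := Submodule.Quotient.mk_surjective _ x
      rw [Submodule.liftQ_apply, Subtype.ext_iff]
      constructor
      · intro hx
        exact ⟨Submodule.Quotient.mk ⟨x, hx⟩, rfl⟩
      · rintro ⟨y, hy⟩
        obtain ⟨y, rfl⟩ := Submodule.Quotient.mk_surjective _ y
        have h2 : d₀ (y.1 - x) = 0 := hle ((Submodule.Quotient.eq _).1 hy)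
        rw [map_sub, y.2, zero_sub, neg_eq_zero] at h2
        exact h2
  rw [h1, add_assoc, ← Module.length_eq_add_of_exact (LinearMap.range d₀).subtype
    (LinearMap.range d₀).mkQ (Submodule.injective_subtype _) (Submodule.mkQ_surjective _)
    (LinearMap.exact_subtype_mkQ _)]

lemma length_quotient_eq_one [IsSimpleModule R R] (N : Submodule R M₀) (z : M₀)
    (h1 : ∀ r : R, r • z ∈ N → r = 0) (h2 : ∀ x, ∃ r : R, x - r • z ∈ N) :
    Module.length R (M₀ ⧸ N) = 1 := by
  refine ((LinearEquiv.ofBijective (N.mkQ ∘ₗ LinearMap.toSpanSingleton R _ z)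
    ⟨?_, ?_⟩).length_eq).symm.trans (Module.length_eq_one R R)
  · rw [injective_iff_map_eq_zero]
    exact fun r hr ↦ h1 r ((Submodule.Quotient.mk_eq_zero _).1 hr)
  · intro x
    obtain ⟨x, rfl⟩ := Submodule.Quotient.mk_surjective _ x
    obtain ⟨r, hr⟩ := h2 x
    exact ⟨r, ((Submodule.Quotient.eq _).2 hr).symm⟩

end

/-! ### Reduced and unreduced homology -/

namespace SingularChain

section

variable {R : Type} [CommRing R] {Y : Type u} [TopologicalSpace Y]

lemma homologyLength_augmentedComplex_eq_zero_iff (n : ℕ) :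
    homologyLength (augmentedComplex R Y) n = 0 ↔ AcyclicAt R (Set.univ : Set Y) n := by
  cases n with
  | zero =>
    rw [augmentedComplex, homologyLength_moduleComplex_zero_eq_zero_iff]
    refine ⟨fun h c _ _ ↦ ?_, fun h c ↦ ?_⟩
    · obtain ⟨b, hb⟩ := h c
      exact ⟨b, mem_chainsIn_univ b, hb⟩
    · obtain ⟨b, -, hb⟩ := h c (mem_chainsIn_univ c) trivial
      exact ⟨b, hb⟩
  | succ n =>
    rw [augmentedComplex, homologyLength_moduleComplex_succ_eq_zero_iff]
    refine ⟨fun h c _ hc ↦ ?_, fun h c hc ↦ ?_⟩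
    · obtain ⟨b, hb⟩ := h c hc
      exact ⟨b, mem_chainsIn_univ b, hb⟩
    · obtain ⟨b, -, hb⟩ := h c (mem_chainsIn_univ c) hc
      exact ⟨b, hb⟩

lemma homologyLength_complex_succ (k : ℕ) : homologyLength (complex R Y) (k + 1) =
    homologyLength (augmentedComplex R Y) (k + 2) := by
  rw [complex, homologyLength_moduleComplex_succ, augmentedComplex,
    homologyLength_moduleComplex_succ]

lemma acyclicAt_univ_zero [Nonempty Y] : AcyclicAt R (Set.univ : Set Y) 0 := by
  intro c _ _
  obtain ⟨y⟩ := ‹Nonempty Y›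
  refine ⟨Finsupp.single (ContinuousMap.const _ y) (c default), mem_chainsIn_univ _, ?_⟩
  rw [boundary_const, if_pos (by simp)]
  exact (congrArg (fun s ↦ Finsupp.single s (c default)) (Subsingleton.elim _ _)).trans
    (Finsupp.unique_single c).symm

lemma homologyLength_augmentedComplex_zero [Nonempty Y] :
    homologyLength (augmentedComplex R Y) 0 = 0 :=
  (homologyLength_augmentedComplex_eq_zero_iff 0).2 acyclicAt_univ_zero

end

section

variable {R : Type} [CommRing R] [IsSimpleModule R R] {Y : Type u} [TopologicalSpace Y]

lemma length_singularChain_zero : Module.length R (SingularChain R Y 0) = 1 :=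
  (Finsupp.uniqueLinearEquiv R R (default : C(stdSimplex ℝ (Fin 0), Y))).length_eq.trans
    (Module.length_eq_one R R)

/-- The index-zero term keeps the formula valid for empty `Y`, where it equals one. -/
lemma homologyLength_complex_zero_add : homologyLength (complex R Y) 0 +
    homologyLength (augmentedComplex R Y) 0 = homologyLength (augmentedComplex R Y) 1 + 1 := by
  rw [complex, homologyLength_moduleComplex_zero, augmentedComplex,
    homologyLength_moduleComplex_zero, homologyLength_moduleComplex_succ,
    ← length_singularChain_zero (R := R) (Y := Y)]
  exact length_quotient_add_length_quotient _ _ boundary_boundary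

lemma homologyLength_augmentedComplex_of_sphereLike {n : ℕ}
    (h : SphereLike R (Set.univ : Set Y) n) (i : ℕ) :
    homologyLength (augmentedComplex R Y) i = if i = n then 1 else 0 := by
  split_ifs with hi
  · subst hi
    obtain ⟨-, z, -, hz, h1, h2⟩ := h
    cases i with
    | zero =>
      rw [augmentedComplex, homologyLength_moduleComplex_zero]
      refine length_quotient_eq_one _ z (fun r hr ↦ ?_) fun x ↦ ?_
      · obtain ⟨b, hb⟩ := hr
        exact h1 r ⟨b, mem_chainsIn_univ b, hb⟩
      · obtain ⟨r, b, -, hb⟩ := h2 x (mem_chainsIn_univ x) trivial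
        exact ⟨r, b, hb⟩
    | succ n =>
      rw [augmentedComplex, homologyLength_moduleComplex_succ]
      refine length_quotient_eq_one _ (⟨z, hz⟩ : LinearMap.ker (boundary R n))
        (fun r hr ↦ ?_) fun x ↦ ?_
      · obtain ⟨b, hb⟩ := hr
        exact h1 r ⟨b, mem_chainsIn_univ b, hb⟩
      · obtain ⟨r, b, -, hb⟩ := h2 x.1 (mem_chainsIn_univ _) x.2
        exact ⟨r, b, hb⟩
  · rw [homologyLength_augmentedComplex_eq_zero_iff]
    exact h.1 i hi

lemma homologyLength_augmentedComplex_of_isEmpty [IsEmpty Y] (i : ℕ) :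
    homologyLength (augmentedComplex R Y) i = if i = 0 then 1 else 0 :=
  homologyLength_augmentedComplex_of_sphereLike
    (by rw [Set.univ_eq_empty_iff.2 ‹_›]; exact sphereLike_empty) i

lemma homologyLength_complex_zero [Nonempty Y] : homologyLength (complex R Y) 0 =
    homologyLength (augmentedComplex R Y) 1 + 1 := by
  rw [← homologyLength_complex_zero_add, homologyLength_augmentedComplex_zero, add_zero]

lemma nonempty_of_homologyLength_complex_zero_ne_zero (h : homologyLength (complex R Y) 0 ≠ 0) :
    Nonempty Y := by
  by_contra hY
  rw [not_nonempty_iff] at hY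
  have := homologyLength_complex_zero_add (R := R) (Y := Y)
  rw [homologyLength_augmentedComplex_of_isEmpty, homologyLength_augmentedComplex_of_isEmpty] at this
  simp only [if_true, one_ne_zero, if_false, zero_add] at this
  exact h (by simpa using this)

lemma homologyLength_complex_eq_iff {Z : Type u} [TopologicalSpace Z] [Nonempty Y] [Nonempty Z] :
    (∀ k, homologyLength (complex R Y) k = homologyLength (complex R Z) k) ↔
      ∀ i, homologyLength (augmentedComplex R Y) i = homologyLength (augmentedComplex R Z) i := by
  constructor
  · rintro h (_ | _ | i)
    · rw [homologyLength_augmentedComplex_zero, homologyLength_augmentedComplex_zero]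
    · have := h 0
      rw [homologyLength_complex_zero, homologyLength_complex_zero] at this
      simpa using this
    · simpa only [homologyLength_complex_succ] using h (i + 1)
  · rintro h (_ | k)
    · rw [homologyLength_complex_zero, homologyLength_complex_zero, h]
    · rw [homologyLength_complex_succ, homologyLength_complex_succ, h]

end

end SingularChain

/-! ### From lengths to isomorphisms of homology -/

section

open SingularChain

variable {p : ℕ} {Y Z : Type u} [TopologicalSpace Y] [TopologicalSpace Z]

lemma length_modPHomology (k : ℕ) : Module.length (ZMod p) (modPHomology p k (TopCat.of Y)) =
    homologyLength (complex (ZMod p) Y) k :=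
  (homologyLength_congr (complexIso (ZMod p) Y) k).symm

lemma SameModPHomology.homologyLength_eq (h : SameModPHomology p (TopCat.of Y) (TopCat.of Z))
    (k : ℕ) : homologyLength (complex (ZMod p) Y) k = homologyLength (complex (ZMod p) Z) k := by
  obtain ⟨e⟩ := h k
  rw [← length_modPHomology, ← length_modPHomology, e.toLinearEquiv.length_eq]

variable [Fact p.Prime]

/-- Vector spaces are classified by dimension, and length detects it when finite; `ℕ∞` does not
separate infinite dimensions. -/
lemma nonempty_iso_of_length_eq {M N : ModuleCat.{u} (ZMod p)}
    (h : Module.length (ZMod p) M = Module.length (ZMod p) N) (hM : Module.length (ZMod p) M ≠ ⊤) :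
    Nonempty (M ≅ N) := by
  have h1 : Module.Finite (ZMod p) M := by
    have := Module.length_ne_top_iff.1 hM
    exact (isFiniteLength_iff_isNoetherian_isArtinian.1 this).1.1 |> fun h ↦ ⟨h ⊤⟩
  have h2 : Module.Finite (ZMod p) N := by
    have := Module.length_ne_top_iff.1 (h ▸ hM)
    exact (isFiniteLength_iff_isNoetherian_isArtinian.1 this).1.1 |> fun h ↦ ⟨h ⊤⟩
  rw [Module.length_eq_finrank, Module.length_eq_finrank] at h
  exact ⟨(LinearEquiv.ofFinrankEq M N (by exact_mod_cast h)).toModuleIso⟩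

lemma sameModPHomology_of_homologyLength_eq [Nonempty Y] [Nonempty Z]
    (h : ∀ i, homologyLength (augmentedComplex (ZMod p) Y) i =
      homologyLength (augmentedComplex (ZMod p) Z) i)
    (hfin : ∀ i, homologyLength (augmentedComplex (ZMod p) Y) i ≠ ⊤) :
    SameModPHomology p (TopCat.of Y) (TopCat.of Z) := by
  intro k
  refine nonempty_iso_of_length_eq ?_ ?_
  · rw [length_modPHomology, length_modPHomology]
    exact homologyLength_complex_eq_iff.2 h k
  · rw [length_modPHomology]
    cases k with
    | zero =>
      rw [homologyLength_complex_zero]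
      exact by simpa using hfin 1
    | succ k =>
      rw [homologyLength_complex_succ]
      exact hfin _

lemma SameModPHomology.nonempty [Nonempty Z] (h : SameModPHomology p (TopCat.of Y) (TopCat.of Z)) :
    Nonempty Y := by
  refine nonempty_of_homologyLength_complex_zero_ne_zero (R := ZMod p) ?_
  rw [h.homologyLength_eq, homologyLength_complex_zero]
  simp

lemma SameModPHomology.homologyLength_augmentedComplex_eq [Nonempty Z]
    (h : SameModPHomology p (TopCat.of Y) (TopCat.of Z)) (i : ℕ) :
    homologyLength (augmentedComplex (ZMod p) Y) i =
      homologyLength (augmentedComplex (ZMod p) Z) i :=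
  have := h.nonempty
  homologyLength_complex_eq_iff.1 h.homologyLength_eq i

end

namespace SingularChain

/-! ### The Smith complex of a map of prime order -/

section

variable {p : ℕ} [Fact p.Prime] {Y : Type u} [TopologicalSpace Y] {g : C(Y, Y)}

lemma fixedSupported_simplexPerm (hg : ∀ y, g^[p] y = y) (n : ℕ) :
    fixedSupported (simplexPerm g hg n) (ZMod p) = chainsIn (ZMod p) {y | g y = y} n := by
  rw [fixedSupported, chainsIn]
  congr 1
  ext s
  change g.comp s = s ↔ Set.range s ⊆ {y | g y = y}
  rw [Set.range_subset_iff]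
  exact DFunLike.ext_iff

/-- The singular chains of a space with a map of order `p`. -/
noncomputable def smithData (hg : ∀ y, g^[p] y = y) :
    SmithData p (M := fun n ↦ SingularChain (ZMod p) Y n) (fun n ↦ boundary (ZMod p) n) where
  t n := permSubOne (simplexPerm g hg n) (ZMod p)
  F n := chainsIn (ZMod p) {y | g y = y} n
  d_d _ c := boundary_boundary c
  t_d n c := by
    change map (ZMod p) g n _ - _ = boundary (ZMod p) n (map (ZMod p) g (n + 1) c - c)
    rw [map_sub, map_boundary]
    rfl
  d_mem _ _ hc := boundary_mem_chainsIn hc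
  t_eq_zero n c hc := permSubOne_eq_zero_of_mem_fixedSupported
    (by rwa [fixedSupported_simplexPerm])
  eq_zero n c hc := range_permSubOne_pow_inf_fixedSupported one_ne_zero
    (by rwa [fixedSupported_simplexPerm hg]) ⟨c, by rw [pow_one]⟩
  t_pow n := sub_one_pow_prime (lmapDomain_pow_eq_one _ (simplexPerm_pow_eq_one hg n))
  exists_eq n j hj hjp c hc := by
    rw [← fixedSupported_simplexPerm hg]
    exact exists_eq_permSubOne_pow_add (simplexPerm_pow_eq_one hg n) hj hjp hc

lemma homologyLength_smithData_image_eq_zero (hg : ∀ y, g^[p] y = y) {n : ℕ}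
    (h : NormAcyclicAt p g Set.univ (n + 1)) :
    homologyLength ((smithData hg).image (p - 1)) (n + 1) = 0 := by
  rw [SmithData.image, homologyLength_moduleComplex_succ_eq_zero_iff]
  rintro ⟨_, c, rfl⟩ hc
  obtain ⟨b, -, hb⟩ := h c (mem_chainsIn_univ c) (congrArg Subtype.val hc)
  exact ⟨⟨_, b, rfl⟩, Subtype.ext hb⟩

/-- The chains in a subset are the chains of the subspace. -/
noncomputable def chainsInEquiv (S : Set Y) (n : ℕ) :
    SingularChain (ZMod p) S n ≃ₗ[ZMod p] chainsIn (ZMod p) S n :=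
  LinearEquiv.ofBijective ((map (ZMod p) (incl S) n).codRestrict _ fun c ↦
      map_mem_chainsIn (mapsTo_incl S) (mem_chainsIn_univ c))
    ⟨fun _ _ h ↦ map_injective Subtype.val_injective n (congrArg Subtype.val h),
      fun c ↦ (exists_map_eq c.2).imp fun _ h ↦ Subtype.ext h⟩

/-- The comparison of the complex of the fixed points with the fixed subcomplex. -/
noncomputable def smithDataFixedHom (hg : ∀ y, g^[p] y = y) :
    augmentedComplex (ZMod p) {y | g y = y} ⟶ (smithData hg).fixed :=
  moduleComplexHom (M' := fun n ↦ (smithData hg).F n)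
    (d' := fun n ↦ (boundary (ZMod p) n).restrict ((smithData hg).d_mem n))
    (fun _ c ↦ boundary_boundary c) (fun n x ↦ Subtype.ext ((smithData hg).d_d n x.1))
    (fun n ↦ (chainsInEquiv (p := p) {y | g y = y} n).toLinearMap)
    fun _ c ↦ Subtype.ext (map_boundary (incl _) c)

/-- The fixed subcomplex is the complex of the fixed points. -/
noncomputable def smithDataFixedIso (hg : ∀ y, g^[p] y = y) :
    augmentedComplex (ZMod p) {y | g y = y} ≅ (smithData hg).fixed :=
  HomologicalComplex.Hom.isoOfComponents
    (fun n ↦ (chainsInEquiv (p := p) {y | g y = y} n).toModuleIso) fun i j _ ↦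
    (smithDataFixedHom hg).comm i j

lemma homologyLength_smithData_fixed (hg : ∀ y, g^[p] y = y) (i : ℕ) :
    homologyLength (smithData hg).fixed i =
      homologyLength (augmentedComplex (ZMod p) {y | g y = y}) i :=
  (homologyLength_congr (smithDataFixedIso hg) i).symm

/-- An empty sphere would have its reduced homology in index `0` rather than `n + 1`; any simple
coefficient ring, such as `ZMod 2`, shows the contradiction. -/
lemma nonempty_sphere (n : ℕ) : Nonempty (TopCat.sphere.{u} n) := by
  by_contra h
  rw [not_nonempty_iff] at h
  have h1 := homologyLength_augmentedComplex_of_sphereLike (R := ZMod 2) (sphereLike_sphere.{u} n) 0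
  rw [homologyLength_augmentedComplex_of_isEmpty] at h1
  simp at h1

end

end SingularChain

/-! ### Homology spheres and acyclic spaces in terms of reduced homology -/

section

open SingularChain Topology.RelCWComplex

variable {X : Type u} [TopologicalSpace X]

lemma exists_skeletonLT_eq_univ [T2Space X] [Topology.CWComplex (Set.univ : Set X)]
    [Topology.CWComplex.FiniteDimensional (Set.univ : Set X)] :
    ∃ N : ℕ, (skeletonLT (Set.univ : Set X) N : Set X) = Set.univ := by
  obtain ⟨N, hN⟩ := Filter.eventually_atTop.1
    (Topology.RelCWComplex.FiniteDimensional.eventually_isEmpty_cell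
      (C := (Set.univ : Set X)) (D := ∅))
  refine ⟨N, Set.eq_univ_iff_forall.2 fun x ↦ ?_⟩
  have hx : x ∈ (Set.univ : Set X) := trivial
  rw [← Topology.CWComplex.iUnion_openCell_eq_complex (C := (Set.univ : Set X))] at hx
  simp only [Set.mem_iUnion] at hx
  obtain ⟨n, e, hx⟩ := hx
  refine Topology.CWComplex.mem_skeletonLT_iff.2 ⟨n, ?_, e, hx⟩
  by_contra hn
  exact (hN n (by simpa using hn)).elim e

variable {p : ℕ} [Fact p.Prime]

lemma IsModPHomologySphere.homologyLength_augmentedComplex_eq {n : ℕ}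
    (h : IsModPHomologySphere p n (TopCat.of X)) (i : ℕ) :
    homologyLength (augmentedComplex (ZMod p) X) i = if i = n + 1 then 1 else 0 :=
  have := nonempty_sphere.{u} n
  (SameModPHomology.homologyLength_augmentedComplex_eq (Z := TopCat.sphere.{u} n) h i).trans
    (homologyLength_augmentedComplex_of_sphereLike (sphereLike_sphere n) i)

lemma isModPHomologySphere_of_homologyLength_eq [Nonempty X] {n : ℕ}
    (h : ∀ i, homologyLength (augmentedComplex (ZMod p) X) i = if i = n + 1 then 1 else 0) :
    IsModPHomologySphere p n (TopCat.of X) := by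
  have := nonempty_sphere.{u} n
  refine sameModPHomology_of_homologyLength_eq (Z := TopCat.sphere.{u} n) (fun i ↦ ?_) fun i ↦ ?_
  · rw [h, homologyLength_augmentedComplex_of_sphereLike (sphereLike_sphere n)]
  · rw [h]
    split_ifs <;> simp

lemma homologyLength_augmentedComplex_punit {R : Type} [CommRing R] (i : ℕ) :
    homologyLength (augmentedComplex (R) PUnit.{u + 1}) i = 0 :=
  (homologyLength_augmentedComplex_eq_zero_iff i).2 (acyclicAt_univ_of_contractibleSpace i)

lemma isModPAcyclic_iff : IsModPAcyclic p (TopCat.of X) ↔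
    ∀ i, homologyLength (augmentedComplex (ZMod p) X) i = 0 := by
  constructor
  · intro h i
    rw [SameModPHomology.homologyLength_augmentedComplex_eq h,
      homologyLength_augmentedComplex_punit]
  · intro h
    have : Nonempty X := by
      by_contra hX
      rw [not_nonempty_iff] at hX
      simpa [homologyLength_augmentedComplex_of_isEmpty] using h 0
    refine sameModPHomology_of_homologyLength_eq (fun i ↦ ?_) fun i ↦ ?_
    · rw [h, homologyLength_augmentedComplex_punit]
    · simp [h]

end

lemma setOf_ofAdd_one_smul_eq {p : ℕ} [NeZero p] {X : Type*}
    [MulAction (Multiplicative (ZMod p)) X] :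
    {x : X | Multiplicative.ofAdd (1 : ZMod p) • x = x} =
      MulAction.fixedPoints (Multiplicative (ZMod p)) X := by
  ext x
  refine ⟨fun hx a ↦ ?_, fun hx ↦ hx _⟩
  have h : Multiplicative.ofAdd (1 : ZMod p) ∈ MulAction.stabilizer (Multiplicative (ZMod p)) x := hx
  have := pow_mem h a.toAdd.val
  rwa [← ofAdd_nsmul, nsmul_one, ZMod.natCast_zmod_val, ofAdd_toAdd] at this

theorem theorem4p1 (p : ℕ) [Fact p.Prime] (X : Type u) [TopologicalSpace X] [T2Space X]
    [Topology.CWComplex (Set.univ : Set X)]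
    [Topology.CWComplex.FiniteDimensional (Set.univ : Set X)]
    [MulAction (Multiplicative (ZMod p)) X] [ContinuousConstSMul (Multiplicative (ZMod p)) X]
    (hX : IsGCWComplex (Multiplicative (ZMod p)) X) :
    (∀ n : ℕ, IsModPHomologySphere p n (TopCat.of X) →
      MulAction.fixedPoints (Multiplicative (ZMod p)) X = ∅ ∨
        ∃ m : ℕ, IsModPHomologySphere p m
          (TopCat.of (MulAction.fixedPoints (Multiplicative (ZMod p)) X))) ∧
    (IsModPAcyclic p (TopCat.of X) →
      IsModPAcyclic p (TopCat.of (MulAction.fixedPoints (Multiplicative (ZMod p)) X))) := by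
  obtain ⟨N, hN⟩ := exists_skeletonLT_eq_univ (X := X)
  have hg : Multiplicative.ofAdd (1 : ZMod p) ^ p = 1 := by
    rw [← ofAdd_nsmul, nsmul_one, ZMod.natCast_self, ofAdd_zero]
  let D := SingularChain.smithData (g := smulMap (X := X) (Multiplicative.ofAdd (1 : ZMod p)))
    (smulMap_iterate hg)
  have hD : ∀ i, N + 1 ≤ i → homologyLength (D.image (p - 1)) i = 0 := by
    rintro (_ | i) hi
    · lia
    · refine SingularChain.homologyLength_smithData_image_eq_zero _ ?_
      rw [← hN]
      exact hX.normAcyclicAt_skeletonLT hg N (i + 1) (by lia)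
  have hF (i : ℕ) : homologyLength D.fixed i = homologyLength (SingularChain.augmentedComplex
      (ZMod p) (MulAction.fixedPoints (Multiplicative (ZMod p)) X)) i := by
    rw [← setOf_ofAdd_one_smul_eq]
    exact SingularChain.homologyLength_smithData_fixed _ i
  refine ⟨fun n h ↦ ?_, fun h ↦ ?_⟩
  · obtain hempty | hne :=
      (MulAction.fixedPoints (Multiplicative (ZMod p)) X).eq_empty_or_nonempty
    · exact Or.inl hempty
    have := hne.to_subtype
    have hT (i : ℕ) : homologyLength D.total i = if i = n + 1 then 1 else 0 :=
      h.homologyLength_augmentedComplex_eq i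
    obtain ⟨l, hl, hl'⟩ := D.exists_fixed_eq hD (m := n + 1)
      (fun i hi ↦ (hT i).trans (if_neg hi)) ((hT _).trans (if_pos rfl))
    rw [hF] at hl
    -- Homology in index `0` would mean an empty fixed set, the sphere of dimension `-1`; this case
    -- was split off above.
    obtain _ | m := l
    · rw [SingularChain.homologyLength_augmentedComplex_zero] at hl
      exact absurd hl zero_ne_one
    refine Or.inr ⟨m, isModPHomologySphere_of_homologyLength_eq fun i ↦ ?_⟩
    split_ifs with hi
    · rw [hi, hl]
    · rw [← hF, hl' i hi]
  · rw [isModPAcyclic_iff] at h ⊢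
    intro i
    rw [← hF]
    exact D.fixed_eq_zero hD h i
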